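/- **Setting.** Fix $p$, true values $\dot\beta\in\mathbb R^p$, $\dot\phi>0$, a covariance matrix $\dot G\in\mathbb R^{p\times p}$, and an exponential family $f(y\mid\eta,\phi)=\exp[\phi^{-1}\{y\eta-a(\eta)\}+c(y,\phi)]$ (canonical parameter $\eta\in\mathbb R$, density with respect to a $\sigma$-finite measure on $\mathbb R$, a probability density at $\phi=\dot\phi$ for every $\eta$). Consider a sequence of independent-cluster generalized linear mixed models: there are $m$ clusters, cluster $i$ has $n_i$ responses $y_{i1},\dots,y_{in_i}$ and deterministic covariates $x_{ij}\in\mathbb R^p$, which serve both the fixed and the random effects. The clusters are independent; $\dot b_i\sim N(0,\dot G)$; and given $\dot b_i$ the $y_{ij}$, $j\le n_i$, are independent with densities $f(\cdot\mid\dot\eta_{ij},\dot\phi)$, $\dot\eta_{ij}=x_{ij}^\top\dot\beta+x_{ij}^\top\dot b_i$. The quantities $m,n_i,x_{ij}$ and the random variables may depend on the stage of the sequence; write $n_L=\min_{i\le m}n_i$, $n=m^{-1}\sum_{i\le m}n_i$, and assume $m\to\infty$, $n_L\to\infty$ and $n_i=O(n_L)$ uniformly in $i\le m$. With a working covariance matrix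 $\hat G$ and a working dispersion $\hat\phi$ (possibly random), the penalized quasi-likelihood (PQL) estimator $(\hat\beta,\hat b_1,\dots,\hat b_m)$ is a (measurable) maximiser of $$Q(\beta,b)=\sum_{i=1}^m\sum_{j=1}^{n_i}\ln f(y_{ij}\mid x_{ij}^\top\beta+x_{ij}^\top b_i,\hat\phi)-\tfrac12\sum_{i=1}^m b_i^\top\hat G^{-1}b_i .$$ Let $X_i$ be the matrix with rows $x_{ij}^\top$, $\dot W_i=\hat\phi^{-1}\operatorname{diag}\{a''(\dot\eta_{ij})\}_j$, $\dot\mu_i=(a'(\dot\eta_{ij}))_j$, and $\dot H_i=(n_i^{-1}\hat\phi\dot\phi^{-1}X_i^\top\dot W_iX_i)^{-1}$, which is a function $\dot H_i(\dot b_i)$ of $\dot b_i$ not involving $\hat\phi$. **Conditions.** - (C1) $a$ is three times continuously differentiable on $\mathbb R$, and for some $c_0>0$: $c_0\le a''\le c_0^{-1}$ and $|a'''|\le c_0^{-1}$. - (C2) The $x_{ij}$ are uniformly bounded; the inverses $\dot H_i$, $i\le m$, exist from some stage on; for every $i$ and $N(0,\dot G)$-almost every $b$, $\dot H_i(b)\to\dot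 K_i(b)$; $m^{-1}\sum_{i\le m}n\,n_i^{-1}\dot H_i(\dot b_i)\to\dot K$ in probability, with $\dot K$ a constant matrix; and for some $c_1>0$, $\dot K$ and, for all $i$ and almost every $b$, $\dot K_i(b)$ are positive definite with eigenvalues in $[c_1,c_1^{-1}]$. - (C3) $(\dot\beta,\dot b_1,\dots,\dot b_m)$ is an interior point of some compact subset of $\mathbb R^{(m+1)p}$ (which may depend on the stage and on the realisation). - (C4) Almost surely $\hat G$ is positive definite and $\hat\phi>0$; $\hat G^{-1}=O_p(1)$ and $\hat\phi=O_p(1)$. - (C5) At every stage and for every $i\le m$, all components of $n_i^{1/2}(X_i^\top\dot W_iX_i+\hat G^{-1})^{-1}\{\hat\phi^{-1}X_i^\top(y_i-\dot\mu_i)-\hat G^{-1}\dot b_i\}$ have finite fourth moments. Let $\mathrm{mixN}(0,\dot K_i,F_{\dot b_i})$ denote the law of a random vector which, given $b\sim N(0,\dot G)$, is $N(0,\dot K_i(b))$-distributed, and let $*$ denote convolution of laws. **Theorem.** Assume (C1)–(C5) and $m/n_L^2\to0$. Then, unconditionally on the random effects, for each fixed $i$: (a) if $m/n_i\to\infty$,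 then $n_i^{1/2}(\hat b_i-\dot b_i)\overset{D}{\to}\mathrm{mixN}(0,\dot K_i,F_{\dot b_i})$; (b) if $m/n_i\to\gamma_i\in(0,\infty)$, then $n_i^{1/2}(\hat b_i-\dot b_i)\overset{D}{\to}\mathrm{mixN}(0,\dot K_i,F_{\dot b_i})*N(0,\gamma_i^{-1}\dot G)$; (c) if $m/n_i\to0$, then $m^{1/2}(\hat b_i-\dot b_i)\overset{D}{\to}N(0,\dot G)$. -/

import Mathlib

open MeasureTheory ProbabilityTheory Filter Topology
open scoped Matrix

noncomputable section

namespace PQL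

/-- The space of coefficient vectors. -/
abbrev Vec (p : ℕ) : Type := EuclideanSpace ℝ (Fin p)

/-- The population quantities of the mixed model: the functions `a`, `c` and the dominating
measure `ν` of the exponential family, and the true values of the dispersion parameter, of the
fixed effects and of the random effects covariance matrix. -/
structure Model (p : ℕ) where
  a : ℝ → ℝ
  c : ℝ → ℝ → ℝ
  ν : Measure ℝ
  φ : ℝ
  β : Vec p
  G : Matrix (Fin p) (Fin p) ℝ

/-- One design: `m` clusters, cluster `i < m` has `n i` measurements, and `x i j` with `j < n i`
is the covariate vector of measurement `j` of cluster `i`, for the fixed and the random effects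
alike. Values of `n` and `x` at other indices are never used. -/
structure Design (p : ℕ) where
  m : ℕ
  n : ℕ → ℕ
  x : ℕ → ℕ → Vec p

/-- The random effects `b i` and the responses `y i j`, as random variables on `Ω`. -/
structure Sample (p : ℕ) (Ω : Type*) where
  b : ℕ → Ω → Vec p
  y : ℕ → ℕ → Ω → ℝ

/-- The working covariance matrix and dispersion, and the estimators of the fixed and of the
random effects, as random variables on `Ω`. -/
structure Fit (p : ℕ) (Ω : Type*) where
  Ghat : Ω → Matrix (Fin p) (Fin p) ℝ
  φhat : Ω → ℝ
  βhat : Ω → Vec p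
  bhat : ℕ → Ω → Vec p

variable {p : ℕ}

namespace Design

/-- Minimum cluster size. -/
def nL (D : Design p) : ℕ := ⨅ i : Fin D.m, D.n i

/-- Average cluster size. -/
def nbar (D : Design p) : ℝ := (∑ i ∈ Finset.range D.m, (D.n i : ℝ)) / D.m

/-- The design matrix of cluster `i`. -/
def X (D : Design p) (i : ℕ) : Matrix (Fin (D.n i)) (Fin p) ℝ :=
  Matrix.of fun j k => D.x i j k

end Design

/-- The linear predictor with equal covariates for the fixed and the random effects. -/
def linPred (x β b : Vec p) : ℝ := inner ℝ x β + inner ℝ x b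

namespace Model

/-- The exponential family density at `y`, with canonical parameter `η` and dispersion `φ`. -/
def density (M : Model p) (φ η y : ℝ) : ℝ :=
  Real.exp (φ⁻¹ * (y * η - M.a η) + M.c y φ)

/-- The exponential family at the true dispersion consists of probability densities with respect
to `ν`, for all canonical parameters; the dispersion is positive and `G` is a covariance
matrix. -/
structure IsValid (M : Model p) : Prop where
  sigmaFinite : SigmaFinite M.ν
  measurable_c : Measurable fun y => M.c y M.φ
  φ_pos : 0 < M.φ
  lintegral_density : ∀ η, ∫⁻ y, ENNReal.ofReal (M.density M.φ η y) ∂M.ν = 1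
  posSemidef_G : M.G.PosSemidef

/-- The weight matrix `φ⁻¹ diag (a'' η)` of cluster `i` with random effect `b`, at the
dispersion `φ`. -/
def W (M : Model p) (D : Design p) (φ : ℝ) (i : ℕ) (b : Vec p) :
    Matrix (Fin (D.n i)) (Fin (D.n i)) ℝ :=
  φ⁻¹ • Matrix.diagonal fun j : Fin (D.n i) => iteratedDeriv 2 M.a (linPred (D.x i j) M.β b)

/-- The vector of conditional means of cluster `i` with random effect `b`. -/
def mean (M : Model p) (D : Design p) (i : ℕ) (b : Vec p) : Fin (D.n i) → ℝ :=
  fun j => deriv M.a (linPred (D.x i j) M.β b)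

/-- The normalised information matrix of cluster `i` with random effect `b`, at the true
dispersion. -/
def info (M : Model p) (D : Design p) (i : ℕ) (b : Vec p) : Matrix (Fin p) (Fin p) ℝ :=
  (D.n i : ℝ)⁻¹ • ((D.X i)ᵀ * M.W D M.φ i b * D.X i)

/-- The inverse of the normalised information matrix. -/
def H (M : Model p) (D : Design p) (i : ℕ) (b : Vec p) : Matrix (Fin p) (Fin p) ℝ :=
  (M.info D i b)⁻¹

/-- The PQL objective function, given the responses `y`, the working covariance matrix `G` and
the working dispersion `φ`. -/
def objective (M : Model p) (D : Design p) (y : ℕ → ℕ → ℝ) (G : Matrix (Fin p) (Fin p) ℝ)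
    (φ : ℝ) (β : Vec p) (b : ℕ → Vec p) : ℝ :=
  (∑ i ∈ Finset.range D.m, ∑ j ∈ Finset.range (D.n i),
      Real.log (M.density φ (linPred (D.x i j) β (b i)) (y i j)))
    - 1 / 2 * ∑ i ∈ Finset.range D.m, WithLp.ofLp (b i) ⬝ᵥ (G⁻¹ *ᵥ WithLp.ofLp (b i))

end Model

/-- The sample follows the independent-cluster generalized linear mixed model: the clusters are
independent, `b i` is `N(0, G)`, and given `b i` the responses of cluster `i` are independent with
the exponential family density at their linear predictors. -/
structure IsGLMM {Ω : Type*} [MeasurableSpace Ω] (P : Measure Ω) (M : Model p) (D : Design p)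
    (S : Sample p Ω) : Prop where
  measurable_b : ∀ i, Measurable (S.b i)
  measurable_y : ∀ i j, Measurable (S.y i j)
  indep : iIndepFun
    (fun (i : Fin D.m) ω => (S.b i ω, fun j : Fin (D.n i) => S.y i j ω)) P
  law : ∀ i < D.m, P.map (fun ω => (S.b i ω, fun j : Fin (D.n i) => S.y i j ω)) =
    ((multivariateGaussian 0 M.G).prod (Measure.pi fun _ : Fin (D.n i) => M.ν)).withDensity
      fun q => ∏ j : Fin (D.n i),
        ENNReal.ofReal (M.density M.φ (linPred (D.x i j) M.β q.1) (q.2 j))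

/-- The estimators jointly maximise the PQL objective at the working covariance matrix and
dispersion. -/
structure IsPQL {Ω : Type*} [MeasurableSpace Ω] (P : Measure Ω) (M : Model p) (D : Design p)
    (S : Sample p Ω) (F : Fit p Ω) : Prop where
  measurable_Ghat : ∀ k l, Measurable fun ω => F.Ghat ω k l
  measurable_φhat : Measurable F.φhat
  measurable_βhat : Measurable F.βhat
  measurable_bhat : ∀ i, Measurable (F.bhat i)
  isMax : ∀ᵐ ω ∂P, ∀ (β : Vec p) (b : ℕ → Vec p),
    M.objective D (fun i j => S.y i j ω) (F.Ghat ω) (F.φhat ω) β b ≤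
      M.objective D (fun i j => S.y i j ω) (F.Ghat ω) (F.φhat ω) (F.βhat ω)
        (fun i => F.bhat i ω)

section Asymptotics

variable {Ω : ℕ → Type*} [∀ t, MeasurableSpace (Ω t)]

/-- `Z t = O_p(1)` as `t → ∞`. -/
def StochBounded (P : ∀ t, Measure (Ω t)) (Z : ∀ t, Ω t → ℝ) : Prop :=
  ∀ ε : ENNReal, 0 < ε → ∃ B : ℝ, ∀ᶠ t in atTop, P t {ω | B < |Z t ω|} ≤ ε

/-- `Z t` converges to the constant `z` in probability as `t → ∞`. -/
def TendstoInProb (P : ∀ t, Measure (Ω t)) (Z : ∀ t, Ω t → ℝ) (z : ℝ) : Prop :=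
  ∀ ε : ℝ, 0 < ε → Tendsto (fun t => P t {ω | ε ≤ |Z t ω - z|}) atTop (𝓝 0)

/-- `Z t` converges in distribution to the probability measure `μ` as `t → ∞`. -/
def TendstoInLaw (P : ∀ t, Measure (Ω t)) [∀ t, IsProbabilityMeasure (P t)]
    (Z : ∀ t, Ω t → Vec p) (μ : Measure (Vec p)) : Prop :=
  ∃ _ : IsProbabilityMeasure μ, TendstoInDistribution Z atTop id P μ

/-- The normal mixture: the law of a vector that, given `b` with law `F`, is normal with mean
`mean b` and covariance matrix `cov b`. -/
def mixN (mean : Vec p → Vec p) (cov : Vec p → Matrix (Fin p) (Fin p) ℝ)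
    (F : Measure (Vec p)) : Measure (Vec p) :=
  F.bind fun b => multivariateGaussian (mean b) (cov b)

/-- Positive definite with all eigenvalues between `c` and `c⁻¹`. -/
def EigenBounded (c : ℝ) (A : Matrix (Fin p) (Fin p) ℝ) : Prop :=
  A.PosDef ∧ ∀ μ ∈ spectrum ℝ A, c ≤ μ ∧ μ ≤ c⁻¹

/-- Growth of the designs: the number of clusters and the minimum cluster size tend to infinity,
and the cluster sizes are uniformly of the order of the smallest one. -/
structure Growth (D : ℕ → Design p) : Prop where
  m_tendsto : Tendsto (fun t => (D t).m) atTop atTop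
  nL_tendsto : Tendsto (fun t => (D t).nL) atTop atTop
  balanced : ∃ C : ℝ, ∀ᶠ t in atTop, ∀ i < (D t).m, ((D t).n i : ℝ) ≤ C * (D t).nL

def C1 (M : Model p) : Prop :=
  ContDiff ℝ 3 M.a ∧ ∃ c₀ : ℝ, 0 < c₀ ∧ ∀ η,
    c₀ ≤ iteratedDeriv 2 M.a η ∧ iteratedDeriv 2 M.a η ≤ c₀⁻¹ ∧ |iteratedDeriv 3 M.a η| ≤ c₀⁻¹

/-- `K i b` is the limit of the matrices `H` of cluster `i` when its random effect is `b`; as the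
random effects are random, this limit is taken for almost every `b`, and the limit of the averages
is taken in probability. -/
structure C2 (P : ∀ t, Measure (Ω t)) (M : Model p) (D : ℕ → Design p)
    (S : ∀ t, Sample p (Ω t)) (K : ℕ → Vec p → Matrix (Fin p) (Fin p) ℝ)
    (Kbar : Matrix (Fin p) (Fin p) ℝ) : Prop where
  bounded_x : ∃ C₁ : ℝ, ∀ t, ∀ i < (D t).m, ∀ j < (D t).n i, ∀ k, |(D t).x i j k| < C₁
  info_invertible : ∀ᶠ t in atTop, ∀ i < (D t).m, ∀ b, IsUnit (M.info (D t) i b)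
  tendsto_H : ∀ i, ∀ᵐ b ∂(multivariateGaussian 0 M.G),
    Tendsto (fun t => M.H (D t) i b) atTop (𝓝 (K i b))
  tendsto_avg : ∀ k l, TendstoInProb P
    (fun t ω => (((D t).m : ℝ)⁻¹ • ∑ i ∈ Finset.range (D t).m,
      ((D t).nbar / (D t).n i) • M.H (D t) i ((S t).b i ω)) k l) (Kbar k l)
  eigen : ∃ c₁ : ℝ, 0 < c₁ ∧ EigenBounded c₁ Kbar ∧
    ∀ i, ∀ᵐ b ∂(multivariateGaussian 0 M.G), EigenBounded c₁ (K i b)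

/-- The vector of all true fixed and random effects is an interior point of some compact set of
parameter vectors; the set may depend on the stage and on the realised random effects. -/
def C3 (M : Model p) (D : ℕ → Design p) (S : ∀ t, Sample p (Ω t)) : Prop :=
  ∀ t ω, ∃ Θ : Set (Vec p × (Fin (D t).m → Vec p)), IsCompact Θ ∧
    (M.β, fun i : Fin (D t).m => (S t).b i ω) ∈ interior Θ

structure C4 (P : ∀ t, Measure (Ω t)) (F : ∀ t, Fit p (Ω t)) : Prop where
  posDef_Ghat : ∀ t, ∀ᵐ ω ∂(P t), ((F t).Ghat ω).PosDef
  bounded_Ghat_inv : ∀ k l, StochBounded P fun t ω => ((F t).Ghat ω)⁻¹ k l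
  φhat_pos : ∀ t, ∀ᵐ ω ∂(P t), 0 < (F t).φhat ω
  bounded_φhat : StochBounded P fun t ω => (F t).φhat ω

/-- The normalised score of cluster `i`, whose fourth moments are required to be finite. -/
def normScore {Ω : Type*} (M : Model p) (D : Design p) (S : Sample p Ω) (F : Fit p Ω) (i : ℕ)
    (ω : Ω) : Fin p → ℝ :=
  √(D.n i : ℝ) • (((D.X i)ᵀ * M.W D (F.φhat ω) i (S.b i ω) * D.X i + (F.Ghat ω)⁻¹)⁻¹ *ᵥ
    ((F.φhat ω)⁻¹ • ((D.X i)ᵀ *ᵥ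
        ((fun j : Fin (D.n i) => S.y i j ω) - M.mean D i (S.b i ω)))
      - (F.Ghat ω)⁻¹ *ᵥ WithLp.ofLp (S.b i ω)))

def C5 (P : ∀ t, Measure (Ω t)) (M : Model p) (D : ℕ → Design p)
    (S : ∀ t, Sample p (Ω t)) (F : ∀ t, Fit p (Ω t)) : Prop :=
  ∀ t, ∀ i < (D t).m, ∀ k,
    ∫⁻ ω, ENNReal.ofReal (normScore M (D t) (S t) (F t) i ω k ^ 4) ∂(P t) < ⊤

end Asymptotics

end PQL

end

/-! The fixed and random effects share their covariates, so the likelihood depends only on the sums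
`β + b i`. Moving a common vector between `β` and all the `b i` alters nothing but the penalty,
hence at a maximiser the predicted random effects sum to zero (`Model.sum_eq_zero_of_isMax`). Let ε
be the error of the estimated `β` and δ_i the error of the estimated `β + b i` (`coefDev`). Then m ε
= Σ δ_k + Σ b_k, so the prediction error of cluster i is δ_i − m⁻¹ Σ δ_k − m⁻¹ Σ b_k. Here δ_i has
order n_i^(-1/2), the last average is exactly Gaussian with covariance G / m, and which of the two
dominates decides between the three regimes.

Each δ_i is compared with z_i (`Sample.dev`), the unpenalised Newton step from the truth. The score
equation tested against δ_i bounds the size of δ_i, and tested against δ_i − z_i it bounds the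
linearisation error by O(1/n_L) (`ClusterScore.energy_le`, `ClusterScore.norm_sub_le`). Both bounds
involve ε through the penalty; `norm_fixed_sq_le` removes it by absorption. The average m⁻¹ Σ z_k
consists of independent centred terms, so it has order (m n_L)^(-1/2) and is negligible. The
curvature constants of the clusters are bounded only on average, but they concern the covariates
alone, so they can be chosen deterministic (`C2.exists_curvature`) and moved outside expectations.

For the limit law, exponential tilting gives moment bounds uniform in the canonical parameter. Given
b_i, the characteristic function of √n_i z_i is then Gaussian up to O(n_i^(-1/2)), and dominated
convergence over b_i produces the mixture. Removing b_i from m⁻¹ Σ b_k costs O_p(1/m) and leaves a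
sum independent of z_i, so characteristic functions multiply
(`IsGLMM.integral_exp_inner_dev_sub_sum`). At scale √n_i the Gaussian factor has covariance lim
n_i/m times G. At scale √m with m/n_i → 0 the term z_i disappears, and m/n_L² → 0 makes the
linearisation error vanish. -/

noncomputable section
namespace PQL

/-! ### Deterministic estimates from the penalised score equations. -/

section Deterministic

set_option linter.unusedSectionVars false

variable {E : Type*} [NormedAddCommGroup E] [InnerProductSpace ℝ E] {J : Type*} [Fintype J]

/-- The squared length of the vector of linear predictors `⟪x j, v⟫`. -/
def energy (x : J → E) (v : E) : ℝ := ∑ j, inner ℝ (x j) v ^ 2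

lemma energy_nonneg (x : J → E) (v : E) : 0 ≤ energy x v :=
  Finset.sum_nonneg fun _ _ => sq_nonneg _

/-- Young's inequality termwise. The share `c / 2` of the energy of `v` is what strong monotonicity
can absorb when `v` is the deviation. -/
lemma sum_mul_inner_mul_inner_le {x : J → E} {w : J → ℝ} {c : ℝ} (hc : 0 < c)
    (hw₀ : ∀ j, 0 ≤ w j) (hw : ∀ j, w j ≤ c⁻¹) (u v : E) :
    ∑ j, w j * inner ℝ (x j) u * inner ℝ (x j) v ≤
      c / 2 * energy x v + (c ^ 3)⁻¹ / 2 * energy x u := by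
  rw [energy, energy, Finset.mul_sum, Finset.mul_sum, ← Finset.sum_add_distrib]
  refine Finset.sum_le_sum fun j _ => ?_
  set s := inner ℝ (x j) u
  set t := inner ℝ (x j) v
  have h1 : w j ^ 2 ≤ (c ^ 2)⁻¹ := by
    rw [← inv_pow]; exact pow_le_pow_left₀ (hw₀ j) (hw j) 2
  have h2 : w j ^ 2 * s ^ 2 ≤ (c ^ 2)⁻¹ * s ^ 2 := mul_le_mul_of_nonneg_right h1 (sq_nonneg _)
  have h3 : (c ^ 3)⁻¹ = c⁻¹ * (c ^ 2)⁻¹ := by field_simp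
  have h4 : 0 ≤ c⁻¹ * (c * t - w j * s) ^ 2 := by positivity
  have h5 : c⁻¹ * (c * t - w j * s) ^ 2 =
      c * t ^ 2 - 2 * (w j * s * t) + c⁻¹ * (w j ^ 2 * s ^ 2) := by field_simp; ring
  have h6 := mul_le_mul_of_nonneg_left h2 (inv_pos.2 hc).le
  rw [h3]
  nlinarith

variable {Λ : E →ₗ[ℝ] E →ₗ[ℝ] ℝ} {lam : ℝ}

lemma bilin_sub_le (hΛs : ∀ u v, Λ u v = Λ v u) (hΛ : ∀ v, 0 ≤ Λ v v)
    (hlam : ∀ v, Λ v v ≤ lam * ‖v‖ ^ 2) (u v : E) :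
    Λ (u - v) (u - v) ≤ 2 * lam * (‖u‖ ^ 2 + ‖v‖ ^ 2) := by
  have h := hΛ (u + v)
  have h1 := hlam u
  have h2 := hlam v
  have h3 := hΛs u v
  simp only [map_add, map_sub, LinearMap.add_apply, LinearMap.sub_apply] at h ⊢
  linarith

lemma bilin_sq_le (hΛs : ∀ u v, Λ u v = Λ v u) (hΛ : ∀ v, 0 ≤ Λ v v) (u v : E) :
    Λ u v ^ 2 ≤ Λ u u * Λ v v :=
  LinearMap.BilinForm.apply_sq_le_of_symm Λ hΛ ⟨hΛs⟩ u v

/-- The data of one cluster at the penalised maximiser. The maximiser deviates by `δ` from the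
true coefficient, `z` is the linearised deviation and `b + δ - ε` the predicted random effect. -/
structure ClusterScore (x : J → E) (g : ℝ → ℝ) (η w e : J → ℝ) (Λ : E →ₗ[ℝ] E →ₗ[ℝ] ℝ)
    (c : ℝ) (b ε δ z : E) : Prop where
  score : ∀ v, ∑ j, e j * inner ℝ (x j) v
    - ∑ j, (g (η j + inner ℝ (x j) δ) - g (η j)) * inner ℝ (x j) v = Λ (b + δ - ε) v
  linearised : ∀ v, ∑ j, e j * inner ℝ (x j) v =
    ∑ j, w j * inner ℝ (x j) z * inner ℝ (x j) v
  le_weight : ∀ j, c ≤ w j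
  weight_le : ∀ j, w j ≤ c⁻¹
  monotone : ∀ j h, c * h ^ 2 ≤ (g (η j + h) - g (η j)) * h
  taylor : ∀ j h, |g (η j + h) - g (η j) - w j * h| ≤ c⁻¹ * h ^ 2

/-- The bound on the energy of the deviation of one cluster. -/
def energyBound (c lam q : ℝ) (b ε : E) : ℝ := (c ^ 3)⁻¹ * q + 2 * lam * (‖b‖ ^ 2 + ‖ε‖ ^ 2)

variable {x : J → E} {g : ℝ → ℝ} {η w e : J → ℝ} {c : ℝ} {b ε δ z : E}

/-- Test the score equation against `δ` itself. Monotonicity yields `c * energy x δ`; the noise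
takes at most half of it by Young's inequality, and the cross term `Λ (b - ε) δ` takes at most half
of `Λ δ δ`. Doubling what is left gives the bound. -/
lemma ClusterScore.energy_le (h : ClusterScore x g η w e Λ c b ε δ z) (hc : 0 < c)
    (hΛs : ∀ u v, Λ u v = Λ v u) (hΛ : ∀ v, 0 ≤ Λ v v)
    (hlam : ∀ v, Λ v v ≤ lam * ‖v‖ ^ 2) :
    c * energy x δ + Λ δ δ ≤ energyBound c lam (energy x z) b ε := by
  have h1 := h.score δ
  rw [h.linearised δ] at h1
  have h2 := sum_mul_inner_mul_inner_le (x := x) hc (fun j => hc.le.trans (h.le_weight j))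
    h.weight_le z δ
  have h3 : c * energy x δ ≤
      ∑ j, (g (η j + inner ℝ (x j) δ) - g (η j)) * inner ℝ (x j) δ := by
    rw [energy, Finset.mul_sum]
    exact Finset.sum_le_sum fun j _ => h.monotone j _
  have h4 : Λ (b + δ - ε) δ = Λ (b - ε) δ + Λ δ δ := by
    rw [show b + δ - ε = (b - ε) + δ by abel, map_add, LinearMap.add_apply]
  have h5 := hΛ ((b - ε) + δ)
  rw [map_add Λ, LinearMap.add_apply, map_add, map_add, hΛs δ (b - ε)] at h5
  have h6 := bilin_sub_le hΛs hΛ hlam b ε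
  rw [energyBound]
  linarith

/-- Test the score equation against `d = δ - z`. The linear parts combine to the weighted energy of
`d`, leaving the Taylor remainder, quadratic in `δ`, and the penalty. Both are bounded by a multiple
of `‖d‖`, while the curvature hypothesis turns the energy of `d` into `n * ‖d‖ ^ 2`; one factor
`‖d‖` cancels. -/
lemma ClusterScore.norm_sub_le (h : ClusterScore x g η w e Λ c b ε δ z) (hc : 0 < c)
    (hΛs : ∀ u v, Λ u v = Λ v u) (hΛ : ∀ v, 0 ≤ Λ v v)
    (hlam : ∀ v, Λ v v ≤ lam * ‖v‖ ^ 2) (hlam₀ : 0 ≤ lam) {Cx n κ : ℝ} (hCx : 0 ≤ Cx)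
    (hx : ∀ j, ‖x j‖ ≤ Cx) (hκ₀ : 0 ≤ κ)
    (hκ : ∀ v, n * ‖v‖ ^ 2 ≤ κ * energy x v) :
    n * ‖δ - z‖ ≤
      κ * (c⁻¹ * ((Cx * (c ^ 2)⁻¹ + 1) * energyBound c lam (energy x z) b ε + lam)) := by
  set τ := energyBound c lam (energy x z) b ε with hτ
  have hE := h.energy_le hc hΛs hΛ hlam
  rw [← hτ] at hE
  set d := δ - z with hd
  have hτ₀ : 0 ≤ τ := by
    have := energy_nonneg x z
    rw [hτ, energyBound]; positivity
  have hδ : energy x δ ≤ c⁻¹ * τ := by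
    rw [← div_eq_inv_mul, le_div_iff₀ hc]
    linarith [hΛ δ]
  have hδΛ : Λ δ δ ≤ τ := by nlinarith [energy_nonneg x δ]
  have hbΛ : Λ (b - ε) (b - ε) ≤ τ := by
    refine (bilin_sub_le hΛs hΛ hlam b ε).trans ?_
    rw [hτ, energyBound]
    have : 0 ≤ (c ^ 3)⁻¹ * energy x z := mul_nonneg (by positivity) (energy_nonneg x z)
    linarith
  have hbh : Λ (b + δ - ε) (b + δ - ε) ≤ 4 * τ := by
    have h5 := hΛ ((b - ε) - δ)
    rw [show b + δ - ε = (b - ε) + δ by abel]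
    simp only [map_add, map_sub, LinearMap.add_apply, LinearMap.sub_apply] at h5 hbΛ ⊢
    linarith
  -- Cauchy–Schwarz for `Λ` gives the factor `√(4 * τ * lam)`, which is at most `τ + lam`.
  have hpen : |Λ (b + δ - ε) d| ≤ (τ + lam) * ‖d‖ := by
    refine abs_le_of_sq_le_sq ?_ (by positivity)
    calc Λ (b + δ - ε) d ^ 2 ≤ Λ (b + δ - ε) (b + δ - ε) * Λ d d := bilin_sq_le hΛs hΛ _ _
      _ ≤ (4 * τ) * (lam * ‖d‖ ^ 2) := by
          exact mul_le_mul hbh (hlam d) (hΛ d) (by positivity)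
      _ ≤ ((τ + lam) * ‖d‖) ^ 2 := by
          rw [mul_pow]
          nlinarith [sq_nonneg (τ - lam), sq_nonneg ‖d‖,
            mul_nonneg (sq_nonneg (τ - lam)) (sq_nonneg ‖d‖)]
  -- The bracket added at the end vanishes by the score equation; with it, the identity holds term
  -- by term.
  have hid : ∑ j, w j * inner ℝ (x j) d ^ 2 =
      ∑ j, -((g (η j + inner ℝ (x j) δ) - g (η j) - w j * inner ℝ (x j) δ) * inner ℝ (x j) d)
        - Λ (b + δ - ε) d +
      (Λ (b + δ - ε) d - (∑ j, e j * inner ℝ (x j) d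
        - ∑ j, (g (η j + inner ℝ (x j) δ) - g (η j)) * inner ℝ (x j) d)) := by
    rw [h.linearised d, sub_add_sub_cancel, ← Finset.sum_sub_distrib, ← Finset.sum_sub_distrib]
    refine Finset.sum_congr rfl fun j _ => ?_
    have : inner ℝ (x j) d = inner ℝ (x j) δ - inner ℝ (x j) z := by rw [hd, inner_sub_right]
    rw [this]; ring
  rw [h.score d, sub_self, add_zero] at hid
  have hrem : ∑ j, -((g (η j + inner ℝ (x j) δ) - g (η j) - w j * inner ℝ (x j) δ)
      * inner ℝ (x j) d) ≤ c⁻¹ * energy x δ * (Cx * ‖d‖) := by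
    rw [energy, Finset.mul_sum, Finset.sum_mul]
    refine Finset.sum_le_sum fun j _ => (neg_le_abs _).trans ?_
    rw [abs_mul]
    refine mul_le_mul (h.taylor j _) ?_ (abs_nonneg _) (by positivity)
    exact (abs_real_inner_le_norm _ _).trans (mul_le_mul_of_nonneg_right (hx j) (norm_nonneg _))
  have hlow : c * energy x d ≤ ∑ j, w j * inner ℝ (x j) d ^ 2 := by
    rw [energy, Finset.mul_sum]
    exact Finset.sum_le_sum fun j _ => mul_le_mul_of_nonneg_right (h.le_weight j) (sq_nonneg _)
  have hmain : c * energy x d ≤ ((Cx * (c ^ 2)⁻¹ + 1) * τ + lam) * ‖d‖ := by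
    have h1 : c⁻¹ * energy x δ * (Cx * ‖d‖) ≤ c⁻¹ * (c⁻¹ * τ) * (Cx * ‖d‖) := by gcongr
    have h2 : c⁻¹ * (c⁻¹ * τ) * (Cx * ‖d‖) = Cx * (c ^ 2)⁻¹ * τ * ‖d‖ := by
      field_simp
    have := neg_le_abs (Λ (b + δ - ε) d)
    linarith
  have h3 := hκ d
  have h4 : energy x d ≤ c⁻¹ * (((Cx * (c ^ 2)⁻¹ + 1) * τ + lam) * ‖d‖) := by
    rw [← div_eq_inv_mul, le_div_iff₀ hc]
    linarith
  rcases eq_or_lt_of_le (norm_nonneg d) with h0 | h0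
  · rw [← h0, mul_zero]; positivity
  · have h5 := h3.trans (mul_le_mul_of_nonneg_left h4 hκ₀)
    refine le_of_mul_le_mul_right ?_ h0
    nlinarith

/-- The bound on the estimation error of the fixed effects. -/
def fixedBound (c L : ℝ) : ℝ := 4 * ((c ^ 3)⁻¹ * L + 2 * L ^ 2) + 4 * L

/-- The bound on the linearisation error. -/
def linBound (c C L : ℝ) : ℝ :=
  c⁻¹ * (C * ((c ^ 3)⁻¹ * L + 2 * L * (L + L * fixedBound c L)) + L * L)

variable {m : ℕ} {N L C : ℝ} {κ q : ℕ → ℝ} {b δ z : ℕ → E}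

/-- The constants `κ i` need not be bounded individually, so they are kept as weights inside every
average. -/
lemma sum_mul_energyBound_le (hc : 0 < c) (hm : 0 < m) (hlam₀ : 0 ≤ lam) (hlam : lam ≤ L)
    (hκ : ∑ i ∈ Finset.range m, κ i ≤ L * m)
    (hκq : ∑ i ∈ Finset.range m, κ i * q i ≤ L * m)
    (hκb : ∑ i ∈ Finset.range m, κ i * ‖b i‖ ^ 2 ≤ L * m) :
    ∑ i ∈ Finset.range m, κ i * energyBound c lam (q i) (b i) ε ≤
      ((c ^ 3)⁻¹ * L + 2 * L * (L + L * ‖ε‖ ^ 2)) * m := by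
  have hL : 0 ≤ L := hlam₀.trans hlam
  have hm' : (0 : ℝ) < m := by exact_mod_cast hm
  have h1 : ∑ i ∈ Finset.range m, κ i * energyBound c lam (q i) (b i) ε =
      (c ^ 3)⁻¹ * ∑ i ∈ Finset.range m, κ i * q i
      + 2 * lam * (∑ i ∈ Finset.range m, κ i * ‖b i‖ ^ 2
        + ‖ε‖ ^ 2 * ∑ i ∈ Finset.range m, κ i) := by
    simp only [Finset.mul_sum, ← Finset.sum_add_distrib, energyBound]
    exact Finset.sum_congr rfl fun i _ => by ring
  rw [h1]
  have h2 : (c ^ 3)⁻¹ * ∑ i ∈ Finset.range m, κ i * q i ≤ (c ^ 3)⁻¹ * (L * m) := by gcongr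
  have h3 : 2 * lam * (∑ i ∈ Finset.range m, κ i * ‖b i‖ ^ 2
        + ‖ε‖ ^ 2 * ∑ i ∈ Finset.range m, κ i) ≤ 2 * lam * (L * m + ‖ε‖ ^ 2 * (L * m)) := by
    gcongr
  have h4 : 2 * lam * (L * m + ‖ε‖ ^ 2 * (L * m)) ≤ 2 * L * (L * m + ‖ε‖ ^ 2 * (L * m)) := by
    gcongr
  nlinarith

lemma norm_sum_sq_le_card_mul (s : Finset ℕ) (v : ℕ → E) :
    ‖∑ i ∈ s, v i‖ ^ 2 ≤ s.card * ∑ i ∈ s, ‖v i‖ ^ 2 :=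
  (pow_le_pow_left₀ (norm_nonneg _) (norm_sum_le _ _) 2).trans sq_sum_le_card_mul_sum_sq

/-- A self-consistent bound: `ε` is an average of deviations and random effects, while the
deviations are bounded in terms of `‖ε‖ ^ 2` with a factor of order `1 / N`. For large `N` this
contribution is absorbed into the left-hand side. -/
lemma norm_fixed_sq_le (hc : 0 < c) (hm : 0 < m) (hlam₀ : 0 ≤ lam) (hlam : lam ≤ L)
    (hκ : ∑ i ∈ Finset.range m, κ i ≤ L * m)
    (hκq : ∑ i ∈ Finset.range m, κ i * q i ≤ L * m)
    (hκb : ∑ i ∈ Finset.range m, κ i * ‖b i‖ ^ 2 ≤ L * m)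
    (hb : ∑ i ∈ Finset.range m, ‖b i‖ ^ 2 ≤ L * m)
    (hN1 : 1 ≤ c * N) (hN : 8 * L ^ 2 ≤ c * N)
    (hδ : ∀ i < m, N * ‖δ i‖ ^ 2 ≤ κ i * (c⁻¹ * energyBound c lam (q i) (b i) ε))
    (hε : (m : ℝ) • ε = ∑ i ∈ Finset.range m, δ i + ∑ i ∈ Finset.range m, b i) :
    ‖ε‖ ^ 2 ≤ fixedBound c L := by
  have hL : 0 ≤ L := hlam₀.trans hlam
  have hm' : (0 : ℝ) < m := by exact_mod_cast hm
  have hS := sum_mul_energyBound_le (ε := ε) hc hm hlam₀ hlam hκ hκq hκb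
  set T := (c ^ 3)⁻¹ * L + 2 * L * (L + L * ‖ε‖ ^ 2) with hT
  have h1 : c * N * ∑ i ∈ Finset.range m, ‖δ i‖ ^ 2 ≤ T * m := by
    refine le_trans ?_ hS
    rw [Finset.mul_sum]
    refine Finset.sum_le_sum fun i hi => ?_
    have := mul_le_mul_of_nonneg_left (hδ i (Finset.mem_range.1 hi)) hc.le
    calc c * N * ‖δ i‖ ^ 2 = c * (N * ‖δ i‖ ^ 2) := by ring
      _ ≤ _ := this
      _ = _ := by field_simp
  have h2 := norm_sum_sq_le_card_mul (Finset.range m) δ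
  have h3 := norm_sum_sq_le_card_mul (Finset.range m) b
  rw [Finset.card_range] at h2 h3
  have h4 : ‖(m : ℝ) • ε‖ ^ 2 ≤
      2 * ‖∑ i ∈ Finset.range m, δ i‖ ^ 2 + 2 * ‖∑ i ∈ Finset.range m, b i‖ ^ 2 := by
    rw [hε]
    have := norm_add_le (∑ i ∈ Finset.range m, δ i) (∑ i ∈ Finset.range m, b i)
    have h5 := pow_le_pow_left₀ (norm_nonneg _) this 2
    nlinarith [sq_nonneg (‖∑ i ∈ Finset.range m, δ i‖ - ‖∑ i ∈ Finset.range m, b i‖)]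
  rw [norm_smul, mul_pow, Real.norm_natCast] at h4
  set Sδ := ∑ i ∈ Finset.range m, ‖δ i‖ ^ 2
  have h5 : (m : ℝ) ^ 2 * ‖ε‖ ^ 2 ≤ 2 * (m * Sδ) + 2 * (m * (L * m)) := by
    have := mul_le_mul_of_nonneg_left hb hm'.le
    linarith
  have h6 : m * ‖ε‖ ^ 2 ≤ 2 * Sδ + 2 * (L * m) := by
    refine le_of_mul_le_mul_left ?_ hm'
    nlinarith
  have h7 : c * N * ‖ε‖ ^ 2 ≤ 2 * T + 2 * (c * N * L) := by
    refine le_of_mul_le_mul_left ?_ hm'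
    have : 0 ≤ c * N := by linarith
    nlinarith [mul_le_mul_of_nonneg_left h6 this]
  have hT' : 2 * T = 2 * ((c ^ 3)⁻¹ * L + 2 * L ^ 2) + 4 * L ^ 2 * ‖ε‖ ^ 2 := by rw [hT]; ring
  -- Here `8 * L ^ 2 ≤ c * N` enters: the unknown takes at most half of the left-hand side of `h7`.
  have h8 : 4 * L ^ 2 * ‖ε‖ ^ 2 ≤ c * N / 2 * ‖ε‖ ^ 2 :=
    mul_le_mul_of_nonneg_right (by linarith) (sq_nonneg _)
  have hA : 0 ≤ (c ^ 3)⁻¹ * L + 2 * L ^ 2 := by positivity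
  have h9 : (c ^ 3)⁻¹ * L + 2 * L ^ 2 ≤ c * N * ((c ^ 3)⁻¹ * L + 2 * L ^ 2) :=
    le_mul_of_one_le_left hA hN1
  rw [fixedBound]
  refine le_of_mul_le_mul_left ?_ (show 0 < c * N by linarith)
  nlinarith

lemma norm_sum_sub_le (hc : 0 < c) (hm : 0 < m) (hC : 0 ≤ C) (hlam₀ : 0 ≤ lam) (hlam : lam ≤ L)
    (hκ₀ : ∀ i < m, 0 ≤ κ i)
    (hκ : ∑ i ∈ Finset.range m, κ i ≤ L * m)
    (hκq : ∑ i ∈ Finset.range m, κ i * q i ≤ L * m)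
    (hκb : ∑ i ∈ Finset.range m, κ i * ‖b i‖ ^ 2 ≤ L * m)
    (hε : ‖ε‖ ^ 2 ≤ fixedBound c L) (hN : 0 ≤ N)
    (hδ : ∀ i < m, N * ‖δ i - z i‖ ≤
      κ i * (c⁻¹ * (C * energyBound c lam (q i) (b i) ε + lam))) :
    N * ‖∑ i ∈ Finset.range m, δ i - ∑ i ∈ Finset.range m, z i‖ ≤ linBound c C L * m := by
  have hL : 0 ≤ L := hlam₀.trans hlam
  have hm' : (0 : ℝ) < m := by exact_mod_cast hm
  have hS := sum_mul_energyBound_le (ε := ε) hc hm hlam₀ hlam hκ hκq hκb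
  rw [← Finset.sum_sub_distrib]
  calc N * ‖∑ i ∈ Finset.range m, (δ i - z i)‖
      ≤ N * ∑ i ∈ Finset.range m, ‖δ i - z i‖ := by gcongr; exact norm_sum_le _ _
    _ = ∑ i ∈ Finset.range m, N * ‖δ i - z i‖ := Finset.mul_sum ..
    _ ≤ ∑ i ∈ Finset.range m, κ i * (c⁻¹ * (C * energyBound c lam (q i) (b i) ε + lam)) :=
        Finset.sum_le_sum fun i hi => hδ i (Finset.mem_range.1 hi)
    _ = c⁻¹ * (C * ∑ i ∈ Finset.range m, κ i * energyBound c lam (q i) (b i) ε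
          + lam * ∑ i ∈ Finset.range m, κ i) := by
        simp only [Finset.mul_sum, ← Finset.sum_add_distrib]
        exact Finset.sum_congr rfl fun i _ => by ring
    _ ≤ c⁻¹ * (C * (((c ^ 3)⁻¹ * L + 2 * L * (L + L * ‖ε‖ ^ 2)) * m) + L * (L * m)) := by
        have h0 : 0 ≤ ∑ i ∈ Finset.range m, κ i :=
          Finset.sum_nonneg fun i hi => hκ₀ i (Finset.mem_range.1 hi)
        have h1 : lam * ∑ i ∈ Finset.range m, κ i ≤ L * (L * m) :=
          mul_le_mul hlam hκ h0 hL
        gcongr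
    _ ≤ c⁻¹ * (C * (((c ^ 3)⁻¹ * L + 2 * L * (L + L * fixedBound c L)) * m) + L * (L * m)) := by
        gcongr
    _ = linBound c C L * m := by rw [linBound]; ring

/-- A bound on the average of the `κ i` says nothing about one given cluster. That cluster carries
its own constant `κ₀`, and the averaged estimate is applied to a family of one element. -/
lemma norm_sub_le_linBound {κ₀ q₀ : ℝ} {b₀ δ₀ z₀ : E} (hc : 0 < c) (hC : 0 ≤ C) (hlam₀ : 0 ≤ lam)
    (hlam : lam ≤ L) (hκ₀ : 0 ≤ κ₀) (hκ : κ₀ ≤ L) (hq : κ₀ * q₀ ≤ L)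
    (hb : κ₀ * ‖b₀‖ ^ 2 ≤ L) (hε : ‖ε‖ ^ 2 ≤ fixedBound c L)
    (hδ : N * ‖δ₀ - z₀‖ ≤ κ₀ * (c⁻¹ * (C * energyBound c lam q₀ b₀ ε + lam))) :
    N * ‖δ₀ - z₀‖ ≤ linBound c C L := by
  have h := sum_mul_energyBound_le (m := 1) (κ := fun _ => κ₀) (q := fun _ => q₀)
    (b := fun _ => b₀) (ε := ε) hc one_pos hlam₀ hlam (by simpa using hκ) (by simpa using hq)
    (by simpa using hb)
  simp only [Finset.range_one, Finset.sum_singleton, Nat.cast_one, mul_one] at h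
  have hL : 0 ≤ L := hlam₀.trans hlam
  calc N * ‖δ₀ - z₀‖ ≤ _ := hδ
    _ = c⁻¹ * (C * (κ₀ * energyBound c lam q₀ b₀ ε) + lam * κ₀) := by ring
    _ ≤ c⁻¹ * (C * ((c ^ 3)⁻¹ * L + 2 * L * (L + L * ‖ε‖ ^ 2)) + L * L) := by
        have h1 : lam * κ₀ ≤ L * L := mul_le_mul hlam hκ hκ₀ hL
        gcongr
    _ ≤ linBound c C L := by rw [linBound]; gcongr

end Deterministic

end PQL
end

/-! ### Taylor estimates and comparison of characteristic functions. -/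

noncomputable section
namespace PQL

section Taylor

/-- The mean value inequality applied twice, first to `f'` and then to the increment minus its
tangent; this loses only the factor 1/2. -/
lemma abs_sub_sub_mul_le {f f' f'' : ℝ → ℝ} {C : ℝ} (hf : ∀ s, HasDerivAt f (f' s) s)
    (hf' : ∀ s, HasDerivAt f' (f'' s) s) (hC : ∀ s, |f'' s| ≤ C) (s h : ℝ) :
    |f (s + h) - f s - f' s * h| ≤ C * h ^ 2 := by
  have hC₀ : 0 ≤ C := (abs_nonneg _).trans (hC 0)
  have hlip : ∀ u, |f' (s + u) - f' s| ≤ C * |u| := fun u => by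
    have := Convex.norm_image_sub_le_of_norm_hasDerivWithin_le (f := f') (f' := f'')
      (s := Set.univ) (C := C) (fun x _ => (hf' x).hasDerivWithinAt) (fun x _ => hC x)
      convex_univ (Set.mem_univ s) (Set.mem_univ (s + u))
    simpa using this
  have hd : ∀ u, HasDerivAt (fun u => f (s + u) - f' s * u) (f' (s + u) - f' s) u := fun u => by
    have h1 : HasDerivAt (fun u => f (s + u)) (f' (s + u)) u :=
      HasDerivAt.comp_const_add s u (hf (s + u))
    have h2 : HasDerivAt (fun u => f' s * u) (f' s) u := by
      simpa using (hasDerivAt_id u).const_mul (f' s)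
    exact h1.sub h2
  have := Convex.norm_image_sub_le_of_norm_hasDerivWithin_le
    (f := fun u => f (s + u) - f' s * u) (f' := fun u => f' (s + u) - f' s)
    (s := Set.uIcc 0 h) (C := C * |h|) (fun x _ => (hd x).hasDerivWithinAt)
    (fun x hx => (hlip x).trans (by
      have : |x| ≤ |h| := by simpa using Set.abs_sub_left_of_mem_uIcc hx
      gcongr)) (convex_uIcc 0 h) Set.left_mem_uIcc Set.right_mem_uIcc
  simp only [add_zero, mul_zero, sub_zero, Real.norm_eq_abs] at this
  calc |f (s + h) - f s - f' s * h| = |f (s + h) - f' s * h - f s| := by ring_nf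
    _ ≤ C * |h| * |h| := this
    _ = C * h ^ 2 := by rw [mul_assoc, abs_mul_abs_self]; ring

lemma mul_sq_le_sub_mul {f f' : ℝ → ℝ} {c : ℝ} (hf : ∀ s, HasDerivAt f (f' s) s)
    (hc : ∀ s, c ≤ f' s) (s h : ℝ) : c * h ^ 2 ≤ (f (s + h) - f s) * h := by
  have hd : ∀ u, HasDerivAt (fun u => f u - c * u) (f' u - c) u := fun u => by
    have h2 : HasDerivAt (fun u => c * u) c u := by
      simpa using (hasDerivAt_id u).const_mul c
    exact (hf u).sub h2
  have hm : Monotone fun u => f u - c * u :=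
    monotone_of_deriv_nonneg (fun u => (hd u).differentiableAt)
      fun u => by rw [(hd u).deriv]; linarith [hc u]
  rcases le_total 0 h with h0 | h0
  · have := hm (show s ≤ s + h by linarith)
    simp only at this
    nlinarith
  · have := hm (show s + h ≤ s by linarith)
    simp only at this
    nlinarith

/-- For `|x| ≤ 1` the exponential series is cut after three terms; for `|x| ≥ 1` the moduli of all
terms are added. The constant 4 covers both ranges. -/
lemma norm_exp_mul_I_sub_le (x : ℝ) :
    ‖Complex.exp (x * Complex.I) - (1 + x * Complex.I - x ^ 2 / 2)‖ ≤ 4 * |x| ^ 3 := by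
  rcases le_total |x| 1 with h | h
  · have hx : ‖(x : ℂ) * Complex.I‖ = |x| := by simp
    have := Complex.exp_bound (x := x * Complex.I) (by rw [hx]; exact h) (n := 3) (by norm_num)
    rw [hx] at this
    have e : ∑ m ∈ Finset.range 3, ((x : ℂ) * Complex.I) ^ m / (m.factorial : ℂ) =
        1 + x * Complex.I - x ^ 2 / 2 := by
      simp [Finset.sum_range_succ, mul_pow, Nat.factorial]; ring
    rw [e] at this
    refine this.trans ?_
    have h3 : 0 ≤ |x| ^ 3 := by positivity
    norm_num [Nat.factorial]
    linarith
  · have h1 : ‖Complex.exp (x * Complex.I) - (1 + x * Complex.I - x ^ 2 / 2)‖ ≤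
        1 + (1 + |x| + |x| ^ 2 / 2) := by
      refine (norm_sub_le _ _).trans ?_
      rw [Complex.norm_exp_ofReal_mul_I]
      gcongr
      refine (norm_sub_le _ _).trans ?_
      gcongr
      · refine (norm_add_le _ _).trans ?_
        simp
      · simp
    refine h1.trans ?_
    nlinarith [mul_nonneg (sub_nonneg.2 h) (sub_nonneg.2 h),
      mul_nonneg (sub_nonneg.2 h) (abs_nonneg x),
      mul_nonneg (mul_nonneg (sub_nonneg.2 h) (abs_nonneg x)) (abs_nonneg x)]

lemma abs_exp_neg_sub_le {x : ℝ} (hx : 0 ≤ x) : |Real.exp (-x) - (1 - x)| ≤ x ^ 2 := by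
  rcases le_total x 1 with h | h
  · have := Real.norm_exp_sub_one_sub_id_le (x := -x) (by simpa [abs_of_nonneg hx] using h)
    simp only [Real.norm_eq_abs, abs_neg, sq_abs] at this
    rwa [show Real.exp (-x) - 1 - -x = Real.exp (-x) - (1 - x) by ring] at this
  · have h1 := Real.add_one_le_exp (-x)
    have h2 : Real.exp (-x) ≤ 1 := Real.exp_le_one_iff.2 (by linarith)
    rw [abs_of_nonneg (by linarith)]
    nlinarith

/-- Telescoping: the factors are exchanged one at a time, the others having modulus at most 1. -/
lemma norm_prod_sub_prod_le {ι : Type*} (s : Finset ι) (f g : ι → ℂ)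
    (hf : ∀ i ∈ s, ‖f i‖ ≤ 1) (hg : ∀ i ∈ s, ‖g i‖ ≤ 1) :
    ‖∏ i ∈ s, f i - ∏ i ∈ s, g i‖ ≤ ∑ i ∈ s, ‖f i - g i‖ := by
  classical
  induction s using Finset.induction_on with
  | empty => simp
  | insert i s hi ih =>
    have hp : ‖∏ i ∈ s, g i‖ ≤ 1 := by
      rw [norm_prod]
      exact Finset.prod_le_one (fun _ _ => norm_nonneg _)
        fun j hj => hg j (Finset.mem_insert_of_mem hj)
    rw [Finset.prod_insert hi, Finset.prod_insert hi, Finset.sum_insert hi,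
      show f i * ∏ i ∈ s, f i - g i * ∏ i ∈ s, g i =
        (f i - g i) * ∏ i ∈ s, g i + f i * (∏ i ∈ s, f i - ∏ i ∈ s, g i) by ring]
    refine (norm_add_le _ _).trans (add_le_add ?_ ?_)
    · rw [norm_mul]
      exact mul_le_of_le_one_right (norm_nonneg _) hp
    · rw [norm_mul]
      exact (mul_le_of_le_one_left (norm_nonneg _) (hf i (Finset.mem_insert_self i s))).trans
        (ih (fun j hj => hf j (Finset.mem_insert_of_mem hj))
          (fun j hj => hg j (Finset.mem_insert_of_mem hj)))

end Taylor

/-- The estimate for one summand in the central limit theorem: both sides are compared with `1 - w ^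
2 * v / 2`, the first-order term vanishing because `X` is centred. -/
lemma norm_integral_exp_mul_I_sub_le {Ω : Type*} [MeasurableSpace Ω] {μ : Measure Ω}
    [IsProbabilityMeasure μ] {X : Ω → ℝ} {v T : ℝ} (hX : AEMeasurable X μ)
    (h1 : Integrable X μ) (h2 : Integrable (fun ω => X ω ^ 2) μ)
    (h3 : Integrable (fun ω => |X ω| ^ 3) μ) (hm : ∫ ω, X ω ∂μ = 0)
    (hv : ∫ ω, X ω ^ 2 ∂μ = v) (hT : ∫ ω, |X ω| ^ 3 ∂μ ≤ T) (w : ℝ) :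
    ‖∫ ω, Complex.exp ((w * X ω : ℝ) * Complex.I) ∂μ - Real.exp (-(w ^ 2 * v / 2))‖ ≤
      4 * T * |w| ^ 3 + (w ^ 2 * v / 2) ^ 2 := by
  have hv₀ : 0 ≤ v := by rw [← hv]; exact integral_nonneg fun _ => sq_nonneg _
  have hexp : Integrable (fun ω => Complex.exp ((w * X ω : ℝ) * Complex.I)) μ := by
    refine Integrable.of_bound (C := 1) ?_ (ae_of_all _ fun ω => ?_)
    · exact (Complex.continuous_exp.comp_aestronglyMeasurable
        (((Complex.continuous_ofReal.comp_aestronglyMeasurable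
          (hX.const_mul w).aestronglyMeasurable)).mul_const _))
    · rw [Complex.norm_exp_ofReal_mul_I]
  have i1 : Integrable (fun ω => ((w * X ω : ℝ) : ℂ) * Complex.I) μ :=
    (h1.const_mul w).ofReal.mul_const _
  have i01 : Integrable (fun ω => 1 + ((w * X ω : ℝ) : ℂ) * Complex.I) μ :=
    (integrable_const _).add i1
  have i2 : Integrable (fun ω => ((w * X ω : ℝ) : ℂ) ^ 2 / 2) μ := by
    have : Integrable (fun ω => ((((w ^ 2 / 2) * X ω ^ 2 : ℝ)) : ℂ)) μ := (h2.const_mul _).ofReal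
    refine this.congr (ae_of_all _ fun ω => ?_)
    push_cast; ring
  have hq : Integrable
      (fun ω => (1 + (w * X ω : ℝ) * Complex.I - ((w * X ω : ℝ) : ℂ) ^ 2 / 2)) μ := i01.sub i2
  have hqi : ∫ ω, (1 + (w * X ω : ℝ) * Complex.I - ((w * X ω : ℝ) : ℂ) ^ 2 / 2) ∂μ =
      ((1 - w ^ 2 * v / 2 : ℝ) : ℂ) := by
    have e1 : ∫ ω, (((w * X ω : ℝ) : ℂ)) * Complex.I ∂μ = 0 := by
      rw [integral_mul_const, integral_complex_ofReal, integral_const_mul, hm]; simp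
    have e2 : ∫ ω, ((w * X ω : ℝ) : ℂ) ^ 2 / 2 ∂μ = ((w ^ 2 * v / 2 : ℝ) : ℂ) := by
      have : ∀ ω, ((w * X ω : ℝ) : ℂ) ^ 2 / 2 = (((w ^ 2 / 2) * X ω ^ 2 : ℝ) : ℂ) := fun ω => by
        push_cast; ring
      simp_rw [this]
      rw [integral_complex_ofReal, integral_const_mul, hv]
      push_cast; ring
    rw [integral_sub i01 i2, integral_add (integrable_const _) i1, e1, e2]
    simp
  have hA : ‖∫ ω, Complex.exp ((w * X ω : ℝ) * Complex.I) ∂μ - ((1 - w ^ 2 * v / 2 : ℝ) : ℂ)‖ ≤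
      4 * T * |w| ^ 3 := by
    rw [← hqi, ← integral_sub hexp hq]
    refine (norm_integral_le_integral_norm _).trans ?_
    have hle : ∫ ω, ‖Complex.exp ((w * X ω : ℝ) * Complex.I)
        - (1 + (w * X ω : ℝ) * Complex.I - ((w * X ω : ℝ) : ℂ) ^ 2 / 2)‖ ∂μ ≤
        ∫ ω, 4 * |w| ^ 3 * |X ω| ^ 3 ∂μ := by
      refine integral_mono (hexp.sub hq).norm (h3.const_mul _) fun ω => ?_
      have := norm_exp_mul_I_sub_le (w * X ω)
      rw [abs_mul, mul_pow] at this
      simp only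
      linarith
    refine hle.trans ?_
    rw [integral_const_mul]
    have : 0 ≤ 4 * |w| ^ 3 := by positivity
    nlinarith [mul_le_mul_of_nonneg_left hT this]
  have hB := abs_exp_neg_sub_le (x := w ^ 2 * v / 2) (by positivity)
  calc _ ≤ ‖∫ ω, Complex.exp ((w * X ω : ℝ) * Complex.I) ∂μ - ((1 - w ^ 2 * v / 2 : ℝ) : ℂ)‖
      + ‖((1 - w ^ 2 * v / 2 : ℝ) : ℂ) - Real.exp (-(w ^ 2 * v / 2))‖ :=
        norm_sub_le_norm_sub_add_norm_sub ..
    _ ≤ _ := by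
      refine add_le_add hA ?_
      rw [← Complex.ofReal_sub, Complex.norm_real, Real.norm_eq_abs, abs_sub_comm]
      exact hB

end PQL
end

/-! ### Cumulants and uniform moment bounds of the exponential family. -/

noncomputable section
namespace PQL

variable {p : ℕ}

/-- The bounds on the derivatives of the cumulant function, with explicit first and second
derivatives. -/
structure CumulantBounds (M : Model p) (c : ℝ) : Prop where
  pos : 0 < c
  hasDerivAt : ∀ s, HasDerivAt M.a (deriv M.a s) s
  hasDerivAt_deriv : ∀ s, HasDerivAt (deriv M.a) (iteratedDeriv 2 M.a s) s
  continuous_two : Continuous (iteratedDeriv 2 M.a)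
  le_two : ∀ s, c ≤ iteratedDeriv 2 M.a s
  two_le : ∀ s, iteratedDeriv 2 M.a s ≤ c⁻¹
  taylor : ∀ s h, |deriv M.a (s + h) - deriv M.a s - iteratedDeriv 2 M.a s * h| ≤ c⁻¹ * h ^ 2

lemma C1.cumulantBounds {M : Model p} (h : C1 M) : ∃ c, CumulantBounds M c := by
  obtain ⟨ha, c, hc, hb⟩ := h
  have h0 : ∀ s, HasDerivAt M.a (deriv M.a s) s := fun s =>
    ((ha.differentiable (by norm_num)) s).hasDerivAt
  have h1 : ∀ s, HasDerivAt (deriv M.a) (iteratedDeriv 2 M.a s) s := fun s => by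
    have := (ha.differentiable_iteratedDeriv 1 (by norm_num)) s
    rw [iteratedDeriv_one] at this
    rw [iteratedDeriv_succ, iteratedDeriv_one]
    exact this.hasDerivAt
  have h2 : ∀ s, HasDerivAt (iteratedDeriv 2 M.a) (iteratedDeriv 3 M.a s) s := fun s => by
    have := (ha.differentiable_iteratedDeriv 2 (by norm_num)) s
    rw [iteratedDeriv_succ (n := 2)]
    exact this.hasDerivAt
  exact ⟨c, hc, h0, h1, continuous_iff_continuousAt.2 fun s => (h2 s).continuousAt,
    fun s => (hb s).1, fun s => (hb s).2.1, abs_sub_sub_mul_le h1 h2 fun s => (hb s).2.2⟩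

variable {M : Model p} {c : ℝ}

lemma CumulantBounds.continuous (h : CumulantBounds M c) : Continuous M.a :=
  continuous_iff_continuousAt.2 fun s => (h.hasDerivAt s).continuousAt

lemma CumulantBounds.continuous_deriv (h : CumulantBounds M c) : Continuous (deriv M.a) :=
  continuous_iff_continuousAt.2 fun s => (h.hasDerivAt_deriv s).continuousAt

namespace Model

/-- The law of a response with canonical parameter `η`, at the true dispersion. -/
def law (M : Model p) (η : ℝ) : Measure ℝ :=
  M.ν.withDensity fun y => ENNReal.ofReal (M.density M.φ η y)

lemma density_pos (M : Model p) (φ η y : ℝ) : 0 < M.density φ η y := Real.exp_pos _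

lemma measurable_density (hM : M.IsValid) (ha : Measurable M.a) :
    Measurable fun q : ℝ × ℝ => M.density M.φ q.1 q.2 := by
  have := hM.measurable_c
  unfold density
  fun_prop

lemma measurable_density_right (hM : M.IsValid) (η : ℝ) : Measurable (M.density M.φ η) := by
  have := hM.measurable_c
  unfold density
  fun_prop

lemma isProbabilityMeasure_law (hM : M.IsValid) (η : ℝ) : IsProbabilityMeasure (M.law η) :=
  ⟨by rw [law, withDensity_apply _ MeasurableSet.univ, Measure.restrict_univ]
      exact hM.lintegral_density η⟩

/-- Exponential tilting: multiplying the density at `η` by `exp (s * y)` gives a constant times the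
density at `η + M.φ * s`, which has total mass 1. All exponential moments are therefore finite and
the cumulant generating function is explicit. -/
lemma lintegral_exp_law (hM : M.IsValid) (η s : ℝ) :
    ∫⁻ y, ENNReal.ofReal (Real.exp (s * y)) ∂(M.law η) =
      ENNReal.ofReal (Real.exp (M.φ⁻¹ * (M.a (η + M.φ * s) - M.a η))) := by
  have hφ := hM.φ_pos.ne'
  rw [law, lintegral_withDensity_eq_lintegral_mul _
    (measurable_density_right hM η).ennreal_ofReal (by fun_prop)]
  have : ∀ y, ((fun y => ENNReal.ofReal (M.density M.φ η y)) *
      fun y => ENNReal.ofReal (Real.exp (s * y))) y =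
      ENNReal.ofReal (Real.exp (M.φ⁻¹ * (M.a (η + M.φ * s) - M.a η))) *
        ENNReal.ofReal (M.density M.φ (η + M.φ * s) y) := fun y => by
    rw [Pi.mul_apply, ← ENNReal.ofReal_mul (density_pos ..).le,
      ← ENNReal.ofReal_mul (Real.exp_pos _).le, density, density, ← Real.exp_add, ← Real.exp_add]
    congr 2
    field_simp
    ring
  simp_rw [this]
  rw [lintegral_const_mul _ (measurable_density_right hM _).ennreal_ofReal,
    hM.lintegral_density, mul_one]

lemma integrable_exp_law (hM : M.IsValid) (η s : ℝ) :
    Integrable (fun y => Real.exp (s * y)) (M.law η) := by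
  refine ⟨by fun_prop, ?_⟩
  rw [hasFiniteIntegral_iff_ofReal (ae_of_all _ fun y => (Real.exp_pos _).le),
    lintegral_exp_law hM]
  exact ENNReal.ofReal_lt_top

lemma mgf_law (hM : M.IsValid) (η s : ℝ) :
    mgf id (M.law η) s = Real.exp (M.φ⁻¹ * (M.a (η + M.φ * s) - M.a η)) := by
  simp only [mgf, id]
  rw [integral_eq_lintegral_of_nonneg_ae (ae_of_all _ fun y => (Real.exp_pos _).le) (by fun_prop),
    lintegral_exp_law hM, ENNReal.toReal_ofReal (Real.exp_pos _).le]

lemma integrableExpSet_law (hM : M.IsValid) (η : ℝ) :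
    integrableExpSet id (M.law η) = Set.univ :=
  Set.eq_univ_of_forall fun s => integrable_exp_law hM η s

lemma cgf_law (hM : M.IsValid) (η : ℝ) :
    cgf id (M.law η) = fun s => M.φ⁻¹ * (M.a (η + M.φ * s) - M.a η) := by
  ext s
  rw [cgf, mgf_law hM, Real.log_exp]

lemma deriv_cgf_law (hM : M.IsValid) (h : CumulantBounds M c) (η : ℝ) :
    deriv (cgf id (M.law η)) = fun s => deriv M.a (η + M.φ * s) := by
  ext s
  rw [cgf_law hM]
  have h1 : HasDerivAt (fun s => η + M.φ * s) M.φ s := by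
    simpa using ((hasDerivAt_id s).const_mul M.φ).const_add η
  have h2 := (((h.hasDerivAt (η + M.φ * s)).comp s h1).sub_const (M.a η)).const_mul M.φ⁻¹
  have := h2.deriv
  simp only [Function.comp_def] at this
  rw [this, mul_comm, mul_assoc, mul_inv_cancel₀ hM.φ_pos.ne', mul_one]

lemma integral_law (hM : M.IsValid) (h : CumulantBounds M c) (η : ℝ) :
    ∫ y, y ∂(M.law η) = deriv M.a η := by
  have := isProbabilityMeasure_law hM η
  have h1 := deriv_cgf_zero (X := id) (μ := M.law η) (by rw [integrableExpSet_law hM]; simp)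
  rw [deriv_cgf_law hM h] at h1
  simpa using h1.symm

lemma integral_sq_law (hM : M.IsValid) (h : CumulantBounds M c) (η : ℝ) :
    ∫ y, (y - deriv M.a η) ^ 2 ∂(M.law η) = M.φ * iteratedDeriv 2 M.a η := by
  have := isProbabilityMeasure_law hM η
  have h1 := iteratedDeriv_two_cgf_eq_integral (X := id) (μ := M.law η) (v := 0)
    (by rw [integrableExpSet_law hM]; simp)
  rw [iteratedDeriv_succ, iteratedDeriv_one, deriv_cgf_law hM h] at h1
  have h2 : HasDerivAt (fun s => η + M.φ * s) M.φ 0 := by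
    simpa using ((hasDerivAt_id (0 : ℝ)).const_mul M.φ).const_add η
  have h3 := ((h.hasDerivAt_deriv (η + M.φ * 0)).comp 0 h2).deriv
  simp only [Function.comp_def] at h3
  rw [h3] at h1
  simp only [mul_zero, add_zero, id, zero_mul, Real.exp_zero, mul_one, mgf_zero',
    probReal_univ, div_one] at h1
  rw [← h1, mul_comm]

lemma integrable_exp_abs_law (hM : M.IsValid) (η : ℝ) :
    Integrable (fun y => Real.exp |y - deriv M.a η|) (M.law η) := by
  have h1 := (integrable_exp_law hM η 1).const_mul (Real.exp (-deriv M.a η))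
  have h2 := (integrable_exp_law hM η (-1)).const_mul (Real.exp (deriv M.a η))
  refine (h1.add h2).mono' (by fun_prop) (ae_of_all _ fun y => ?_)
  simp only [Pi.add_apply, ← Real.exp_add, Real.norm_eq_abs, Real.abs_exp]
  rcases abs_cases (y - deriv M.a η) with ⟨e, _⟩ | ⟨e, _⟩
  · rw [e, show y - deriv M.a η = -deriv M.a η + 1 * y by ring]
    exact le_add_of_nonneg_right (Real.exp_pos _).le
  · rw [e, show -(y - deriv M.a η) = deriv M.a η + -1 * y by ring]
    exact le_add_of_nonneg_left (Real.exp_pos _).le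

/-- The centred cumulant generating function at `±1` is a second-order Taylor remainder of `a`,
bounded by means of `a'' ≤ c⁻¹`. The bound does not depend on `η`, which matters because the
Gaussian random effects make the linear predictors unbounded. -/
lemma integral_exp_abs_law_le (hM : M.IsValid) (h : CumulantBounds M c) (η : ℝ) :
    ∫ y, Real.exp |y - deriv M.a η| ∂(M.law η) ≤ 2 * Real.exp (c⁻¹ * M.φ) := by
  have hφ := hM.φ_pos
  have h1 := (integrable_exp_law hM η 1).const_mul (Real.exp (-deriv M.a η))
  have h2 := (integrable_exp_law hM η (-1)).const_mul (Real.exp (deriv M.a η))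
  have key : ∀ s : ℝ, s ^ 2 = 1 →
      Real.exp (-(s * deriv M.a η)) * ∫ y, Real.exp (s * y) ∂(M.law η) ≤
        Real.exp (c⁻¹ * M.φ) := fun s hs => by
    have hm := mgf_law hM η s
    simp only [mgf, id] at hm
    rw [hm, ← Real.exp_add, Real.exp_le_exp]
    have ht := abs_sub_sub_mul_le h.hasDerivAt h.hasDerivAt_deriv
      (fun u => abs_le.2 ⟨by linarith [h.le_two u, h.pos, inv_pos.2 h.pos], h.two_le u⟩)
      η (M.φ * s)
    have ht' := (le_abs_self _).trans ht
    rw [mul_pow, hs, mul_one] at ht'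
    have := mul_le_mul_of_nonneg_left ht' (inv_pos.2 hφ).le
    have e1 : M.φ⁻¹ * (M.a (η + M.φ * s) - M.a η - deriv M.a η * (M.φ * s)) =
        -(s * deriv M.a η) + M.φ⁻¹ * (M.a (η + M.φ * s) - M.a η) := by field_simp; ring
    have e2 : M.φ⁻¹ * (c⁻¹ * M.φ ^ 2) = c⁻¹ * M.φ := by field_simp
    linarith
  have k1 := key 1 (by norm_num)
  have k2 := key (-1) (by norm_num)
  simp only [one_mul, neg_mul, neg_neg] at k1 k2 h1 h2
  calc ∫ y, Real.exp |y - deriv M.a η| ∂(M.law η)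
      ≤ ∫ y, (Real.exp (-deriv M.a η) * Real.exp y + Real.exp (deriv M.a η) * Real.exp (-y))
          ∂(M.law η) := by
        refine integral_mono (integrable_exp_abs_law hM η) (h1.add h2) fun y => ?_
        simp only [← Real.exp_add]
        rcases abs_cases (y - deriv M.a η) with ⟨e, _⟩ | ⟨e, _⟩
        · rw [e, show y - deriv M.a η = -deriv M.a η + y by ring]
          exact le_add_of_nonneg_right (Real.exp_pos _).le
        · rw [e, show -(y - deriv M.a η) = deriv M.a η + -y by ring]
          exact le_add_of_nonneg_left (Real.exp_pos _).le
    _ ≤ 2 * Real.exp (c⁻¹ * M.φ) := by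
        rw [integral_add h1 h2, integral_const_mul, integral_const_mul]
        linarith

lemma abs_pow_le_exp (k : ℕ) (t : ℝ) : |t| ^ k ≤ k.factorial * Real.exp |t| := by
  have := Real.pow_div_factorial_le_exp |t| (abs_nonneg t) k
  rwa [div_le_iff₀ (by positivity), mul_comm] at this

lemma integrable_abs_pow_law (hM : M.IsValid) (η : ℝ) (k : ℕ) :
    Integrable (fun y => |y - deriv M.a η| ^ k) (M.law η) := by
  refine ((integrable_exp_abs_law hM η).const_mul (k.factorial : ℝ)).mono' (by fun_prop)
    (ae_of_all _ fun y => ?_)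
  rw [Real.norm_eq_abs, abs_of_nonneg (by positivity)]
  exact abs_pow_le_exp k _

lemma integrable_sub_law (hM : M.IsValid) (η : ℝ) :
    Integrable (fun y => y - deriv M.a η) (M.law η) := by
  have := integrable_abs_pow_law hM η 1
  simp only [pow_one] at this
  exact (integrable_norm_iff (f := fun y => y - deriv M.a η) (by fun_prop)).1 this

lemma integrable_sub_sq_law (hM : M.IsValid) (η : ℝ) :
    Integrable (fun y => (y - deriv M.a η) ^ 2) (M.law η) := by
  simpa using integrable_abs_pow_law hM η 2

lemma integral_sub_law (hM : M.IsValid) (h : CumulantBounds M c) (η : ℝ) :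
    ∫ y, (y - deriv M.a η) ∂(M.law η) = 0 := by
  have := isProbabilityMeasure_law hM η
  have hi : Integrable (fun y : ℝ => y) (M.law η) := by
    refine ((integrable_sub_law hM η).add (integrable_const (deriv M.a η))).congr
      (ae_of_all _ fun y => ?_)
    simp
  rw [integral_sub hi (integrable_const _), integral_law hM h]
  simp

lemma integral_abs_pow_three_law_le (hM : M.IsValid) (h : CumulantBounds M c) (η : ℝ) :
    ∫ y, |y - deriv M.a η| ^ 3 ∂(M.law η) ≤ 12 * Real.exp (c⁻¹ * M.φ) := by
  calc ∫ y, |y - deriv M.a η| ^ 3 ∂(M.law η)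
      ≤ ∫ y, 6 * Real.exp |y - deriv M.a η| ∂(M.law η) := by
        refine integral_mono (integrable_abs_pow_law hM η 3)
          ((integrable_exp_abs_law hM η).const_mul 6) fun y => ?_
        simpa [Nat.factorial] using abs_pow_le_exp 3 (y - deriv M.a η)
    _ ≤ _ := by
        rw [integral_const_mul]
        linarith [integral_exp_abs_law_le hM h η]

/-- The constant is `48 = 4 * 12`, from the third-moment bound; the estimate is again uniform in
`η`. -/
lemma norm_charFun_law_sub_le (hM : M.IsValid) (h : CumulantBounds M c) (η w : ℝ) :
    ‖∫ y, Complex.exp ((w * (y - deriv M.a η) : ℝ) * Complex.I) ∂(M.law η)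
        - Real.exp (-(w ^ 2 * (M.φ * iteratedDeriv 2 M.a η) / 2))‖ ≤
      48 * Real.exp (c⁻¹ * M.φ) * |w| ^ 3 + (w ^ 2 * (M.φ * c⁻¹) / 2) ^ 2 := by
  have := isProbabilityMeasure_law hM η
  have hφ := hM.φ_pos
  refine (norm_integral_exp_mul_I_sub_le (by fun_prop) (integrable_sub_law hM η)
    (integrable_sub_sq_law hM η) (integrable_abs_pow_law hM η 3) (integral_sub_law hM h η)
    (integral_sq_law hM h η) (integral_abs_pow_three_law_le hM h η) w).trans ?_
  have h1 := h.le_two η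
  have h2 := h.two_le η
  have h3 := h.pos
  gcongr ?_ + ?_ ^ 2
  · linarith
  · have : 0 ≤ iteratedDeriv 2 M.a η := h3.le.trans h1
    positivity
  · gcongr

end Model

end PQL
end

/-! ### Quadratic forms, the information matrix and the linearised deviation. -/

noncomputable section
namespace PQL

variable {p : ℕ}

section MatForm

/-- The bilinear form of a matrix. -/
def matForm (A : Matrix (Fin p) (Fin p) ℝ) : Vec p →ₗ[ℝ] Vec p →ₗ[ℝ] ℝ :=
  LinearMap.mk₂ ℝ (fun u v => WithLp.ofLp u ⬝ᵥ (A *ᵥ WithLp.ofLp v))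
    (fun _ _ _ => by simp [add_dotProduct]) (fun _ _ _ => by simp)
    (fun _ _ _ => by simp [Matrix.mulVec_add, dotProduct_add])
    (fun _ _ _ => by simp [Matrix.mulVec_smul])

lemma matForm_apply (A : Matrix (Fin p) (Fin p) ℝ) (u v : Vec p) :
    matForm A u v = WithLp.ofLp u ⬝ᵥ (A *ᵥ WithLp.ofLp v) := rfl

lemma matForm_eq_sum (A : Matrix (Fin p) (Fin p) ℝ) (u v : Vec p) :
    matForm A u v = ∑ k, ∑ l, u k * A k l * v l := by
  simp only [matForm_apply, dotProduct, Matrix.mulVec, Finset.mul_sum, mul_assoc]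

lemma matForm_comm {A : Matrix (Fin p) (Fin p) ℝ} (hA : A.IsHermitian) (u v : Vec p) :
    matForm A u v = matForm A v u := by
  have h : Aᵀ = A := Matrix.conjTranspose_eq_transpose_of_trivial A ▸ hA
  rw [matForm_apply, matForm_apply, Matrix.dotProduct_mulVec, ← Matrix.mulVec_transpose, h,
    dotProduct_comm]

lemma matForm_nonneg {A : Matrix (Fin p) (Fin p) ℝ} (hA : A.PosSemidef) (v : Vec p) :
    0 ≤ matForm A v v := by
  simpa [matForm_apply] using hA.dotProduct_mulVec_nonneg (WithLp.ofLp v)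

lemma abs_coord_le (v : Vec p) (k : Fin p) : |v k| ≤ ‖v‖ := by
  simpa using PiLp.norm_apply_le v k

lemma matForm_self_le (A : Matrix (Fin p) (Fin p) ℝ) (v : Vec p) :
    matForm A v v ≤ (∑ k, ∑ l, |A k l|) * ‖v‖ ^ 2 := by
  rw [matForm_eq_sum, Finset.sum_mul]
  refine Finset.sum_le_sum fun k _ => ?_
  rw [Finset.sum_mul]
  refine Finset.sum_le_sum fun l _ => (le_abs_self _).trans ?_
  rw [abs_mul, abs_mul]
  calc |v k| * |A k l| * |v l| ≤ ‖v‖ * |A k l| * ‖v‖ := by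
        gcongr <;> exact abs_coord_le _ _
    _ = |A k l| * ‖v‖ ^ 2 := by ring

/-- The coordinate `v k` is the form of `A` at `v` and the k-th column of `A⁻¹`. Cauchy–Schwarz for
that form bounds its square by `A⁻¹ k k` times the form at `v`; then sum over `k`. -/
lemma norm_sq_le_trace_inv_mul {A : Matrix (Fin p) (Fin p) ℝ} (hA : A.PosDef) (v : Vec p) :
    ‖v‖ ^ 2 ≤ A⁻¹.trace * matForm A v v := by
  have hu : IsUnit A.det := hA.det_pos.ne'.isUnit
  rw [EuclideanSpace.real_norm_sq_eq, Matrix.trace, Finset.sum_mul]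
  refine Finset.sum_le_sum fun k _ => ?_
  set u : Vec p := WithLp.toLp 2 (A⁻¹ *ᵥ Pi.single k 1) with hu'
  have h := bilin_sq_le (matForm_comm hA.isHermitian) (matForm_nonneg hA.posSemidef) v u
  have e1 : A *ᵥ WithLp.ofLp u = Pi.single k 1 := by
    rw [hu', Matrix.mulVec_mulVec, Matrix.mul_nonsing_inv _ hu, Matrix.one_mulVec]
  rw [matForm_apply A v u, e1, matForm_apply A u u, e1, dotProduct_single_one,
    dotProduct_single_one] at h
  refine h.trans (le_of_eq ?_)
  rw [mul_comm, hu']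
  simp [Matrix.diag]

end MatForm

namespace Model

variable (M : Model p) (D : Design p) (i : ℕ)

/-- The variance function of measurement `j` of cluster `i` with random effect `b`. -/
def weight (b : Vec p) (j : Fin (D.n i)) : ℝ := iteratedDeriv 2 M.a (linPred (D.x i j) M.β b)

lemma info_apply (b : Vec p) (k l : Fin p) :
    M.info D i b k l =
      ((D.n i : ℝ) * M.φ)⁻¹ * ∑ j : Fin (D.n i), M.weight D i b j * D.x i j k * D.x i j l := by
  simp only [info, W, Matrix.smul_apply, Matrix.mul_smul, Matrix.smul_mul,
    Matrix.mul_apply (M := _ * _), Matrix.mul_diagonal, Matrix.transpose_apply, Design.X,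
    Matrix.of_apply, smul_eq_mul, mul_inv, weight, mul_assoc]
  congr 2
  exact Finset.sum_congr rfl fun j _ => by ring

lemma matForm_info (b u v : Vec p) :
    matForm (M.info D i b) u v = ((D.n i : ℝ) * M.φ)⁻¹ *
      ∑ j : Fin (D.n i), M.weight D i b j * inner ℝ (D.x i j) u * inner ℝ (D.x i j) v := by
  simp only [matForm_eq_sum, info_apply, PiLp.inner_apply, RCLike.inner_apply, conj_trivial]
  simp only [Finset.mul_sum, Finset.sum_mul]
  rw [Finset.sum_congr rfl fun k _ => Finset.sum_comm, Finset.sum_comm]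
  refine Finset.sum_congr rfl fun j _ => ?_
  rw [Finset.sum_comm]
  refine Finset.sum_congr rfl fun k _ => Finset.sum_congr rfl fun l _ => ?_
  ring

lemma isHermitian_info (b : Vec p) : (M.info D i b).IsHermitian := by
  ext k l
  simp only [Matrix.conjTranspose_apply, info_apply, star_trivial]
  congr 1
  exact Finset.sum_congr rfl fun j _ => by ring

variable {M D i} {c : ℝ}

lemma posDef_info (hM : M.IsValid) (hc : CumulantBounds M c) {b : Vec p}
    (hu : IsUnit (M.info D i b)) : (M.info D i b).PosDef := by
  have hps : (M.info D i b).PosSemidef := by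
    refine Matrix.PosSemidef.of_dotProduct_mulVec_nonneg (M.isHermitian_info D i b) fun v => ?_
    have := M.matForm_info D i b (WithLp.toLp 2 v) (WithLp.toLp 2 v)
    rw [matForm_apply] at this
    simp only [star_trivial]
    rw [this]
    have := hM.φ_pos
    refine mul_nonneg (by positivity) (Finset.sum_nonneg fun j _ => ?_)
    rw [mul_assoc]
    exact mul_nonneg (hc.pos.le.trans (hc.le_two _)) (mul_self_nonneg _)
  exact hps.posDef_iff_isUnit.2 hu

lemma posDef_H (hM : M.IsValid) (hc : CumulantBounds M c) {b : Vec p}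
    (hu : IsUnit (M.info D i b)) : (M.H D i b).PosDef :=
  (posDef_info hM hc hu).inv

lemma info_mul_H {b : Vec p} (hu : IsUnit (M.info D i b)) : M.info D i b * M.H D i b = 1 :=
  Matrix.mul_nonsing_inv _ ((Matrix.isUnit_iff_isUnit_det _).1 hu)

lemma H_mul_info {b : Vec p} (hu : IsUnit (M.info D i b)) : M.H D i b * M.info D i b = 1 :=
  Matrix.nonsing_inv_mul _ ((Matrix.isUnit_iff_isUnit_det _).1 hu)

/-- Since `a''` is bounded above, the information at any `b` is dominated by the energy, which does
not involve `b`. The curvature constant may therefore be computed at whichever `b` is convenient. -/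
lemma mul_norm_sq_le_trace_H (hM : M.IsValid) (hc : CumulantBounds M c) {b : Vec p}
    (hu : IsUnit (M.info D i b)) (hn : 0 < D.n i) (v : Vec p) :
    (D.n i : ℝ) * ‖v‖ ^ 2 ≤
      ((M.H D i b).trace * (M.φ * c)⁻¹) * energy (fun j : Fin (D.n i) => D.x i j) v := by
  have h1 := norm_sq_le_trace_inv_mul (posDef_info hM hc hu) v
  have hφ := hM.φ_pos
  have hc₀ := hc.pos
  have hn' : (0 : ℝ) < D.n i := by exact_mod_cast hn
  have htr : 0 ≤ (M.H D i b).trace := (posDef_H hM hc hu).posSemidef.trace_nonneg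
  have h2 : matForm (M.info D i b) v v ≤ ((D.n i : ℝ) * M.φ)⁻¹ *
      (c⁻¹ * energy (fun j : Fin (D.n i) => D.x i j) v) := by
    rw [matForm_info]
    gcongr
    rw [energy, Finset.mul_sum]
    refine Finset.sum_le_sum fun j _ => ?_
    rw [mul_assoc, ← sq]
    exact mul_le_mul_of_nonneg_right (hc.two_le _) (sq_nonneg _)
  calc (D.n i : ℝ) * ‖v‖ ^ 2
      ≤ D.n i * ((M.H D i b).trace * (((D.n i : ℝ) * M.φ)⁻¹ *
          (c⁻¹ * energy (fun j : Fin (D.n i) => D.x i j) v))) := by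
        gcongr
        exact h1.trans (mul_le_mul_of_nonneg_left h2 htr)
    _ = _ := by field_simp

variable (M D i)

/-- The linearised deviation of the estimated coefficient of cluster `i` from the true one. -/
def linDev (b : Vec p) (y : Fin (D.n i) → ℝ) : Vec p :=
  WithLp.toLp 2 (((D.n i : ℝ) * M.φ)⁻¹ • (M.H D i b *ᵥ ((D.X i)ᵀ *ᵥ (y - M.mean D i b))))

/-- The coefficients of the linearised deviation in the direction `u`. -/
def linCoef (b u : Vec p) (j : Fin (D.n i)) : ℝ :=
  ((D.n i : ℝ) * M.φ)⁻¹ * inner ℝ (D.x i j) (WithLp.toLp 2 (M.H D i b *ᵥ WithLp.ofLp u) : Vec p)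

variable {M D i}

lemma X_transpose_mulVec_dotProduct (e : Fin (D.n i) → ℝ) (v : Vec p) :
    ((D.X i)ᵀ *ᵥ e) ⬝ᵥ WithLp.ofLp v = ∑ j, e j * inner ℝ (D.x i j) v := by
  rw [Matrix.mulVec_transpose, ← Matrix.dotProduct_mulVec, dotProduct]
  refine Finset.sum_congr rfl fun j _ => ?_
  congr 1
  simp [Matrix.mulVec, dotProduct, Design.X, PiLp.inner_apply, mul_comm]

lemma inner_linDev (hM : M.IsValid) (hc : CumulantBounds M c) {b : Vec p}
    (hu : IsUnit (M.info D i b)) (u : Vec p) (y : Fin (D.n i) → ℝ) :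
    inner ℝ u (M.linDev D i b y) = ∑ j, M.linCoef D i b u j * (y j - M.mean D i b j) := by
  have hH : (M.H D i b)ᵀ = M.H D i b :=
    Matrix.conjTranspose_eq_transpose_of_trivial (M.H D i b) ▸ (posDef_H hM hc hu).isHermitian
  have e : inner ℝ u (M.linDev D i b y) = ((D.n i : ℝ) * M.φ)⁻¹ *
      (((D.X i)ᵀ *ᵥ (y - M.mean D i b)) ⬝ᵥ (M.H D i b *ᵥ WithLp.ofLp u)) := by
    rw [EuclideanSpace.inner_eq_star_dotProduct, linDev]
    simp only [star_trivial, smul_dotProduct, smul_eq_mul]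
    rw [dotProduct_comm, Matrix.dotProduct_mulVec, ← Matrix.mulVec_transpose, hH, dotProduct_comm]
  rw [e, X_transpose_mulVec_dotProduct (v := WithLp.toLp 2 (M.H D i b *ᵥ WithLp.ofLp u)),
    Finset.mul_sum]
  refine Finset.sum_congr rfl fun j _ => ?_
  rw [linCoef, Pi.sub_apply]
  ring

/-- The linearised deviation solves the weighted normal equations of its cluster, because `info * H
= 1`. -/
lemma sum_mul_inner_eq_linDev (hM : M.IsValid) {b : Vec p}
    (hu : IsUnit (M.info D i b)) (hn : 0 < D.n i) (v : Vec p) (y : Fin (D.n i) → ℝ) :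
    ∑ j, (y j - M.mean D i b j) * inner ℝ (D.x i j) v =
      ∑ j : Fin (D.n i), M.weight D i b j * inner ℝ (D.x i j) (M.linDev D i b y)
        * inner ℝ (D.x i j) v := by
  have hφ := hM.φ_pos
  have hn' : (0 : ℝ) < D.n i := by exact_mod_cast hn
  have hnφ : (D.n i : ℝ) * M.φ ≠ 0 := by positivity
  have h1 := M.matForm_info D i b v (M.linDev D i b y)
  rw [matForm_apply, linDev, Matrix.mulVec_smul, Matrix.mulVec_mulVec, info_mul_H hu,
    Matrix.one_mulVec, dotProduct_smul, smul_eq_mul, dotProduct_comm,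
    X_transpose_mulVec_dotProduct] at h1
  have h2 := mul_left_cancel₀ (inv_ne_zero hnφ) h1
  simp only [Pi.sub_apply] at h2
  rw [h2]
  exact Finset.sum_congr rfl fun j _ => by rw [linDev]; ring

/-- The left-hand side is the conditional variance of the linearised deviation in direction `u`.
Residual variances are `M.φ` times the weights that build the information, so the sandwich `H * info
* H` collapses to `H`. -/
lemma sum_linCoef_sq (hM : M.IsValid) {b : Vec p}
    (hu : IsUnit (M.info D i b)) (hn : 0 < D.n i) (u : Vec p) :
    ∑ j, M.linCoef D i b u j ^ 2 * (M.φ * M.weight D i b j) =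
      (D.n i : ℝ)⁻¹ * matForm (M.H D i b) u u := by
  have hφ := hM.φ_pos
  have hn' : (0 : ℝ) < D.n i := by exact_mod_cast hn
  set w : Vec p := WithLp.toLp 2 (M.H D i b *ᵥ WithLp.ofLp u) with hw
  have h1 := M.matForm_info D i b w w
  have h2 : matForm (M.info D i b) w w = matForm (M.H D i b) u u := by
    rw [matForm_apply, hw, Matrix.mulVec_mulVec, info_mul_H hu, Matrix.one_mulVec,
      dotProduct_comm, matForm_apply]
  rw [← h2, h1, Finset.mul_sum, Finset.mul_sum]
  refine Finset.sum_congr rfl fun j _ => ?_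
  rw [linCoef, ← hw]
  field_simp

/-- With the weights included, the sum would be `M.φ` times the trace of `H * info = 1`, that is
`M.φ * p`; dropping the weights costs `c⁻¹`. The mean energy of the noise is thus bounded without
any bound on `H`. -/
lemma sum_matForm_H_le (hM : M.IsValid) (hc : CumulantBounds M c) {b : Vec p}
    (hu : IsUnit (M.info D i b)) (hn : 0 < D.n i) :
    ∑ j : Fin (D.n i), (D.n i : ℝ)⁻¹ * matForm (M.H D i b) (D.x i j) (D.x i j) ≤
      c⁻¹ * (M.φ * p) := by
  have hφ := hM.φ_pos
  have hc₀ := hc.pos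
  have hn' : (0 : ℝ) < D.n i := by exact_mod_cast hn
  have hH := posDef_H hM hc hu
  have htr : ∑ j : Fin (D.n i), (D.n i : ℝ)⁻¹ *
      (M.weight D i b j * matForm (M.H D i b) (D.x i j) (D.x i j)) = M.φ * p := by
    have h1 : (M.H D i b * M.info D i b).trace = p := by
      rw [H_mul_info hu, Matrix.trace_one, Fintype.card_fin]
    rw [← h1, Matrix.trace]
    simp only [Matrix.diag, Matrix.mul_apply, info_apply, matForm_eq_sum, Finset.mul_sum]
    rw [Finset.sum_comm]
    refine Finset.sum_congr rfl fun k _ => ?_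
    rw [Finset.sum_comm]
    refine Finset.sum_congr rfl fun l _ => Finset.sum_congr rfl fun j _ => ?_
    field_simp
  rw [← htr, Finset.mul_sum]
  refine Finset.sum_le_sum fun j _ => ?_
  have hnn := matForm_nonneg hH.posSemidef (D.x i j)
  have h3 : matForm (M.H D i b) (D.x i j) (D.x i j) ≤
      c⁻¹ * (M.weight D i b j * matForm (M.H D i b) (D.x i j) (D.x i j)) := by
    rw [← mul_assoc]
    refine le_mul_of_one_le_left hnn ?_
    rw [← div_eq_inv_mul, one_le_div hc₀]
    exact hc.le_two _
  calc _ ≤ (D.n i : ℝ)⁻¹ * (c⁻¹ * (M.weight D i b j *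
        matForm (M.H D i b) (D.x i j) (D.x i j))) := by gcongr
    _ = _ := by ring

lemma continuous_linPred (x β : Vec p) : Continuous fun b : Vec p => linPred x β b := by
  unfold linPred; fun_prop

lemma continuous_info (hc : CumulantBounds M c) (k l : Fin p) :
    Continuous fun b => M.info D i b k l := by
  simp only [info_apply, weight]
  refine continuous_const.mul (continuous_finsetSum _ fun j _ => ?_)
  exact ((hc.continuous_two.comp (continuous_linPred _ _)).mul continuous_const).mul
    continuous_const

/-- By Cramer's rule an entry of the inverse is a product of `det⁻¹` and a continuous function. The
convention `0⁻¹ = 0` makes invertibility unnecessary. -/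
lemma measurable_H (hc : CumulantBounds M c) (k l : Fin p) :
    Measurable fun b => M.H D i b k l := by
  have h : Continuous fun b => M.info D i b :=
    continuous_pi fun k => continuous_pi fun l => continuous_info hc k l
  have h1 : Continuous fun b => (M.info D i b).det := h.matrix_det
  have h2 : Continuous fun b => (M.info D i b).adjugate k l :=
    h.matrix_adjugate.matrix_elem k l
  simp only [H, Matrix.inv_def, Matrix.smul_apply, Ring.inverse_eq_inv', smul_eq_mul]
  exact h1.measurable.inv.mul h2.measurable

lemma measurable_mean (hc : CumulantBounds M c) (j : Fin (D.n i)) :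
    Measurable fun b => M.mean D i b j :=
  (hc.continuous_deriv.comp (continuous_linPred _ _)).measurable

lemma measurable_linDev (hc : CumulantBounds M c) :
    Measurable fun q : Vec p × (Fin (D.n i) → ℝ) => M.linDev D i q.1 q.2 := by
  unfold linDev
  refine (PiLp.continuous_toLp 2 _).measurable.comp (measurable_pi_lambda _ fun k => ?_)
  simp only [Pi.smul_apply, smul_eq_mul, Matrix.mulVec, dotProduct, Pi.sub_apply]
  refine measurable_const.mul (Finset.measurable_sum _ fun l _ =>
    ((measurable_H hc k l).comp measurable_fst).mul (Finset.measurable_sum _ fun j _ =>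
      measurable_const.mul ?_))
  exact ((measurable_pi_apply j).comp measurable_snd).sub
    ((measurable_mean hc j).comp measurable_fst)

end Model

end PQL
end

/-! ### Conditional law of the responses given the random effect. -/

noncomputable section
namespace PQL

section PiDensity

lemma lintegral_fin_prod_eq_prod {n : ℕ} {α : Type*} [MeasurableSpace α] {μ : Measure α}
    [SigmaFinite μ] {f : Fin n → α → ENNReal} (hf : ∀ j, Measurable (f j)) :
    ∫⁻ y : Fin n → α, ∏ j, f j (y j) ∂(Measure.pi fun _ => μ) = ∏ j, ∫⁻ y, f j y ∂μ := by
  induction n with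
  | zero => simp
  | succ n ih =>
    calc ∫⁻ y : Fin (n + 1) → α, ∏ j, f j (y j) ∂(Measure.pi fun _ => μ)
        = ∫⁻ q : α × (Fin n → α), f 0 q.1 * ∏ j : Fin n, f j.succ (q.2 j)
            ∂(μ.prod (Measure.pi fun _ => μ)) := by
          rw [← ((measurePreserving_piFinSuccAbove
              (fun _ : Fin (n + 1) => μ) 0).symm).lintegral_comp_emb
            (MeasurableEquiv.measurableEmbedding _)]
          simp_rw [MeasurableEquiv.piFinSuccAbove_symm_apply, Fin.insertNthEquiv,
            Fin.prod_univ_succ, Fin.insertNth_zero, Equiv.coe_fn_mk, Fin.cons_succ, Fin.cons_zero]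
          rfl
      _ = _ := by
          rw [lintegral_prod_mul (g := fun y : Fin n → α => ∏ j : Fin n, f j.succ (y j))
            (hf 0).aemeasurable (Finset.measurable_fun_prod _ fun j _ =>
              (hf j.succ).comp (measurable_pi_apply j)).aemeasurable,
            ih fun j => hf j.succ, Fin.prod_univ_succ]

lemma pi_withDensity {n : ℕ} {α : Type*} [MeasurableSpace α] {μ : Measure α}
    [SigmaFinite μ] {f : Fin n → α → ENNReal} (hf : ∀ j, Measurable (f j))
    [∀ j, SigmaFinite (μ.withDensity (f j))] :
    (Measure.pi fun j => μ.withDensity (f j)) =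
      (Measure.pi fun _ => μ).withDensity fun y => ∏ j, f j (y j) := by
  refine Measure.pi_eq fun s hs => ?_
  rw [withDensity_apply _ (MeasurableSet.univ_pi hs),
    ← lintegral_indicator (MeasurableSet.univ_pi hs)]
  have h : ∀ y : Fin n → α, (Set.univ.pi s).indicator (fun y => ∏ j, f j (y j)) y =
      ∏ j, (s j).indicator (f j) (y j) := fun y => by
    by_cases hy : y ∈ Set.univ.pi s
    · rw [Set.indicator_of_mem hy]
      exact Finset.prod_congr rfl fun j _ => (Set.indicator_of_mem (hy j (Set.mem_univ j)) _).symm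
    · rw [Set.indicator_of_notMem hy]
      simp only [Set.mem_pi, Set.mem_univ, true_implies, not_forall] at hy
      obtain ⟨j, hj⟩ := hy
      exact (Finset.prod_eq_zero (Finset.mem_univ j) (Set.indicator_of_notMem hj _)).symm
  simp_rw [h]
  rw [lintegral_fin_prod_eq_prod fun j => (hf j).indicator (hs j)]
  refine Finset.prod_congr rfl fun j _ => ?_
  rw [lintegral_indicator (hs j), withDensity_apply _ (hs j)]

end PiDensity

variable {p : ℕ}

namespace Model

variable (M : Model p) (D : Design p) (i : ℕ)

/-- The conditional law of the responses of cluster `i` given its random effect. -/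
def condLaw (b : Vec p) : Measure (Fin (D.n i) → ℝ) :=
  Measure.pi fun j => M.law (linPred (D.x i j) M.β b)

variable {M D i} {c : ℝ}

lemma isProbabilityMeasure_condLaw (hM : M.IsValid) (b : Vec p) :
    IsProbabilityMeasure (M.condLaw D i b) := by
  have := isProbabilityMeasure_law hM
  unfold condLaw
  infer_instance

/-- The joint density is a product over the measurements, each factor a probability density in its
response, so the joint law disintegrates with the product of the individual laws as kernel. The
kernel also supplies the measurable dependence on `b`. -/
lemma exists_condKernel (hM : M.IsValid) (hc : CumulantBounds M c) :
    ∃ κ : Kernel (Vec p) (Fin (D.n i) → ℝ), IsMarkovKernel κ ∧ (∀ b, κ b = M.condLaw D i b) ∧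
      ((multivariateGaussian 0 M.G).prod (Measure.pi fun _ : Fin (D.n i) => M.ν)).withDensity
        (fun q => ∏ j : Fin (D.n i),
          ENNReal.ofReal (M.density M.φ (linPred (D.x i j) M.β q.1) (q.2 j))) =
        (multivariateGaussian 0 M.G) ⊗ₘ κ := by
  have := hM.sigmaFinite
  have hprob := isProbabilityMeasure_law hM
  set f : Vec p → (Fin (D.n i) → ℝ) → ENNReal := fun b y => ∏ j : Fin (D.n i),
    ENNReal.ofReal (M.density M.φ (linPred (D.x i j) M.β b) (y j)) with hf
  have hfm : Measurable (Function.uncurry f) := by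
    refine Finset.measurable_fun_prod _ fun j _ => ENNReal.measurable_ofReal.comp ?_
    exact (measurable_density hM hc.continuous.measurable).comp
      (((continuous_linPred _ _).measurable.comp measurable_fst).prodMk
        ((measurable_pi_apply j).comp measurable_snd))
  set κ := Kernel.withDensity (Kernel.const (Vec p) (Measure.pi fun _ : Fin (D.n i) => M.ν)) f
  have hκ : ∀ b, κ b = M.condLaw D i b := fun b => by
    rw [Kernel.withDensity_apply _ hfm, Kernel.const_apply, condLaw]
    have : ∀ j : Fin (D.n i), SigmaFinite (M.ν.withDensity fun y =>
        ENNReal.ofReal (M.density M.φ (linPred (D.x i j) M.β b) y)) := fun j => by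
      have := hprob (linPred (D.x i j) M.β b)
      rw [law] at this
      infer_instance
    exact (pi_withDensity fun j => (measurable_density_right hM _).ennreal_ofReal).symm
  have hmk : IsMarkovKernel κ := ⟨fun b => by
    rw [hκ]; exact isProbabilityMeasure_condLaw hM b⟩
  refine ⟨κ, hmk, hκ, ?_⟩
  change (Measure.prod _ _).withDensity (Function.uncurry f) = _
  ext s hs
  rw [Measure.compProd_apply hs, withDensity_apply _ hs, ← lintegral_indicator hs,
    lintegral_prod _ ((hfm.indicator hs).aemeasurable)]
  refine lintegral_congr fun b => ?_
  rw [Kernel.withDensity_apply _ hfm, Kernel.const_apply,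
    withDensity_apply _ (measurable_prodMk_left hs),
    ← lintegral_indicator (measurable_prodMk_left hs)]
  rfl

lemma memLp_sub_law (hM : M.IsValid) (η : ℝ) :
    MemLp (fun y => y - deriv M.a η) 2 (M.law η) :=
  (memLp_two_iff_integrable_sq (by fun_prop)).2 (integrable_sub_sq_law hM η)

lemma memLp_condLaw (hM : M.IsValid) (b : Vec p) (w : Fin (D.n i) → ℝ) :
    MemLp (fun y => ∑ j, w j * (y j - M.mean D i b j)) 2 (M.condLaw D i b) := by
  have hprob := isProbabilityMeasure_law hM
  refine memLp_finsetSum _ fun j _ => MemLp.const_mul ?_ _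
  exact (memLp_sub_law hM (linPred (D.x i j) M.β b)).comp_measurePreserving
    (measurePreserving_eval (fun j : Fin (D.n i) => M.law (linPred (D.x i j) M.β b)) j)

lemma integral_condLaw (hM : M.IsValid) (hc : CumulantBounds M c) (b : Vec p)
    (w : Fin (D.n i) → ℝ) :
    ∫ y, ∑ j, w j * (y j - M.mean D i b j) ∂(M.condLaw D i b) = 0 := by
  have hprob := isProbabilityMeasure_law hM
  have := isProbabilityMeasure_condLaw (D := D) (i := i) hM b
  have hmp : ∀ j, MeasurePreserving (fun y : Fin (D.n i) → ℝ => y j) (M.condLaw D i b)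
      (M.law (linPred (D.x i j) M.β b)) := fun j =>
    measurePreserving_eval (fun j : Fin (D.n i) => M.law (linPred (D.x i j) M.β b)) j
  rw [integral_finsetSum]
  · refine Finset.sum_eq_zero fun j _ => ?_
    rw [integral_const_mul]
    have h := integral_sub_law hM hc (linPred (D.x i j) M.β b)
    rw [← (hmp j).map_eq, integral_map (hmp j).aemeasurable (by fun_prop)] at h
    rw [mean, h, mul_zero]
  · intro j _
    refine Integrable.const_mul ?_ _
    exact ((memLp_sub_law hM (linPred (D.x i j) M.β b)).comp_measurePreserving
      (hmp j)).integrable one_le_two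

lemma integral_sq_condLaw (hM : M.IsValid) (hc : CumulantBounds M c) (b : Vec p)
    (w : Fin (D.n i) → ℝ) :
    ∫ y, (∑ j, w j * (y j - M.mean D i b j)) ^ 2 ∂(M.condLaw D i b) =
      ∑ j, w j ^ 2 * (M.φ * M.weight D i b j) := by
  have hprob := isProbabilityMeasure_law hM
  have := isProbabilityMeasure_condLaw (D := D) (i := i) hM b
  have h0 := integral_condLaw hM hc b w
  have h1 := variance_of_integral_eq_zero
    (memLp_condLaw hM b w).aestronglyMeasurable.aemeasurable h0
  rw [← h1]
  have h2 := variance_sum_pi (μ := fun j : Fin (D.n i) => M.law (linPred (D.x i j) M.β b))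
    (X := fun j y => w j * (y - deriv M.a (linPred (D.x i j) M.β b)))
    fun j => (memLp_sub_law hM _).const_mul _
  have e : (fun y : Fin (D.n i) → ℝ => ∑ j, w j * (y j - M.mean D i b j)) =
      ∑ j, fun y : Fin (D.n i) → ℝ => w j * (y j - deriv M.a (linPred (D.x i j) M.β b)) := by
    ext y; simp [mean]
  rw [e, condLaw, h2]
  refine Finset.sum_congr rfl fun j _ => ?_
  rw [variance_const_mul, variance_of_integral_eq_zero (by fun_prop) (integral_sub_law hM hc _),
    integral_sq_law hM hc, weight]

/-- Conditional independence makes both characteristic functions products over the measurements;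
telescoping adds up the errors for single responses. -/
lemma norm_charFun_condLaw_sub_le (hM : M.IsValid) (hc : CumulantBounds M c) (b : Vec p)
    (w : Fin (D.n i) → ℝ) :
    ‖∫ y, Complex.exp ((∑ j, w j * (y j - M.mean D i b j) : ℝ) * Complex.I) ∂(M.condLaw D i b)
        - Real.exp (-(∑ j, w j ^ 2 * (M.φ * M.weight D i b j)) / 2)‖ ≤
      ∑ j, (48 * Real.exp (c⁻¹ * M.φ) * |w j| ^ 3 + (w j ^ 2 * (M.φ * c⁻¹) / 2) ^ 2) := by
  have hprob := isProbabilityMeasure_law hM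
  have e1 : ∫ y, Complex.exp ((∑ j, w j * (y j - M.mean D i b j) : ℝ) * Complex.I)
      ∂(M.condLaw D i b) = ∏ j : Fin (D.n i),
        ∫ y, Complex.exp ((w j * (y - deriv M.a (linPred (D.x i j) M.β b)) : ℝ) * Complex.I)
          ∂(M.law (linPred (D.x i j) M.β b)) := by
    rw [← integral_fintype_prod_eq_prod (μ := fun j : Fin (D.n i) =>
      M.law (linPred (D.x i j) M.β b)) (f := fun j y =>
        Complex.exp ((w j * (y - deriv M.a (linPred (D.x i j) M.β b)) : ℝ) * Complex.I)), condLaw]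
    refine integral_congr_ae (ae_of_all _ fun y => ?_)
    simp only [← Complex.exp_sum, Complex.ofReal_sum, Finset.sum_mul]
    rfl
  have e2 : (Real.exp (-(∑ j, w j ^ 2 * (M.φ * M.weight D i b j)) / 2) : ℂ) =
      ∏ j, (Real.exp (-(w j ^ 2 * (M.φ * M.weight D i b j) / 2)) : ℂ) := by
    rw [← Complex.ofReal_prod, ← Real.exp_sum]
    congr 2
    rw [Finset.sum_neg_distrib, ← Finset.sum_div, neg_div]
  rw [e1, e2]
  refine (norm_prod_sub_prod_le _ _ _ (fun j _ => ?_) fun j _ => ?_).trans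
    (Finset.sum_le_sum fun j _ => norm_charFun_law_sub_le hM hc _ _)
  · refine (norm_integral_le_integral_norm _).trans ?_
    simp only [Complex.norm_exp_ofReal_mul_I]
    simp
  · rw [Complex.norm_real, Real.norm_eq_abs, Real.abs_exp, Real.exp_le_one_iff]
    have := hc.pos.le.trans (hc.le_two (linPred (D.x i j) M.β b))
    have := hM.φ_pos
    rw [weight]
    simp only [Left.neg_nonpos_iff]
    positivity

lemma integral_inner_linDev (hM : M.IsValid) (hc : CumulantBounds M c) {b : Vec p}
    (hu : IsUnit (M.info D i b)) (u : Vec p) :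
    ∫ y, inner ℝ u (M.linDev D i b y) ∂(M.condLaw D i b) = 0 := by
  simp_rw [inner_linDev hM hc hu]
  exact integral_condLaw hM hc b _

lemma memLp_inner_linDev (hM : M.IsValid) (hc : CumulantBounds M c) {b : Vec p}
    (hu : IsUnit (M.info D i b)) (u : Vec p) :
    MemLp (fun y => inner ℝ u (M.linDev D i b y)) 2 (M.condLaw D i b) := by
  simp_rw [inner_linDev hM hc hu]
  exact memLp_condLaw hM b _

lemma integral_inner_linDev_sq (hM : M.IsValid) (hc : CumulantBounds M c) {b : Vec p}
    (hu : IsUnit (M.info D i b)) (hn : 0 < D.n i) (u : Vec p) :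
    ∫ y, inner ℝ u (M.linDev D i b y) ^ 2 ∂(M.condLaw D i b) =
      (D.n i : ℝ)⁻¹ * matForm (M.H D i b) u u := by
  simp_rw [inner_linDev hM hc hu]
  rw [integral_sq_condLaw hM hc, sum_linCoef_sq hM hu hn]

lemma lintegral_energy_linDev_le (hM : M.IsValid) (hc : CumulantBounds M c) {b : Vec p}
    (hu : IsUnit (M.info D i b)) (hn : 0 < D.n i) :
    ∫⁻ y, ENNReal.ofReal (energy (fun j : Fin (D.n i) => D.x i j) (M.linDev D i b y))
      ∂(M.condLaw D i b) ≤ ENNReal.ofReal (c⁻¹ * (M.φ * p)) := by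
  have hint : ∀ j : Fin (D.n i), Integrable
      (fun y => inner ℝ (D.x i j) (M.linDev D i b y) ^ 2) (M.condLaw D i b) := fun j =>
    (memLp_inner_linDev hM hc hu (D.x i j)).integrable_sq
  rw [← ofReal_integral_eq_lintegral_ofReal]
  · refine ENNReal.ofReal_le_ofReal ?_
    simp only [energy]
    rw [integral_finsetSum _ fun j _ => hint j]
    simp_rw [integral_inner_linDev_sq hM hc hu hn]
    exact sum_matForm_H_le hM hc hu hn
  · exact integrable_finsetSum _ fun j _ => hint j
  · exact ae_of_all _ fun y => energy_nonneg _ _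

/-- After scaling by the root of the cluster size n, each coefficient is O(n^(-1/2)). The n cubic
errors add up to O(n^(-1/2)) and the n quartic ones to O(n⁻¹). The remaining factor depends on the
design only through `H` and `Cx`. -/
lemma norm_charFun_linDev_sub_le (hM : M.IsValid) (hc : CumulantBounds M c) {b : Vec p}
    (hu : IsUnit (M.info D i b)) (hn : 0 < D.n i) {Cx : ℝ} (hx : ∀ j < D.n i, ‖D.x i j‖ ≤ Cx)
    (u : Vec p) :
    ‖∫ y, Complex.exp ((√(D.n i : ℝ) * inner ℝ u (M.linDev D i b y) : ℝ) * Complex.I)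
          ∂(M.condLaw D i b) - Real.exp (-matForm (M.H D i b) u u / 2)‖ ≤
      (√(D.n i : ℝ))⁻¹ *
        (48 * Real.exp (c⁻¹ * M.φ) *
            (M.φ⁻¹ * Cx * ‖(WithLp.toLp 2 (M.H D i b *ᵥ WithLp.ofLp u) : Vec p)‖) ^ 3
          + ((M.φ⁻¹ * Cx * ‖(WithLp.toLp 2 (M.H D i b *ᵥ WithLp.ofLp u) : Vec p)‖) ^ 2
            * (M.φ * c⁻¹) / 2) ^ 2) := by
  have hφ := hM.φ_pos
  have hc₀ := hc.pos
  have hn' : (0 : ℝ) < D.n i := by exact_mod_cast hn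
  set r := √(D.n i : ℝ) with hr
  have hr0 : 0 < r := Real.sqrt_pos.2 hn'
  have hr2 : r ^ 2 = D.n i := Real.sq_sqrt hn'.le
  have hr1 : 1 ≤ r := by
    rw [hr, Real.one_le_sqrt]; exact_mod_cast hn
  set A := M.φ⁻¹ * Cx * ‖(WithLp.toLp 2 (M.H D i b *ᵥ WithLp.ofLp u) : Vec p)‖ with hA
  have hCx : 0 ≤ Cx := (norm_nonneg _).trans (hx 0 hn)
  have hA0 : 0 ≤ A := by positivity
  have h := norm_charFun_condLaw_sub_le hM hc b fun j => r * M.linCoef D i b u j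
  have e1 : ∀ y : Fin (D.n i) → ℝ, ∑ j, r * M.linCoef D i b u j * (y j - M.mean D i b j) =
      r * inner ℝ u (M.linDev D i b y) := fun y => by
    rw [inner_linDev hM hc hu, Finset.mul_sum]
    exact Finset.sum_congr rfl fun j _ => by ring
  have e2 : ∑ j, (r * M.linCoef D i b u j) ^ 2 * (M.φ * M.weight D i b j) =
      matForm (M.H D i b) u u := by
    simp_rw [mul_pow, mul_assoc]
    rw [← Finset.mul_sum, sum_linCoef_sq hM hu hn, hr2]
    field_simp
  simp_rw [e1, e2] at h
  refine h.trans ?_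
  have hw : ∀ j, |r * M.linCoef D i b u j| ≤ r⁻¹ * A := fun j => by
    rw [abs_mul, linCoef, abs_mul, abs_of_pos hr0, abs_of_pos (by positivity)]
    have := (abs_real_inner_le_norm (D.x i j)
      (WithLp.toLp 2 (M.H D i b *ᵥ WithLp.ofLp u) : Vec p)).trans
        (mul_le_mul_of_nonneg_right (hx j j.2) (norm_nonneg _))
    calc r * (((D.n i : ℝ) * M.φ)⁻¹ * |inner ℝ (D.x i j)
          (WithLp.toLp 2 (M.H D i b *ᵥ WithLp.ofLp u) : Vec p)|)
        ≤ r * (((D.n i : ℝ) * M.φ)⁻¹ *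
          (Cx * ‖(WithLp.toLp 2 (M.H D i b *ᵥ WithLp.ofLp u) : Vec p)‖)) := by gcongr
      _ = r⁻¹ * A := by rw [hA, ← hr2]; field_simp
  calc ∑ j, (48 * Real.exp (c⁻¹ * M.φ) * |r * M.linCoef D i b u j| ^ 3
        + ((r * M.linCoef D i b u j) ^ 2 * (M.φ * c⁻¹) / 2) ^ 2)
      ≤ ∑ _j : Fin (D.n i), (48 * Real.exp (c⁻¹ * M.φ) * (r⁻¹ * A) ^ 3
        + ((r⁻¹ * A) ^ 2 * (M.φ * c⁻¹) / 2) ^ 2) := by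
        refine Finset.sum_le_sum fun j _ => ?_
        have h2 : (r * M.linCoef D i b u j) ^ 2 ≤ (r⁻¹ * A) ^ 2 := by
          rw [← sq_abs]; exact pow_le_pow_left₀ (abs_nonneg _) (hw j) 2
        have h3 := hw j
        gcongr
    _ = r⁻¹ * (48 * Real.exp (c⁻¹ * M.φ) * A ^ 3)
        + r⁻¹ ^ 2 * (A ^ 2 * (M.φ * c⁻¹) / 2) ^ 2 := by
        rw [Finset.sum_const, Finset.card_univ, Fintype.card_fin, nsmul_eq_mul, ← hr2]
        field_simp
    _ ≤ _ := by
        have h4 : r⁻¹ ^ 2 ≤ r⁻¹ := by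
          rw [sq]; exact mul_le_of_le_one_left (by positivity) (inv_le_one_of_one_le₀ hr1)
        rw [mul_add]
        gcongr

end Model

end PQL
end

/-! ### Unconditional moments and independence of the clusters. -/

noncomputable section
namespace PQL

variable {p : ℕ} {Ω : Type*} [MeasurableSpace Ω] {P : Measure Ω} {M : Model p} {D : Design p}
  {S : Sample p Ω} {i : ℕ} {c : ℝ}

set_option linter.unusedSectionVars false

section IndependentSum

lemma integral_norm_sum_sq [IsProbabilityMeasure P] {m : ℕ} {V : Fin m → Ω → Vec p}
    (hind : iIndepFun V P) (hL : ∀ i k, MemLp (fun ω => V i ω k) 2 P)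
    (h0 : ∀ i k, ∫ ω, V i ω k ∂P = 0) :
    ∫ ω, ‖∑ i, V i ω‖ ^ 2 ∂P = ∑ i, ∫ ω, ‖V i ω‖ ^ 2 ∂P := by
  have hk : ∀ k, ∫ ω, (∑ i, V i ω k) ^ 2 ∂P = ∑ i, ∫ ω, V i ω k ^ 2 ∂P := fun k => by
    have hS : ∫ ω, (∑ i, fun ω => V i ω k) ω ∂P = 0 := by
      simp only [Finset.sum_apply]
      rw [integral_finsetSum _ fun i _ => (hL i k).integrable one_le_two]
      exact Finset.sum_eq_zero fun i _ => h0 i k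
    have h1 := IndepFun.variance_sum (μ := P) (X := fun i ω => V i ω k) (s := Finset.univ)
      (fun i _ => hL i k) fun i _ j _ hij =>
        (hind.indepFun hij).comp (φ := fun v : Vec p => v k) (ψ := fun v : Vec p => v k)
          (by fun_prop) (by fun_prop)
    rw [variance_of_integral_eq_zero (Finset.aemeasurable_sum _ fun i _ =>
      (hL i k).aestronglyMeasurable.aemeasurable) hS] at h1
    simp only [Finset.sum_apply] at h1
    rw [h1]
    exact Finset.sum_congr rfl fun i _ => variance_of_integral_eq_zero
      (hL i k).aestronglyMeasurable.aemeasurable (h0 i k)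
  have hsum : ∀ k, MemLp (fun ω => ∑ i, V i ω k) 2 P := fun k => memLp_finsetSum _ fun i _ => hL i k
  simp only [EuclideanSpace.real_norm_sq_eq, WithLp.ofLp_sum, Finset.sum_apply]
  rw [integral_finsetSum _ fun k _ => (hsum k).integrable_sq]
  simp_rw [hk]
  rw [Finset.sum_comm]
  exact Finset.sum_congr rfl fun i _ => (integral_finsetSum _ fun k _ =>
    (hL i k).integrable_sq).symm

end IndependentSum

/-- The data of cluster `i`. -/
def Sample.cluster (S : Sample p Ω) (D : Design p) (i : ℕ) (ω : Ω) : Vec p × (Fin (D.n i) → ℝ) :=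
  (S.b i ω, fun j => S.y i j ω)

/-- The linearised deviation of cluster `i` as a random variable. -/
def Sample.dev (S : Sample p Ω) (M : Model p) (D : Design p) (i : ℕ) (ω : Ω) : Vec p :=
  M.linDev D i (S.b i ω) fun j => S.y i j ω

/-- The squared length of the fitted linearised deviation of cluster `i`. -/
def Sample.devEnergy (S : Sample p Ω) (M : Model p) (D : Design p) (i : ℕ) (ω : Ω) : ℝ :=
  energy (fun j : Fin (D.n i) => D.x i j) (S.dev M D i ω)

namespace IsGLMM

lemma measurable_cluster (h : IsGLMM P M D S) (i : ℕ) : Measurable (S.cluster D i) :=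
  (h.measurable_b i).prodMk (measurable_pi_lambda _ fun j => h.measurable_y i j)

lemma measurable_dev (h : IsGLMM P M D S) (hc : CumulantBounds M c) (i : ℕ) :
    Measurable (S.dev M D i) := by
  have h1 := Model.measurable_linDev (D := D) (i := i) hc
  have h2 := h1.comp (h.measurable_cluster i)
  simp only [Function.comp_def, Sample.cluster] at h2
  unfold Sample.dev
  exact h2

lemma measurable_devEnergy (h : IsGLMM P M D S) (hc : CumulantBounds M c) (i : ℕ) :
    Measurable (S.devEnergy M D i) := by
  have := h.measurable_dev hc i
  unfold Sample.devEnergy energy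
  fun_prop

lemma exists_condKernel (h : IsGLMM P M D S) (hM : M.IsValid) (hc : CumulantBounds M c)
    (hi : i < D.m) : ∃ κ : Kernel (Vec p) (Fin (D.n i) → ℝ), IsMarkovKernel κ ∧
      (∀ b, κ b = M.condLaw D i b) ∧
      P.map (S.cluster D i) = (multivariateGaussian 0 M.G) ⊗ₘ κ := by
  obtain ⟨κ, h1, h2, h3⟩ := Model.exists_condKernel (D := D) (i := i) hM hc
  exact ⟨κ, h1, h2, (h.law i hi).trans h3⟩

lemma map_b (h : IsGLMM P M D S) (hM : M.IsValid) (hc : CumulantBounds M c) (hi : i < D.m) :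
    P.map (S.b i) = multivariateGaussian 0 M.G := by
  obtain ⟨κ, _, _, hκ⟩ := h.exists_condKernel hM hc hi
  have h1 : P.map (S.b i) = (P.map (S.cluster D i)).fst := by
    rw [Measure.fst, Measure.map_map measurable_fst (h.measurable_cluster i)]
    rfl
  rw [h1, hκ, Measure.fst_compProd]

lemma lintegral_norm_b_sq (h : IsGLMM P M D S) (hM : M.IsValid) (hc : CumulantBounds M c)
    (hi : i < D.m) : ∫⁻ ω, ENNReal.ofReal (‖S.b i ω‖ ^ 2) ∂P =
      ∫⁻ b, ENNReal.ofReal (‖b‖ ^ 2) ∂(multivariateGaussian 0 M.G) := by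
  rw [← h.map_b hM hc hi, lintegral_map (by fun_prop) (h.measurable_b i)]

lemma lintegral_devEnergy_le (h : IsGLMM P M D S) (hM : M.IsValid) (hc : CumulantBounds M c)
    (hi : i < D.m) (hn : 0 < D.n i) (hu : ∀ b, IsUnit (M.info D i b)) :
    ∫⁻ ω, ENNReal.ofReal (S.devEnergy M D i ω) ∂P ≤ ENNReal.ofReal (c⁻¹ * (M.φ * p)) := by
  obtain ⟨κ, _, hκ', hκ⟩ := h.exists_condKernel hM hc hi
  have hm : Measurable fun q : Vec p × (Fin (D.n i) → ℝ) => ENNReal.ofReal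
      (energy (fun j : Fin (D.n i) => D.x i j) (M.linDev D i q.1 q.2)) := by
    have := Model.measurable_linDev (D := D) (i := i) hc
    unfold energy
    fun_prop
  have e := lintegral_map (μ := P) hm (h.measurable_cluster i)
  rw [hκ, Measure.lintegral_compProd hm] at e
  refine e.symm.le.trans ?_
  calc _ ≤ ∫⁻ _, ENNReal.ofReal (c⁻¹ * (M.φ * p)) ∂(multivariateGaussian 0 M.G) := by
        refine lintegral_mono fun b => ?_
        rw [hκ']
        exact Model.lintegral_energy_linDev_le hM hc (hu b) hn
    _ = _ := by simp

lemma integrable_devEnergy (h : IsGLMM P M D S) (hM : M.IsValid) (hc : CumulantBounds M c)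
    (hi : i < D.m) (hn : 0 < D.n i) (hu : ∀ b, IsUnit (M.info D i b)) :
    Integrable (S.devEnergy M D i) P := by
  refine ⟨(h.measurable_devEnergy hc i).aestronglyMeasurable, ?_⟩
  have h0 : ∀ ω, 0 ≤ S.devEnergy M D i ω := fun ω => energy_nonneg _ _
  rw [hasFiniteIntegral_iff_ofReal (ae_of_all _ h0)]
  exact (h.lintegral_devEnergy_le hM hc hi hn hu).trans_lt ENNReal.ofReal_lt_top

lemma integral_devEnergy_le (h : IsGLMM P M D S) (hM : M.IsValid) (hc : CumulantBounds M c)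
    (hi : i < D.m) (hn : 0 < D.n i) (hu : ∀ b, IsUnit (M.info D i b)) :
    ∫ ω, S.devEnergy M D i ω ∂P ≤ c⁻¹ * (M.φ * p) := by
  have := hM.φ_pos
  have := hc.pos
  have h0 : ∀ ω, 0 ≤ S.devEnergy M D i ω := fun ω => energy_nonneg _ _
  rw [integral_eq_lintegral_of_nonneg_ae (ae_of_all _ h0)
    (h.measurable_devEnergy hc i).aestronglyMeasurable]
  exact ENNReal.toReal_le_of_le_ofReal (by positivity) (h.lintegral_devEnergy_le hM hc hi hn hu)

lemma norm_dev_sq_le {κ : ℝ} (hn : 0 < D.n i)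
    (hκ : ∀ v, (D.n i : ℝ) * ‖v‖ ^ 2 ≤ κ * energy (fun j : Fin (D.n i) => D.x i j) v) (ω : Ω) :
    ‖S.dev M D i ω‖ ^ 2 ≤ (D.n i : ℝ)⁻¹ * κ * S.devEnergy M D i ω := by
  have hn' : (0 : ℝ) < D.n i := by exact_mod_cast hn
  rw [mul_assoc, ← div_eq_inv_mul, le_div_iff₀ hn', mul_comm]
  exact hκ _

lemma memLp_dev (h : IsGLMM P M D S) (hM : M.IsValid) (hc : CumulantBounds M c)
    (hi : i < D.m) (hn : 0 < D.n i) (hu : ∀ b, IsUnit (M.info D i b)) :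
    MemLp (S.dev M D i) 2 P := by
  refine (memLp_two_iff_integrable_sq_norm (h.measurable_dev hc i).aestronglyMeasurable).2 ?_
  -- The random effect `0` is an arbitrary reference point for the deterministic curvature constant.
  refine ((h.integrable_devEnergy hM hc hi hn hu).const_mul
    ((D.n i : ℝ)⁻¹ * ((M.H D i 0).trace * (M.φ * c)⁻¹))).mono'
    ((h.measurable_dev hc i).norm.pow_const 2).aestronglyMeasurable (ae_of_all _ fun ω => ?_)
  rw [Real.norm_of_nonneg (sq_nonneg _)]
  exact norm_dev_sq_le hn (Model.mul_norm_sq_le_trace_H hM hc (hu 0) hn) ω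

lemma integral_inner_dev (h : IsGLMM P M D S) [IsProbabilityMeasure P] (hM : M.IsValid)
    (hc : CumulantBounds M c)
    (hi : i < D.m) (hn : 0 < D.n i) (hu : ∀ b, IsUnit (M.info D i b)) (u : Vec p) :
    ∫ ω, inner ℝ u (S.dev M D i ω) ∂P = 0 := by
  obtain ⟨κ, _, hκ', hκ⟩ := h.exists_condKernel hM hc hi
  have hm : Measurable fun q : Vec p × (Fin (D.n i) → ℝ) => inner ℝ u (M.linDev D i q.1 q.2) := by
    have := Model.measurable_linDev (D := D) (i := i) hc
    fun_prop
  have hint : Integrable (fun ω => inner ℝ u (S.dev M D i ω)) P :=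
    ((h.memLp_dev hM hc hi hn hu).integrable one_le_two).const_inner u
  have e := integral_map (μ := P) (h.measurable_cluster i).aemeasurable hm.aestronglyMeasurable
  have hint' := (integrable_map_measure (μ := P) hm.aestronglyMeasurable
    (h.measurable_cluster i).aemeasurable).2 hint
  rw [hκ] at e hint'
  rw [Measure.integral_compProd hint'] at e
  refine e.symm.trans ?_
  simp_rw [hκ', Model.integral_inner_linDev hM hc (hu _)]
  simp

/-- The deviations are independent and centred, so cross terms vanish and second moments add. The
sum therefore has squared norm of order m/n_L in the mean instead of m²/n_L. -/
lemma integral_norm_sum_dev_sq_le (h : IsGLMM P M D S) [IsProbabilityMeasure P] (hM : M.IsValid)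
    (hc : CumulantBounds M c) (hn : ∀ i < D.m, 0 < D.n i)
    (hu : ∀ i < D.m, ∀ b, IsUnit (M.info D i b)) {κ : ℕ → ℝ} (hκ₀ : ∀ i < D.m, 0 ≤ κ i)
    (hκ : ∀ i < D.m, ∀ v, (D.n i : ℝ) * ‖v‖ ^ 2 ≤
      κ i * energy (fun j : Fin (D.n i) => D.x i j) v) :
    ∫ ω, ‖∑ i ∈ Finset.range D.m, S.dev M D i ω‖ ^ 2 ∂P ≤
      ∑ i ∈ Finset.range D.m, (D.n i : ℝ)⁻¹ * κ i * (c⁻¹ * (M.φ * p)) := by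
  have hcoord : ∀ (v : Vec p) k, v k = inner ℝ (EuclideanSpace.single k (1 : ℝ)) v := fun v k => by
    simp [EuclideanSpace.inner_single_left]
  simp_rw [Finset.sum_range]
  rw [integral_norm_sum_sq (V := fun (i : Fin D.m) => S.dev M D i)]
  · refine Finset.sum_le_sum fun i _ => ?_
    have hn' := hn i i.2
    have := hκ₀ i i.2
    calc ∫ ω, ‖S.dev M D i ω‖ ^ 2 ∂P
        ≤ ∫ ω, (D.n i : ℝ)⁻¹ * κ i * S.devEnergy M D i ω ∂P := by
          refine integral_mono (h.memLp_dev hM hc i.2 hn' (hu i i.2)).integrable_norm_pow'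
            ((h.integrable_devEnergy hM hc i.2 hn' (hu i i.2)).const_mul _)
            fun ω => norm_dev_sq_le hn' (hκ i i.2) ω
      _ ≤ _ := by
          rw [integral_const_mul]
          gcongr
          exact h.integral_devEnergy_le hM hc i.2 hn' (hu i i.2)
  · exact h.indep.comp (fun i q => M.linDev D i q.1 q.2) fun i => Model.measurable_linDev hc
  · intro i k
    simp_rw [hcoord _ k]
    exact (h.memLp_dev hM hc i.2 (hn i i.2) (hu i i.2)).const_inner _
  · intro i k
    simp_rw [hcoord _ k]
    exact h.integral_inner_dev hM hc i.2 (hn i i.2) (hu i i.2) _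

lemma integrable_norm_sum_dev_sq (h : IsGLMM P M D S) [IsProbabilityMeasure P] (hM : M.IsValid)
    (hc : CumulantBounds M c) (hn : ∀ i < D.m, 0 < D.n i)
    (hu : ∀ i < D.m, ∀ b, IsUnit (M.info D i b)) :
    Integrable (fun ω => ‖∑ i ∈ Finset.range D.m, S.dev M D i ω‖ ^ 2) P := by
  have : MemLp (fun ω => ∑ i ∈ Finset.range D.m, S.dev M D i ω) 2 P :=
    memLp_finsetSum _ fun i hi => h.memLp_dev hM hc (Finset.mem_range.1 hi)
      (hn i (Finset.mem_range.1 hi)) (hu i (Finset.mem_range.1 hi))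
  exact this.integrable_norm_pow'

lemma integral_exp_inner_dev (h : IsGLMM P M D S) [IsProbabilityMeasure P] (hM : M.IsValid)
    (hc : CumulantBounds M c) (hi : i < D.m) (r : ℝ) (u : Vec p) :
    ∫ ω, Complex.exp ((r * inner ℝ u (S.dev M D i ω) : ℝ) * Complex.I) ∂P =
      ∫ b, ∫ y, Complex.exp ((r * inner ℝ u (M.linDev D i b y) : ℝ) * Complex.I)
        ∂(M.condLaw D i b) ∂(multivariateGaussian 0 M.G) := by
  obtain ⟨κ, _, hκ', hκ⟩ := h.exists_condKernel hM hc hi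
  have hm : Measurable fun q : Vec p × (Fin (D.n i) → ℝ) =>
      Complex.exp ((r * inner ℝ u (M.linDev D i q.1 q.2) : ℝ) * Complex.I) := by
    have := Model.measurable_linDev (D := D) (i := i) hc
    fun_prop
  have e := integral_map (μ := P) (h.measurable_cluster i).aemeasurable hm.aestronglyMeasurable
  have hint : Integrable (fun q : Vec p × (Fin (D.n i) → ℝ) =>
      Complex.exp ((r * inner ℝ u (M.linDev D i q.1 q.2) : ℝ) * Complex.I))
      ((multivariateGaussian 0 M.G) ⊗ₘ κ) :=
    Integrable.of_bound hm.aestronglyMeasurable 1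
      (ae_of_all _ fun q => by rw [Complex.norm_exp_ofReal_mul_I])
  rw [hκ, Measure.integral_compProd hint] at e
  simp_rw [hκ'] at e
  exact e.symm

/-- The characteristic function of a combination of the linearised deviation of cluster `i` and of
the random effects of the other clusters. -/
lemma integral_exp_inner_dev_sub_sum (h : IsGLMM P M D S) [IsProbabilityMeasure P]
    (hM : M.IsValid) (hc : CumulantBounds M c) (hi : i < D.m) (r s : ℝ) (u : Vec p) :
    ∫ ω, Complex.exp ((inner ℝ u (r • S.dev M D i ω
        - s • ∑ k ∈ (Finset.range D.m).erase i, S.b k ω) : ℝ) * Complex.I) ∂P =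
      (∫ ω, Complex.exp ((r * inner ℝ u (S.dev M D i ω) : ℝ) * Complex.I) ∂P) *
        Real.exp (-((D.m - 1 : ℝ) * s ^ 2 * matForm M.G u u / 2)) := by
  classical
  -- One function for each cluster: the deviation for cluster `i`, the random effect for every
  -- other. The random effect of cluster `i` is left out because it is not independent of the
  -- deviation; hence the factor `D.m - 1`.
  set f : (k : Fin D.m) → Vec p × (Fin (D.n k) → ℝ) → ℂ := fun k q =>
    if (k : ℕ) = i then Complex.exp ((r * inner ℝ u (M.linDev D k q.1 q.2) : ℝ) * Complex.I)
    else Complex.exp ((inner ℝ q.1 (-(s • u)) : ℝ) * Complex.I) with hf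
  set g : ℕ → Ω → ℝ := fun k ω =>
    if k = i then r * inner ℝ u (S.dev M D k ω) else inner ℝ (S.b k ω) (-(s • u)) with hg
  have hfm : ∀ k, Measurable (f k) := fun k => by
    have := Model.measurable_linDev (D := D) (i := k) hc
    by_cases hk : (k : ℕ) = i
    · simp only [hf, hk, if_true]
      fun_prop
    · simp only [hf, hk, if_false]
      fun_prop
  have hfg : ∀ (k : Fin D.m) ω, f k (S.cluster D k ω) =
      Complex.exp ((g k ω : ℝ) * Complex.I) := fun k ω => by
    by_cases hk : (k : ℕ) = i
    · simp only [hf, hg, if_pos hk]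
      rfl
    · simp only [hf, hg, hk, if_false]
      rfl
  have hprod := iIndepFun.integral_fun_prod_comp (f := f) h.indep
    (fun k => (h.measurable_cluster k).aemeasurable) (fun k => (hfm k).aestronglyMeasurable)
  change ∫ ω, ∏ k, f k (S.cluster D k ω) ∂P = ∏ k, ∫ ω, f k (S.cluster D k ω) ∂P at hprod
  simp_rw [hfg] at hprod
  rw [← Finset.prod_range fun k => ∫ ω, Complex.exp ((g k ω : ℝ) * Complex.I) ∂P,
    ← Finset.mul_prod_erase _ _ (Finset.mem_range.2 hi)] at hprod
  have hgi : ∀ ω, g i ω = r * inner ℝ u (S.dev M D i ω) := fun ω => if_pos rfl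
  have hgk : ∀ k ∈ (Finset.range D.m).erase i, ∀ ω, g k ω = inner ℝ (S.b k ω) (-(s • u)) :=
    fun k hk ω => if_neg (Finset.ne_of_mem_erase hk)
  have e1 : ∀ ω, ∏ k : Fin D.m, Complex.exp ((g k ω : ℝ) * Complex.I) =
      Complex.exp ((inner ℝ u (r • S.dev M D i ω
        - s • ∑ k ∈ (Finset.range D.m).erase i, S.b k ω) : ℝ) * Complex.I) := fun ω => by
    rw [← Complex.exp_sum, ← Finset.sum_mul, ← Complex.ofReal_sum,
      ← Finset.sum_range fun k => g k ω, ← Finset.add_sum_erase _ _ (Finset.mem_range.2 hi), hgi,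
      Finset.sum_congr rfl fun k hk => hgk k hk ω, inner_sub_right, inner_smul_right,
      inner_smul_right, ← sum_inner, inner_neg_right, inner_smul_right, real_inner_comm u]
    rfl
  have e2 : ∀ k ∈ (Finset.range D.m).erase i,
      ∫ ω, Complex.exp ((g k ω : ℝ) * Complex.I) ∂P =
        Real.exp (-(s ^ 2 * matForm M.G u u / 2)) := fun k hk => by
    simp_rw [hgk k hk]
    have hk' := Finset.mem_range.1 (Finset.mem_of_mem_erase hk)
    have h1 := charFun_apply (μ := P.map (S.b k)) (-(s • u))
    rw [integral_map (h.measurable_b k).aemeasurable (by fun_prop), h.map_b hM hc hk',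
      charFun_multivariateGaussian hM.posSemidef_G] at h1
    rw [← h1, Complex.ofReal_exp]
    congr 1
    simp only [inner_zero_right, Complex.ofReal_zero, zero_mul, zero_sub, matForm_apply,
      WithLp.ofLp_neg, WithLp.ofLp_smul, Matrix.mulVec_neg, Matrix.mulVec_smul, neg_dotProduct,
      dotProduct_neg, smul_dotProduct, dotProduct_smul, smul_eq_mul]
    push_cast
    ring
  simp_rw [e1, hgi] at hprod
  rw [hprod, Finset.prod_congr rfl e2, Finset.prod_const, Finset.card_erase_of_mem
    (Finset.mem_range.2 hi), Finset.card_range, ← Complex.ofReal_pow, ← Real.exp_nat_mul,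
    Nat.cast_sub (by omega), Nat.cast_one]
  congr 3
  ring

end IsGLMM

end PQL
end

noncomputable section
namespace PQL

variable {p : ℕ}

/-! ### Measurability and characteristic functions of Gaussian mixtures. -/

section GaussianMixture

lemma isClosed_setOf_posSemidef :
    IsClosed {A : Fin p → Fin p → ℝ | (Matrix.of A).PosSemidef} := by
  have h : {A : Fin p → Fin p → ℝ | (Matrix.of A).PosSemidef} =
      {A | ∀ k l, A k l = A l k} ∩ {A | ∀ v : Vec p, 0 ≤ matForm (Matrix.of A) v v} := by
    ext A
    constructor
    · intro hA
      refine ⟨fun k l => ?_, matForm_nonneg hA⟩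
      have := hA.isHermitian.apply l k
      simpa using this
    · rintro ⟨h1, h2⟩
      refine Matrix.PosSemidef.of_dotProduct_mulVec_nonneg ?_ fun v => ?_
      · ext k l
        simpa using h1 l k
      · simpa [matForm_apply] using h2 (WithLp.toLp 2 v)
  rw [h]
  refine IsClosed.inter ?_ ?_
  · simp only [Set.ofPred_forall]
    exact isClosed_iInter fun k => isClosed_iInter fun l =>
      isClosed_eq (by fun_prop) (by fun_prop)
  · simp only [Set.ofPred_forall, matForm_eq_sum, Matrix.of_apply]
    exact isClosed_iInter fun v => isClosed_le (by fun_prop) (by fun_prop)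

lemma charFun_gaussian_zero {A : Matrix (Fin p) (Fin p) ℝ} (hA : A.PosSemidef) (u : Vec p) :
    charFun (multivariateGaussian 0 A) u = Real.exp (-matForm A u u / 2) := by
  rw [charFun_multivariateGaussian hA, Complex.ofReal_exp, matForm_apply]
  congr 1
  simp only [inner_zero_right, Complex.ofReal_zero, zero_mul, zero_sub]
  push_cast
  ring

/-- On the closed set of positive semidefinite matrices, convergence of characteristic functions
makes the Gaussian law weakly continuous. The mass of an open set is then lower semicontinuous, and
open sets form a generating π-system. Off this set the law is by convention the Dirac mass at 0. -/
lemma measurable_multivariateGaussian :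
    Measurable fun A : Fin p → Fin p → ℝ => multivariateGaussian (0 : Vec p) (Matrix.of A) := by
  refine measurable_of_restrict_of_restrict_compl isClosed_setOf_posSemidef.measurableSet ?_ ?_
  · have : ∀ A, IsProbabilityMeasure ({A : Fin p → Fin p → ℝ | (Matrix.of A).PosSemidef}.domRestrict
        (fun A => multivariateGaussian (0 : Vec p) (Matrix.of A)) A) := fun A =>
      inferInstanceAs (IsProbabilityMeasure (multivariateGaussian (0 : Vec p) (Matrix.of A.1)))
    refine Measurable.measure_of_isPiSystem_of_isProbabilityMeasure
      (BorelSpace.measurable_eq (α := Vec p)) isPiSystem_isOpen fun s hs => ?_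
    refine LowerSemicontinuous.measurable ?_
    let g : {A : Fin p → Fin p → ℝ | (Matrix.of A).PosSemidef} → ProbabilityMeasure (Vec p) :=
      fun A => ⟨multivariateGaussian 0 (Matrix.of A.1), inferInstance⟩
    have hg : Continuous g := by
      refine continuous_iff_seqContinuous.2 fun A A₀ hA => ?_
      refine ProbabilityMeasure.tendsto_of_tendsto_charFun fun u => ?_
      change Tendsto (fun t => charFun (multivariateGaussian 0 (Matrix.of (A t).1)) u) atTop
        (𝓝 (charFun (multivariateGaussian 0 (Matrix.of A₀.1)) u))
      rw [charFun_gaussian_zero A₀.2]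
      simp_rw [fun t => charFun_gaussian_zero (A t).2]
      have hc : Continuous fun A : Fin p → Fin p → ℝ =>
          ((Real.exp (-matForm (Matrix.of A) u u / 2) : ℝ) : ℂ) := by
        simp only [matForm_eq_sum, Matrix.of_apply]
        fun_prop
      exact (hc.tendsto A₀.1).comp ((continuous_subtype_val.tendsto A₀).comp hA)
    refine lowerSemicontinuous_iff_le_liminf.2 fun A => ?_
    exact ProbabilityMeasure.le_liminf_measure_open_of_tendsto (hg.tendsto A) hs
  · have : ({A : Fin p → Fin p → ℝ | (Matrix.of A).PosSemidef}ᶜ).domRestrict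
        (fun A : Fin p → Fin p → ℝ => multivariateGaussian (0 : Vec p) (Matrix.of A)) =
        fun _ => Measure.dirac 0 := by
      ext1 A
      exact multivariateGaussian_of_not_posSemidef 0 A.2
    rw [this]
    exact measurable_const

lemma aemeasurable_gaussian_comp {N : Measure (Vec p)} {K : Vec p → Matrix (Fin p) (Fin p) ℝ}
    (hK : ∀ k l, AEMeasurable (fun b => K b k l) N) :
    AEMeasurable (fun b => multivariateGaussian (0 : Vec p) (K b)) N := by
  have h : AEMeasurable (fun b k l => K b k l) N :=
    aemeasurable_pi_lambda _ fun k => aemeasurable_pi_lambda _ fun l => hK k l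
  exact measurable_multivariateGaussian.comp_aemeasurable h

lemma isProbabilityMeasure_mixN {N : Measure (Vec p)} [IsProbabilityMeasure N]
    {K : Vec p → Matrix (Fin p) (Fin p) ℝ}
    (hK : ∀ k l, AEMeasurable (fun b => K b k l) N) :
    IsProbabilityMeasure (mixN (fun _ => 0) K N) :=
  ⟨by rw [mixN, Measure.bind_apply MeasurableSet.univ (aemeasurable_gaussian_comp hK)]; simp⟩

lemma charFun_mixN {N : Measure (Vec p)} [IsProbabilityMeasure N]
    {K : Vec p → Matrix (Fin p) (Fin p) ℝ}
    (hK : ∀ k l, AEMeasurable (fun b => K b k l) N) (hps : ∀ᵐ b ∂N, (K b).PosSemidef)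
    (u : Vec p) :
    charFun (mixN (fun _ => 0) K N) u = ∫ b, (Real.exp (-matForm (K b) u u / 2) : ℂ) ∂N := by
  have hae : AEMeasurable (fun b k l => K b k l) N :=
    aemeasurable_pi_lambda _ fun k => aemeasurable_pi_lambda _ fun l => hK k l
  -- As a limit of measurable functions holding only almost everywhere, `K` is merely a.e.
  -- measurable; the kernel is built from a measurable version.
  let κ : Kernel (Vec p) (Vec p) :=
    ⟨fun b => multivariateGaussian 0 (Matrix.of (hae.mk _ b)),
      measurable_multivariateGaussian.comp hae.measurable_mk⟩
  have hmk : IsMarkovKernel κ :=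
    ⟨fun b => inferInstanceAs (IsProbabilityMeasure (multivariateGaussian 0 _))⟩
  have hκ : ∀ᵐ b ∂N, multivariateGaussian 0 (K b) = κ b := by
    filter_upwards [hae.ae_eq_mk] with b hb
    change _ = multivariateGaussian 0 (Matrix.of (hae.mk _ b))
    rw [← hb]
    rfl
  have e1 : mixN (fun _ => 0) K N = (N ⊗ₘ κ).snd := by
    rw [Measure.snd_compProd]
    exact Measure.bind_congr_right hκ
  have hm : Measurable fun x : Vec p => Complex.exp ((inner ℝ x u : ℝ) * Complex.I) := by fun_prop
  rw [e1, charFun_apply, Measure.snd, integral_map measurable_snd.aemeasurable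
    hm.aestronglyMeasurable, Measure.integral_compProd]
  · refine integral_congr_ae ?_
    filter_upwards [hκ, hps] with b hb hb'
    rw [← hb, ← charFun_apply, charFun_gaussian_zero hb']
  · refine Integrable.of_bound (C := 1) (by fun_prop) (ae_of_all _ fun x => ?_)
    rw [Complex.norm_exp_ofReal_mul_I]

end GaussianMixture

/-! ### Calculus of stochastic boundedness. -/

section StochasticOrder

variable {Ω : ℕ → Type*} [∀ t, MeasurableSpace (Ω t)] {P : ∀ t, Measure (Ω t)}

lemma StochBounded.mono {Y Z : ∀ t, Ω t → ℝ} (hZ : StochBounded P Z)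
    (h : ∀ᶠ t in atTop, ∀ ω, |Y t ω| ≤ |Z t ω|) : StochBounded P Y := fun ε hε => by
  obtain ⟨B, hB⟩ := hZ ε hε
  refine ⟨B, ?_⟩
  filter_upwards [hB, h] with t h1 h2
  exact (measure_mono fun ω (hω : B < _) => hω.trans_le (h2 ω)).trans h1

lemma StochBounded.add {Y Z : ∀ t, Ω t → ℝ} (hY : StochBounded P Y) (hZ : StochBounded P Z) :
    StochBounded P fun t ω => |Y t ω| + |Z t ω| := fun ε hε => by
  obtain ⟨B, hB⟩ := hY (ε / 2) (ENNReal.half_pos hε.ne')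
  obtain ⟨C, hC⟩ := hZ (ε / 2) (ENNReal.half_pos hε.ne')
  refine ⟨B + C, ?_⟩
  filter_upwards [hB, hC] with t h1 h2
  calc P t {ω | B + C < |(|Y t ω| + |Z t ω|)|}
      ≤ P t ({ω | B < |Y t ω|} ∪ {ω | C < |Z t ω|}) := measure_mono fun ω hω => by
        simp only [Set.mem_ofPred_eq, Set.mem_union] at hω ⊢
        rw [abs_of_nonneg (by positivity)] at hω
        by_contra! hcon
        linarith
    _ ≤ ε / 2 + ε / 2 := (measure_union_le _ _).trans (add_le_add h1 h2)
    _ = ε := ENNReal.add_halves ε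

lemma StochBounded.mul {Y Z : ∀ t, Ω t → ℝ} (hY : StochBounded P Y) (hZ : StochBounded P Z) :
    StochBounded P fun t ω => Y t ω * Z t ω := fun ε hε => by
  obtain ⟨B, hB⟩ := hY.add hZ ε hε
  refine ⟨B ^ 2, ?_⟩
  filter_upwards [hB] with t h1
  refine (measure_mono fun ω hω => ?_).trans h1
  simp only [Set.mem_ofPred_eq] at hω ⊢
  rw [abs_mul] at hω
  rw [abs_of_nonneg (by positivity)]
  refine lt_of_pow_lt_pow_left₀ 2 (by positivity) (hω.trans_le ?_)
  nlinarith [abs_nonneg (Y t ω), abs_nonneg (Z t ω),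
    mul_nonneg (abs_nonneg (Y t ω)) (abs_nonneg (Z t ω))]

lemma StochBounded.zero : StochBounded P fun _ _ => (0 : ℝ) := fun ε _ => ⟨0, by simp⟩

lemma StochBounded.sum {ι : Type*} (s : Finset ι) {Z : ι → ∀ t, Ω t → ℝ}
    (hZ : ∀ k, StochBounded P (Z k)) : StochBounded P fun t ω => ∑ k ∈ s, |Z k t ω| := by
  classical
  induction s using Finset.induction_on with
  | empty => simpa using StochBounded.zero
  | insert k s hk ih =>
    refine ((hZ k).add ih).mono (Eventually.of_forall fun t ω => ?_)
    rw [Finset.sum_insert hk, abs_of_nonneg (a := ∑ k ∈ s, _)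
      (Finset.sum_nonneg fun _ _ => abs_nonneg _)]

lemma stochBounded_of_lintegral_le {Z : ∀ t, Ω t → ℝ} {C : ENNReal} (hC : C ≠ ⊤)
    (hm : ∀ t, Measurable (Z t))
    (h : ∀ᶠ t in atTop, ∫⁻ ω, ENNReal.ofReal |Z t ω| ∂(P t) ≤ C) : StochBounded P Z := by
  intro ε hε
  by_cases hε' : ε = ⊤
  · exact ⟨0, by simp [hε']⟩
  have hdiv : C / ε ≠ ⊤ := ENNReal.div_ne_top hC hε.ne'
  -- Markov's inequality at a threshold above `C / ε`; the added 1 keeps the threshold positive when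
  -- `C = 0`.
  refine ⟨(C / ε).toReal + 1, ?_⟩
  filter_upwards [h] with t ht
  have hpos : ENNReal.ofReal ((C / ε).toReal + 1) ≠ 0 := by
    simp only [ne_eq, ENNReal.ofReal_eq_zero, not_le]; positivity
  have h1 := mul_meas_ge_le_lintegral₀ (μ := P t)
    ((hm t).abs.ennreal_ofReal.aemeasurable) (ENNReal.ofReal ((C / ε).toReal + 1))
  have h2 : P t {ω | (C / ε).toReal + 1 < |Z t ω|} ≤
      P t {ω | ENNReal.ofReal ((C / ε).toReal + 1) ≤ ENNReal.ofReal |Z t ω|} :=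
    measure_mono fun ω (hω : _ < _) => ENNReal.ofReal_le_ofReal hω.le
  refine h2.trans ?_
  have h3 := h1.trans ht
  rw [mul_comm, ← ENNReal.le_div_iff_mul_le (Or.inl hpos) (Or.inl ENNReal.ofReal_ne_top)] at h3
  refine h3.trans (ENNReal.div_le_of_le_mul ?_)
  have h4 : C / ε ≤ ENNReal.ofReal ((C / ε).toReal + 1) := by
    rw [← ENNReal.ofReal_toReal hdiv]
    refine ENNReal.ofReal_le_ofReal ?_
    rw [ENNReal.ofReal_toReal hdiv]; linarith
  rw [mul_comm]
  exact (ENNReal.div_le_iff hε.ne' hε').1 h4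

/-- If a random sequence is small whenever finitely many stochastically bounded ones are bounded,
then it tends to zero in probability. -/
lemma tendstoInProb_zero_of_stochBounded {ι : Type*} [Fintype ι] {U : ι → ∀ t, Ω t → ℝ}
    {Z : ∀ t, Ω t → ℝ} (hU : ∀ k, StochBounded P (U k))
    (h : ∀ L ε : ℝ, 0 < ε → ∀ᶠ t in atTop, ∀ᵐ ω ∂(P t), (∀ k, |U k t ω| ≤ L) → |Z t ω| < ε) :
    TendstoInProb P Z 0 := by
  intro ε hε
  rw [ENNReal.tendsto_nhds_zero]
  intro η hη
  obtain ⟨L, hL⟩ := StochBounded.sum Finset.univ hU η hη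
  filter_upwards [hL, h L ε hε] with t h1 h2
  refine (measure_mono_ae ?_).trans h1
  filter_upwards [h2] with ω hω hω'
  change ε ≤ |Z t ω - 0| at hω'
  change L < abs (∑ k, |U k t ω|)
  rw [sub_zero] at hω'
  by_contra! hcon
  have hk : ∀ k, |U k t ω| ≤ L := fun k =>
    ((Finset.single_le_sum (f := fun k => |U k t ω|) (fun _ _ => abs_nonneg _)
      (Finset.mem_univ k)).trans (le_abs_self _)).trans hcon
  linarith [hω hk]

end StochasticOrder

/-! ### Convergence in law from approximating sequences. -/

section Slutsky

variable {Ω : ℕ → Type*} [∀ t, MeasurableSpace (Ω t)] {P : ∀ t, Measure (Ω t)}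
  [∀ t, IsProbabilityMeasure (P t)]

lemma norm_exp_sub_exp_le (x y : ℝ) :
    ‖Complex.exp (x * Complex.I) - Complex.exp (y * Complex.I)‖ ≤ |x - y| := by
  have : Complex.exp (x * Complex.I) - Complex.exp (y * Complex.I) =
      Complex.exp (y * Complex.I) * (Complex.exp (Complex.I * ((x - y : ℝ) : ℂ)) - 1) := by
    rw [mul_sub, ← Complex.exp_add, mul_one]
    congr 2
    push_cast
    ring
  rw [this, norm_mul, Complex.norm_exp_ofReal_mul_I, one_mul]
  exact Real.norm_exp_I_mul_ofReal_sub_one_le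

/-- Where the vectors are within `ε`, use that `exp (i x)` is 1-Lipschitz; elsewhere, use the
trivial bound 2. -/
lemma norm_integral_exp_sub_le {Ω : Type*} [MeasurableSpace Ω] {P : Measure Ω}
    [IsProbabilityMeasure P] {Z V : Ω → Vec p} (hZ : Measurable Z) (hV : Measurable V)
    (u : Vec p) {ε : ℝ} (hε : 0 ≤ ε) :
    ‖∫ ω, Complex.exp ((inner ℝ u (Z ω) : ℝ) * Complex.I) ∂P
        - ∫ ω, Complex.exp ((inner ℝ u (V ω) : ℝ) * Complex.I) ∂P‖ ≤
      ‖u‖ * ε + 2 * P.real {ω | ε ≤ ‖Z ω - V ω‖} := by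
  have hint : ∀ {X : Ω → Vec p}, Measurable X →
      Integrable (fun ω => Complex.exp ((inner ℝ u (X ω) : ℝ) * Complex.I)) P := fun hX =>
    Integrable.of_bound (C := 1) (by fun_prop) (ae_of_all _ fun x => by
      rw [Complex.norm_exp_ofReal_mul_I])
  have hs : MeasurableSet {ω | ε ≤ ‖Z ω - V ω‖} :=
    measurableSet_le measurable_const (hZ.sub hV).norm
  rw [← integral_sub (hint hZ) (hint hV)]
  refine (norm_integral_le_integral_norm _).trans ?_
  have hint2 : Integrable (fun ω => ‖u‖ * ε +
      {ω | ε ≤ ‖Z ω - V ω‖}.indicator (fun _ => (2 : ℝ)) ω) P :=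
    (integrable_const _).add ((integrable_const _).indicator hs)
  calc ∫ ω, ‖Complex.exp ((inner ℝ u (Z ω) : ℝ) * Complex.I)
        - Complex.exp ((inner ℝ u (V ω) : ℝ) * Complex.I)‖ ∂P
      ≤ ∫ ω, (‖u‖ * ε + {ω | ε ≤ ‖Z ω - V ω‖}.indicator (fun _ => (2 : ℝ)) ω) ∂P := by
        refine integral_mono ((hint hZ).sub (hint hV)).norm hint2 fun ω => ?_
        by_cases hω : ε ≤ ‖Z ω - V ω‖
        · rw [Set.indicator_of_mem (by exact hω)]
          refine (norm_sub_le _ _).trans ?_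
          rw [Complex.norm_exp_ofReal_mul_I, Complex.norm_exp_ofReal_mul_I]
          have : 0 ≤ ‖u‖ * ε := by positivity
          linarith
        · rw [Set.indicator_of_notMem (by exact hω), add_zero]
          refine (norm_exp_sub_exp_le _ _).trans ?_
          rw [← inner_sub_right]
          refine (abs_real_inner_le_norm _ _).trans ?_
          gcongr
          exact (not_le.1 hω).le
    _ = _ := by
        rw [integral_add (integrable_const _) ((integrable_const _).indicator hs),
          integral_indicator hs]
        simp [mul_comm]

/-- Convergence in law, from the convergence of the characteristic functions of an approximating
sequence. -/
lemma tendstoInLaw_of_tendsto_charFun {Z V : ∀ t, Ω t → Vec p} {μ : Measure (Vec p)}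
    (hμ : IsProbabilityMeasure μ) (hZ : ∀ t, Measurable (Z t)) (hV : ∀ t, Measurable (V t))
    (hZV : TendstoInProb P (fun t ω => ‖Z t ω - V t ω‖) 0)
    (h : ∀ u, Tendsto (fun t => ∫ ω, Complex.exp ((inner ℝ u (V t ω) : ℝ) * Complex.I) ∂(P t))
      atTop (𝓝 (charFun μ u))) :
    TendstoInLaw P Z μ := by
  refine ⟨hμ, fun t => (hZ t).aemeasurable, aemeasurable_id, ?_⟩
  refine ProbabilityMeasure.tendsto_of_tendsto_charFun fun u => ?_
  simp only [ProbabilityMeasure.coe_mk, Measure.map_id]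
  have e : ∀ t, charFun ((P t).map (Z t)) u =
      ∫ ω, Complex.exp ((inner ℝ u (Z t ω) : ℝ) * Complex.I) ∂(P t) := fun t => by
    rw [charFun_apply, integral_map (hZ t).aemeasurable (by fun_prop)]
    simp_rw [real_inner_comm]
  simp_rw [e]
  have hd : Tendsto (fun t => ∫ ω, Complex.exp ((inner ℝ u (Z t ω) : ℝ) * Complex.I) ∂(P t)
      - ∫ ω, Complex.exp ((inner ℝ u (V t ω) : ℝ) * Complex.I) ∂(P t)) atTop (𝓝 0) := by
    rw [tendsto_zero_iff_norm_tendsto_zero, Metric.tendsto_atTop']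
    intro η hη
    -- The Lipschitz part is then at most `η / 4` and the exceptional part below `2 * (η / 4)`;
    -- adding 1 covers `u = 0`.
    set ε := η / (4 * (‖u‖ + 1)) with hε
    have hε0 : 0 < ε := by positivity
    have h1 := hZV ε hε0
    have h2 := (ENNReal.tendsto_toReal ENNReal.zero_ne_top).comp h1
    have h3 := h2.eventually
      (gt_mem_nhds (show (0 : ENNReal).toReal < η / 4 by simpa using by positivity))
    obtain ⟨T, hT⟩ := eventually_atTop.1 h3
    refine ⟨T, fun t ht => ?_⟩
    have h4 := hT t ht.le
    simp only [Function.comp_apply, sub_zero, abs_norm] at h4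
    rw [Real.dist_0_eq_abs, abs_norm]
    refine (norm_integral_exp_sub_le (hZ t) (hV t) u hε0.le).trans_lt ?_
    rw [measureReal_def]
    have h5 : ‖u‖ * ε ≤ η / 4 := by
      rw [hε, ← mul_div_assoc, div_le_div_iff₀ (by positivity) (by norm_num)]
      nlinarith [norm_nonneg u]
    linarith
  simpa using hd.add (h u)

end Slutsky

end PQL
end

/-! ### First-order conditions and the error decomposition at a maximiser. -/

noncomputable section
namespace PQL

variable {p : ℕ} {M : Model p} {D : Design p} {c : ℝ}

namespace Model

/-- The contribution of cluster `i` to the objective function. -/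
def clusterObjective (M : Model p) (D : Design p) (y : ℕ → ℕ → ℝ) (G : Matrix (Fin p) (Fin p) ℝ)
    (φ : ℝ) (β : Vec p) (i : ℕ) (w : Vec p) : ℝ :=
  ∑ j ∈ Finset.range (D.n i), Real.log (M.density φ (linPred (D.x i j) β w) (y i j))
    - 1 / 2 * matForm G⁻¹ w w

lemma objective_eq_sum (y : ℕ → ℕ → ℝ) (G : Matrix (Fin p) (Fin p) ℝ) (φ : ℝ) (β : Vec p)
    (b : ℕ → Vec p) : M.objective D y G φ β b =
      ∑ i ∈ Finset.range D.m, M.clusterObjective D y G φ β i (b i) := by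
  simp only [objective, clusterObjective, Finset.sum_sub_distrib, Finset.mul_sum, matForm_apply]

variable {y : ℕ → ℕ → ℝ} {G : Matrix (Fin p) (Fin p) ℝ} {φ : ℝ} {β : Vec p} {b : ℕ → Vec p}

lemma clusterObjective_le {i : ℕ} (hi : i < D.m)
    (hmax : ∀ b', M.objective D y G φ β b' ≤ M.objective D y G φ β b) (w : Vec p) :
    M.clusterObjective D y G φ β i w ≤ M.clusterObjective D y G φ β i (b i) := by
  have h := hmax (Function.update b i w)
  rw [objective_eq_sum, objective_eq_sum, ← Finset.add_sum_erase _ _ (Finset.mem_range.2 hi),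
    ← Finset.add_sum_erase (Finset.range D.m) (fun k => M.clusterObjective D y G φ β k (b k))
      (Finset.mem_range.2 hi), Function.update_self] at h
  have e : ∑ k ∈ (Finset.range D.m).erase i,
      M.clusterObjective D y G φ β k (Function.update b i w k) =
      ∑ k ∈ (Finset.range D.m).erase i, M.clusterObjective D y G φ β k (b k) :=
    Finset.sum_congr rfl fun k hk => by
      rw [Function.update_of_ne (Finset.ne_of_mem_erase hk)]
  rw [e] at h
  linarith

/-- With `β` and the other clusters fixed, the objective along the line `b i + s • v` has a maximum
at `s = 0`. Multiplying the vanishing derivative by `φ` moves the dispersion into the penalty. -/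
lemma score_eq (hc : CumulantBounds M c) (hG : G.PosDef) (hφ : 0 < φ) {i : ℕ} (hi : i < D.m)
    (hmax : ∀ b', M.objective D y G φ β b' ≤ M.objective D y G φ β b) (v : Vec p) :
    ∑ j : Fin (D.n i), (y i j - deriv M.a (linPred (D.x i j) β (b i))) * inner ℝ (D.x i j) v =
      matForm (φ • G⁻¹) (b i) v := by
  have hG' := hG.inv
  set f : ℝ → ℝ := fun s => M.clusterObjective D y G φ β i (b i + s • v) with hf
  have hlog : ∀ η y : ℝ, Real.log (M.density φ η y) = φ⁻¹ * (y * η - M.a η) + M.c y φ :=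
    fun η y => by rw [density, Real.log_exp]
  have hlin : ∀ x : Vec p, ∀ s : ℝ, linPred x β (b i + s • v) =
      linPred x β (b i) + s * inner ℝ x v := fun x s => by
    rw [linPred, linPred, inner_add_right, inner_smul_right]; ring
  have hquad : ∀ s : ℝ, matForm G⁻¹ (b i + s • v) (b i + s • v) =
      matForm G⁻¹ (b i) (b i) + 2 * s * matForm G⁻¹ (b i) v + s ^ 2 * matForm G⁻¹ v v :=
    fun s => by
      have := matForm_comm hG'.isHermitian (b i) v
      simp only [map_add, map_smul, LinearMap.add_apply, LinearMap.smul_apply, smul_eq_mul]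
      rw [← this]; ring
  have hd : HasDerivAt f (∑ j ∈ Finset.range (D.n i), φ⁻¹ *
      ((y i j - deriv M.a (linPred (D.x i j) β (b i))) * inner ℝ (D.x i j) v)
        - matForm G⁻¹ (b i) v) 0 := by
    have h1 : ∀ j ∈ Finset.range (D.n i), HasDerivAt (fun s : ℝ =>
        Real.log (M.density φ (linPred (D.x i j) β (b i + s • v)) (y i j)))
        (φ⁻¹ * ((y i j - deriv M.a (linPred (D.x i j) β (b i))) * inner ℝ (D.x i j) v)) 0 := by
      intro j _
      simp_rw [hlog, hlin]
      have hη : HasDerivAt (fun s : ℝ => linPred (D.x i j) β (b i) + s * inner ℝ (D.x i j) v)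
          (inner ℝ (D.x i j) v) 0 := by
        simpa using ((hasDerivAt_id (0 : ℝ)).mul_const (inner ℝ (D.x i j) v)).const_add
          (linPred (D.x i j) β (b i))
      have ha := (hc.hasDerivAt (linPred (D.x i j) β (b i) + 0 * inner ℝ (D.x i j) v)).comp 0 hη
      have h2 := (((hη.const_mul (y i j)).sub ha).const_mul φ⁻¹).add_const (M.c (y i j) φ)
      refine h2.congr_deriv ?_
      rw [zero_mul, add_zero]
      ring
    have h3 : HasDerivAt (fun s : ℝ => 1 / 2 * matForm G⁻¹ (b i + s • v) (b i + s • v))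
        (matForm G⁻¹ (b i) v) 0 := by
      simp_rw [hquad]
      have e1 : HasDerivAt (fun s : ℝ => 2 * s * matForm G⁻¹ (b i) v)
          (2 * matForm G⁻¹ (b i) v) 0 := by
        simpa using ((hasDerivAt_id (0 : ℝ)).const_mul 2).mul_const (matForm G⁻¹ (b i) v)
      have e2 : HasDerivAt (fun s : ℝ => s ^ 2 * matForm G⁻¹ v v) 0 0 := by
        simpa using (hasDerivAt_pow 2 (0 : ℝ)).mul_const (matForm G⁻¹ v v)
      refine (((e1.const_add (matForm G⁻¹ (b i) (b i))).add e2).const_mul (1 / 2)).congr_deriv ?_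
      ring
    exact (HasDerivAt.fun_sum h1).sub h3
  have hmax' : IsLocalMax f 0 := Eventually.of_forall fun s => by
    simp only [hf, zero_smul, add_zero]
    exact clusterObjective_le hi hmax _
  have h0 := hmax'.hasDerivAt_eq_zero hd
  rw [← Finset.mul_sum, sub_eq_zero] at h0
  rw [← Finset.sum_range fun j =>
    (y i j - deriv M.a (linPred (D.x i j) β (b i))) * inner ℝ (D.x i j) v]
  have e : matForm (φ • G⁻¹) (b i) v = φ * matForm G⁻¹ (b i) v := by
    simp [matForm_apply, Matrix.smul_mulVec]
  rw [e, ← h0, ← mul_assoc, mul_inv_cancel₀ hφ.ne', one_mul]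

/-- Moving the average `w` of the `b i` into `β` leaves every linear predictor unchanged and lowers
the sum of the penalty forms by `D.m` times the form at `w`. At a maximiser this gain is not
positive, so positive definiteness forces `w = 0`. -/
lemma sum_eq_zero_of_isMax (hG : G.PosDef)
    (hmax : ∀ β' b', M.objective D y G φ β' b' ≤ M.objective D y G φ β b) :
    ∑ i ∈ Finset.range D.m, b i = 0 := by
  have hG' := hG.inv
  rcases Nat.eq_zero_or_pos D.m with hm | hm
  · simp [hm]
  have hm' : (0 : ℝ) < D.m := by exact_mod_cast hm
  set s := ∑ i ∈ Finset.range D.m, b i with hs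
  set w : Vec p := (D.m : ℝ)⁻¹ • s with hw
  have h := hmax (β + w) fun i => b i - w
  have hlin : ∀ x b : Vec p, linPred x (β + w) (b - w) = linPred x β b := fun x b => by
    rw [linPred, linPred, inner_add_right, inner_sub_right]; ring
  simp only [objective, hlin, sub_le_sub_iff_left, ← matForm_apply] at h
  have e : ∑ i ∈ Finset.range D.m, matForm G⁻¹ (b i - w) (b i - w) =
      ∑ i ∈ Finset.range D.m, matForm G⁻¹ (b i) (b i) - D.m * matForm G⁻¹ w w := by
    have h1 : ∀ i, matForm G⁻¹ (b i - w) (b i - w) =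
        matForm G⁻¹ (b i) (b i) - 2 * matForm G⁻¹ (b i) w + matForm G⁻¹ w w := fun i => by
      have := matForm_comm hG'.isHermitian (b i) w
      simp only [map_sub, LinearMap.sub_apply]
      rw [← this]; ring
    simp only [h1, Finset.sum_add_distrib, Finset.sum_sub_distrib, ← Finset.mul_sum,
      Finset.sum_const, Finset.card_range, nsmul_eq_mul]
    have h2 : ∑ i ∈ Finset.range D.m, matForm G⁻¹ (b i) w = D.m * matForm G⁻¹ w w := by
      rw [← LinearMap.sum_apply, ← map_sum, ← hs]
      have : s = (D.m : ℝ) • w := by rw [hw, smul_smul, mul_inv_cancel₀ hm'.ne', one_smul]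
      conv_lhs => rw [this]
      simp
    rw [h2]; ring
  rw [e] at h
  have h3 : matForm G⁻¹ w w ≤ 0 := by nlinarith
  have hw0 : w = 0 := by
    by_contra hne
    have hne' : WithLp.ofLp w ≠ 0 := fun h0 => hne (by ext k; simpa using congrFun h0 k)
    have := hG'.dotProduct_mulVec_pos hne'
    simp only [star_trivial] at this
    rw [matForm_apply] at h3
    linarith
  rw [hw, smul_eq_zero] at hw0
  exact hw0.resolve_left (inv_ne_zero hm'.ne')

end Model

lemma Design.nL_le (D : Design p) {i : ℕ} (hi : i < D.m) : D.nL ≤ D.n i :=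
  ciInf_le (f := fun i : Fin D.m => D.n i) (OrderBot.bddBelow _) ⟨i, hi⟩

section Stage

variable {Ω : Type*} {S : Sample p Ω} {F : Fit p Ω} {ω : Ω}

/-- The deviation of the estimated coefficient of cluster `i` from the true one. -/
def coefDev (M : Model p) (S : Sample p Ω) (F : Fit p Ω) (i : ℕ) (ω : Ω) : Vec p :=
  F.βhat ω + F.bhat i ω - (M.β + S.b i ω)

/-- A realisation at which the fit is a maximiser of an objective function with a proper penalty. -/
structure IsMaxAt (M : Model p) (D : Design p) (S : Sample p Ω) (F : Fit p Ω) (ω : Ω) : Prop where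
  posDef_Ghat : (F.Ghat ω).PosDef
  φhat_pos : 0 < F.φhat ω
  isMax : ∀ (β : Vec p) (b : ℕ → Vec p),
    M.objective D (fun i j => S.y i j ω) (F.Ghat ω) (F.φhat ω) β b ≤
      M.objective D (fun i j => S.y i j ω) (F.Ghat ω) (F.φhat ω) (F.βhat ω)
        (fun i => F.bhat i ω)

/-- The matrix of the penalty, relative to the log-likelihood at unit dispersion. -/
def penalty (F : Fit p Ω) (ω : Ω) : Matrix (Fin p) (Fin p) ℝ := F.φhat ω • (F.Ghat ω)⁻¹

/-- A bound on the size of the penalty. -/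
def penaltySize (F : Fit p Ω) (ω : Ω) : ℝ := ∑ k, ∑ l, |penalty F ω k l|

lemma IsMaxAt.posDef_penalty (h : IsMaxAt M D S F ω) : (penalty F ω).PosDef :=
  h.posDef_Ghat.inv.smul h.φhat_pos

/-- With shared covariates, the fitted predictor differs from the true one by the inner product with
`coefDev`, and the prediction entering the penalty is `b + δ - ε`. -/
lemma IsMaxAt.clusterScore (h : IsMaxAt M D S F ω) (hM : M.IsValid) (hc : CumulantBounds M c)
    {i : ℕ} (hi : i < D.m) (hn : 0 < D.n i) (hu : IsUnit (M.info D i (S.b i ω))) :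
    ClusterScore (fun j : Fin (D.n i) => D.x i j) (deriv M.a)
      (fun j => linPred (D.x i j) M.β (S.b i ω)) (M.weight D i (S.b i ω))
      (fun j => S.y i j ω - M.mean D i (S.b i ω) j) (matForm (penalty F ω)) c (S.b i ω)
      (F.βhat ω - M.β) (coefDev M S F i ω) (S.dev M D i ω) where
  score v := by
    have h1 := Model.score_eq hc h.posDef_Ghat h.φhat_pos hi (fun b' => h.isMax _ b') v
    have e1 : S.b i ω + coefDev M S F i ω - (F.βhat ω - M.β) = F.bhat i ω := by
      rw [coefDev]; abel
    have e2 : ∀ j, linPred (D.x i j) M.β (S.b i ω) + inner ℝ (D.x i j) (coefDev M S F i ω) =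
        linPred (D.x i j) (F.βhat ω) (F.bhat i ω) := fun j => by
      simp only [linPred, coefDev, inner_add_right, inner_sub_right]; ring
    rw [e1, penalty, ← h1, ← Finset.sum_sub_distrib]
    refine Finset.sum_congr rfl fun j _ => ?_
    rw [e2, Model.mean]
    ring
  linearised v := Model.sum_mul_inner_eq_linDev hM hu hn v _
  le_weight j := hc.le_two _
  weight_le j := hc.two_le _
  monotone j t := mul_sq_le_sub_mul hc.hasDerivAt_deriv hc.le_two _ t
  taylor j t := hc.taylor _ t

lemma IsMaxAt.smul_fixed (h : IsMaxAt M D S F ω) :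
    (D.m : ℝ) • (F.βhat ω - M.β) = ∑ i ∈ Finset.range D.m, coefDev M S F i ω
      + ∑ i ∈ Finset.range D.m, S.b i ω := by
  have h0 := Model.sum_eq_zero_of_isMax h.posDef_Ghat h.isMax
  simp only [coefDev, Finset.sum_sub_distrib, Finset.sum_add_distrib, h0, Finset.sum_const,
    Finset.card_range, ← Nat.cast_smul_eq_nsmul ℝ]
  module

/-- The linearisation of the predicted random effect of one cluster. -/
lemma IsMaxAt.norm_bhat_sub_le (h : IsMaxAt M D S F ω) (hM : M.IsValid)
    (hc : CumulantBounds M c) {Cx N L κi : ℝ} {κ : ℕ → ℝ} {i : ℕ} (hi : i < D.m)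
    (hx : ∀ k < D.m, ∀ j < D.n k, ‖D.x k j‖ ≤ Cx) (hCx : 0 ≤ Cx)
    (hN : ∀ k < D.m, N ≤ D.n k) (hN1 : 1 ≤ c * N) (hNL : 8 * L ^ 2 ≤ c * N)
    (hu : ∀ k < D.m, ∀ b, IsUnit (M.info D k b)) (hκ₀ : ∀ k < D.m, 0 ≤ κ k)
    (hκ : ∀ k < D.m, ∀ v, (D.n k : ℝ) * ‖v‖ ^ 2 ≤
      κ k * energy (fun j : Fin (D.n k) => D.x k j) v)
    (hκi₀ : 0 ≤ κi)
    (hκi : ∀ v, (D.n i : ℝ) * ‖v‖ ^ 2 ≤ κi * energy (fun j : Fin (D.n i) => D.x i j) v)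
    (hpen : penaltySize F ω ≤ L)
    (h1 : ∑ k ∈ Finset.range D.m, κ k ≤ L * D.m)
    (h2 : ∑ k ∈ Finset.range D.m, κ k * S.devEnergy M D k ω ≤ L * D.m)
    (h3 : ∑ k ∈ Finset.range D.m, κ k * ‖S.b k ω‖ ^ 2 ≤ L * D.m)
    (h4 : ∑ k ∈ Finset.range D.m, ‖S.b k ω‖ ^ 2 ≤ L * D.m)
    (h5 : κi ≤ L) (h6 : κi * S.devEnergy M D i ω ≤ L) (h7 : κi * ‖S.b i ω‖ ^ 2 ≤ L) :
    ‖F.bhat i ω - S.b i ω -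
        (S.dev M D i ω - (D.m : ℝ)⁻¹ • ∑ k ∈ Finset.range D.m, S.b k ω)‖ ≤
      2 * (linBound c (Cx * (c ^ 2)⁻¹ + 1) L * N⁻¹)
        + (D.m : ℝ)⁻¹ * ‖∑ k ∈ Finset.range D.m, S.dev M D k ω‖ := by
  have hc₀ := hc.pos
  have hm : 0 < D.m := Nat.zero_lt_of_lt hi
  have hm' : (0 : ℝ) < D.m := by exact_mod_cast hm
  have hN0 : 0 < N := by
    by_contra! hcon
    nlinarith
  have hn : ∀ k < D.m, 0 < D.n k := fun k hk => by
    have : (0 : ℝ) < D.n k := hN0.trans_le (hN k hk)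
    exact_mod_cast this
  have hps := h.posDef_penalty
  have hΛs := matForm_comm hps.isHermitian
  have hΛ := matForm_nonneg hps.posSemidef
  have hlam := matForm_self_le (penalty F ω)
  change ∀ v, _ ≤ penaltySize F ω * ‖v‖ ^ 2 at hlam
  have hlam₀ : 0 ≤ penaltySize F ω :=
    Finset.sum_nonneg fun _ _ => Finset.sum_nonneg fun _ _ => abs_nonneg _
  set ε := F.βhat ω - M.β with hε
  set C := Cx * (c ^ 2)⁻¹ + 1 with hC
  have hC₀ : 0 ≤ C := by positivity
  have hcs := fun k (hk : k < D.m) =>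
    h.clusterScore hM hc hk (hn k hk) (hu k hk (S.b k ω))
  have hτ : ∀ k, 0 ≤ energyBound c (penaltySize F ω) (S.devEnergy M D k ω) (S.b k ω) ε :=
    fun k => by
      have : 0 ≤ S.devEnergy M D k ω := energy_nonneg _ _
      rw [energyBound]; positivity
  have hδ : ∀ k < D.m, N * ‖coefDev M S F k ω‖ ^ 2 ≤
      κ k * (c⁻¹ * energyBound c (penaltySize F ω) (S.devEnergy M D k ω) (S.b k ω) ε) := by
    intro k hk
    have e1 := (hcs k hk).energy_le hc₀ hΛs hΛ hlam
    have e2 : energy (fun j : Fin (D.n k) => D.x k j) (coefDev M S F k ω) ≤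
        c⁻¹ * energyBound c (penaltySize F ω) (S.devEnergy M D k ω) (S.b k ω) ε := by
      rw [← div_eq_inv_mul, le_div_iff₀ hc₀]
      have := hΛ (coefDev M S F k ω)
      change _ ≤ energyBound c (penaltySize F ω) (S.devEnergy M D k ω) (S.b k ω) ε at e1
      linarith
    calc N * ‖coefDev M S F k ω‖ ^ 2 ≤ D.n k * ‖coefDev M S F k ω‖ ^ 2 := by
          gcongr; exact hN k hk
      _ ≤ _ := hκ k hk _
      _ ≤ _ := mul_le_mul_of_nonneg_left e2 (hκ₀ k hk)
  -- The constant `κ'` is left free: the sum over clusters uses `κ k`, the given cluster `i` uses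
  -- `κi`.
  have hlin : ∀ k (hk : k < D.m) (κ' : ℝ), 0 ≤ κ' → (∀ v, (D.n k : ℝ) * ‖v‖ ^ 2 ≤
      κ' * energy (fun j : Fin (D.n k) => D.x k j) v) →
      N * ‖coefDev M S F k ω - S.dev M D k ω‖ ≤ κ' * (c⁻¹ * (C *
        energyBound c (penaltySize F ω) (S.devEnergy M D k ω) (S.b k ω) ε + penaltySize F ω)) := by
    intro k hk κ' hκ'₀ hκ'
    refine le_trans ?_ ((hcs k hk).norm_sub_le hc₀ hΛs hΛ hlam hlam₀ hCx
      (fun j => hx k hk j j.2) hκ'₀ hκ')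
    gcongr
    exact hN k hk
  have hεb := norm_fixed_sq_le (δ := fun k => coefDev M S F k ω) (b := fun k => S.b k ω)
    (q := fun k => S.devEnergy M D k ω) hc₀ hm hlam₀ hpen h1 h2 h3 h4 hN1 hNL hδ h.smul_fixed
  have hsum := norm_sum_sub_le (δ := fun k => coefDev M S F k ω) (z := fun k => S.dev M D k ω)
    (b := fun k => S.b k ω) (q := fun k => S.devEnergy M D k ω) hc₀ hm hC₀ hlam₀ hpen hκ₀ h1 h2 h3
    hεb hN0.le fun k hk => hlin k hk (κ k) (hκ₀ k hk) (hκ k hk)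
  have hone := norm_sub_le_linBound (δ₀ := coefDev M S F i ω) (z₀ := S.dev M D i ω) hc₀ hC₀ hlam₀
    hpen hκi₀ h5 h6 h7 hεb (hlin i hi κi hκi₀ hκi)
  set B := linBound c C L
  -- Three errors remain: the linearisation error of cluster `i`, its average over all clusters, and
  -- the average of the linearised deviations. The first two have the same bound, hence the factor 2
  -- in the conclusion.
  have e : F.bhat i ω - S.b i ω -
      (S.dev M D i ω - (D.m : ℝ)⁻¹ • ∑ k ∈ Finset.range D.m, S.b k ω) =
      (coefDev M S F i ω - S.dev M D i ω)
      - (D.m : ℝ)⁻¹ • (∑ k ∈ Finset.range D.m, coefDev M S F k ω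
        - ∑ k ∈ Finset.range D.m, S.dev M D k ω)
      - (D.m : ℝ)⁻¹ • ∑ k ∈ Finset.range D.m, S.dev M D k ω := by
    have h8 : ε = (D.m : ℝ)⁻¹ • (∑ k ∈ Finset.range D.m, coefDev M S F k ω
        + ∑ k ∈ Finset.range D.m, S.b k ω) := by
      rw [← h.smul_fixed, smul_smul, inv_mul_cancel₀ hm'.ne', one_smul]
    have h9 : F.bhat i ω - S.b i ω = coefDev M S F i ω - ε := by
      rw [coefDev, hε]; abel
    rw [h9, h8]
    module
  rw [e]
  refine (norm_sub_le _ _).trans (add_le_add ((norm_sub_le _ _).trans ?_) ?_)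
  · have a1 : ‖coefDev M S F i ω - S.dev M D i ω‖ ≤ B * N⁻¹ := by
      rw [← div_eq_mul_inv, le_div_iff₀ hN0]; linarith
    have a2 : ‖(D.m : ℝ)⁻¹ • (∑ k ∈ Finset.range D.m, coefDev M S F k ω
        - ∑ k ∈ Finset.range D.m, S.dev M D k ω)‖ ≤ B * N⁻¹ := by
      rw [norm_smul, norm_inv, Real.norm_natCast, ← div_eq_inv_mul, div_le_iff₀ hm',
        ← div_eq_mul_inv, div_mul_eq_mul_div, le_div_iff₀ hN0]
      linarith
    linarith
  · rw [norm_smul, norm_inv, Real.norm_natCast]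

end Stage

end PQL
end

/-! ### Curvature constants and limits of characteristic functions. -/

noncomputable section
namespace PQL

variable {p : ℕ}

lemma norm_le_of_coord_le {v : Vec p} {C : ℝ} (h : ∀ k, |v k| ≤ C) : ‖v‖ ≤ √(p * C ^ 2) := by
  refine Real.le_sqrt_of_sq_le ?_
  rw [EuclideanSpace.real_norm_sq_eq]
  calc ∑ k, v k ^ 2 ≤ ∑ _k : Fin p, C ^ 2 := Finset.sum_le_sum fun k _ => by
        rw [← sq_abs]; exact pow_le_pow_left₀ (abs_nonneg _) (h k) 2
    _ = p * C ^ 2 := by simp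

lemma Model.stronglyMeasurable_integral_condLaw {M : Model p} {D : Design p} {i : ℕ} {c : ℝ}
    (hM : M.IsValid) (hc : CumulantBounds M c) {f : Vec p × (Fin (D.n i) → ℝ) → ℂ}
    (hf : Measurable f) : StronglyMeasurable fun b => ∫ y, f (b, y) ∂(M.condLaw D i b) := by
  obtain ⟨κ, _, hκ, _⟩ := Model.exists_condKernel (D := D) (i := i) hM hc
  simp_rw [← hκ]
  exact StronglyMeasurable.integral_kernel_prod_right' hf.stronglyMeasurable

variable {Ω : ℕ → Type*} [∀ t, MeasurableSpace (Ω t)] {P : ∀ t, Measure (Ω t)}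
  {M : Model p} {D : ℕ → Design p} {S : ∀ t, Sample p (Ω t)} {F : ∀ t, Fit p (Ω t)}
  {K : ℕ → Vec p → Matrix (Fin p) (Fin p) ℝ} {Kbar : Matrix (Fin p) (Fin p) ℝ} {c : ℝ} {i : ℕ}

section Growth

lemma Growth.eventually_lt_m (hD : Growth D) (i : ℕ) : ∀ᶠ t in atTop, i < (D t).m :=
  hD.m_tendsto.eventually_gt_atTop i

lemma Growth.tendsto_nL (hD : Growth D) : Tendsto (fun t => ((D t).nL : ℝ)) atTop atTop :=
  tendsto_natCast_atTop_atTop.comp hD.nL_tendsto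

lemma Growth.tendsto_m (hD : Growth D) : Tendsto (fun t => ((D t).m : ℝ)) atTop atTop :=
  tendsto_natCast_atTop_atTop.comp hD.m_tendsto

lemma Growth.tendsto_n (hD : Growth D) (i : ℕ) :
    Tendsto (fun t => ((D t).n i : ℝ)) atTop atTop := by
  refine tendsto_atTop_mono' _ ?_ hD.tendsto_nL
  filter_upwards [hD.eventually_lt_m i] with t ht
  exact_mod_cast (D t).nL_le ht

end Growth

section Curvature

/-- A quadratic bound for the design matrix of a fixed cluster, with bounded constant. -/
lemma C2.exists_curvature_single (h2 : C2 P M D S K Kbar) (hM : M.IsValid)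
    (hc : CumulantBounds M c) (hD : Growth D) (i : ℕ) : ∃ (κ : ℕ → ℝ) (C : ℝ), ∀ᶠ t in atTop,
      0 ≤ κ t ∧ κ t ≤ C ∧ ∀ v, ((D t).n i : ℝ) * ‖v‖ ^ 2 ≤
        κ t * energy (fun j : Fin ((D t).n i) => (D t).x i j) v := by
  have hφ := hM.φ_pos
  have hc₀ := hc.pos
  -- A single `b` with convergent `H` suffices, because the curvature inequality does not involve
  -- the random effect.
  obtain ⟨b, hb⟩ := (h2.tendsto_H i).exists
  have htr : Tendsto (fun t => (M.H (D t) i b).trace) atTop (𝓝 (K i b).trace) :=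
    ((continuous_id.matrix_trace).tendsto (K i b)).comp hb
  refine ⟨fun t => (M.H (D t) i b).trace * (M.φ * c)⁻¹, ((K i b).trace + 1) * (M.φ * c)⁻¹, ?_⟩
  filter_upwards [htr.eventually (gt_mem_nhds (lt_add_one _)), h2.info_invertible,
    hD.eventually_lt_m i, hD.nL_tendsto.eventually_gt_atTop 0] with t h1 hu hi hL
  have hn := hL.trans_le ((D t).nL_le hi)
  refine ⟨mul_nonneg (Model.posDef_H hM hc (hu i hi b)).posSemidef.trace_nonneg (by positivity),
    by gcongr, Model.mul_norm_sq_le_trace_H hM hc (hu i hi b) hn⟩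

variable [∀ t, IsProbabilityMeasure (P t)]

/-- Quadratic bounds for the design matrices of all clusters, with bounded average constant. -/
lemma C2.exists_curvature (h2 : C2 P M D S K Kbar) (hM : M.IsValid) (hc : CumulantBounds M c)
    (hD : Growth D) : ∃ (κ : ℕ → ℕ → ℝ) (C : ℝ), ∀ᶠ t in atTop,
      (∀ k < (D t).m, 0 ≤ κ t k ∧ ∀ v, ((D t).n k : ℝ) * ‖v‖ ^ 2 ≤
        κ t k * energy (fun j : Fin ((D t).n k) => (D t).x k j) v) ∧
      ∑ k ∈ Finset.range (D t).m, κ t k ≤ C * (D t).m := by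
  have hφ := hM.φ_pos
  have hc₀ := hc.pos
  obtain ⟨Cb, hCb⟩ := hD.balanced
  set A := fun t (ω : Ω t) => (((D t).m : ℝ)⁻¹ • ∑ i ∈ Finset.range (D t).m,
      ((D t).nbar / (D t).n i) • M.H (D t) i ((S t).b i ω)) with hA
  -- Convergence in probability provides, at every late stage, one realisation whose averaged
  -- diagonal is within 1 of that of `Kbar`: the exceptional events have total probability below 1.
  -- The constants `κ` are computed at that realisation and are therefore deterministic.
  have hω : ∀ᶠ t in atTop, ∃ ω, ∀ k, |A t ω k k - Kbar k k| < 1 := by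
    have hs : Tendsto (fun t => ∑ k, P t {ω | 1 ≤ |A t ω k k - Kbar k k|}) atTop (𝓝 0) := by
      have := tendsto_finsetSum (Finset.univ : Finset (Fin p))
        fun k _ => h2.tendsto_avg k k 1 one_pos
      rw [Finset.sum_const_zero] at this
      exact this
    filter_upwards [hs.eventually (gt_mem_nhds zero_lt_one)] with t ht
    by_contra! hcon
    have hcov : (Set.univ : Set (Ω t)) ⊆ ⋃ k, {ω | 1 ≤ |A t ω k k - Kbar k k|} := fun ω _ => by
      obtain ⟨k, hk⟩ := hcon ω
      exact Set.mem_iUnion.2 ⟨k, hk⟩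
    have := (measure_mono hcov).trans (measure_iUnion_fintype_le (P t) _)
    rw [measure_univ] at this
    exact absurd this (not_le.2 ht)
  have hmain : ∀ᶠ t in atTop, ∃ κ : ℕ → ℝ,
      (∀ k < (D t).m, 0 ≤ κ k ∧ ∀ v, ((D t).n k : ℝ) * ‖v‖ ^ 2 ≤
        κ k * energy (fun j : Fin ((D t).n k) => (D t).x k j) v) ∧
      ∑ k ∈ Finset.range (D t).m, κ k ≤
        (|Cb| * (∑ l, (Kbar l l + 1)) * (M.φ * c)⁻¹) * (D t).m := by
    filter_upwards [hω, hCb, h2.info_invertible, hD.eventually_lt_m 0,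
      hD.nL_tendsto.eventually_gt_atTop 0] with t hω hCb hu hm hL
    obtain ⟨ω, hω⟩ := hω
    have hm' : (0 : ℝ) < (D t).m := by exact_mod_cast hm
    have hL' : (0 : ℝ) < (D t).nL := by exact_mod_cast hL
    have hn : ∀ k < (D t).m, 0 < (D t).n k := fun k hk => hL.trans_le ((D t).nL_le hk)
    have hH : ∀ k < (D t).m, 0 ≤ (M.H (D t) k ((S t).b k ω)).trace := fun k hk =>
      (Model.posDef_H hM hc (hu k hk _)).posSemidef.trace_nonneg
    refine ⟨fun k => (M.H (D t) k ((S t).b k ω)).trace * (M.φ * c)⁻¹, fun k hk => ⟨?_, ?_⟩, ?_⟩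
    · exact mul_nonneg (hH k hk) (by positivity)
    · exact Model.mul_norm_sq_le_trace_H hM hc (hu k hk _) (hn k hk)
    · rw [← Finset.sum_mul, mul_right_comm]
      refine mul_le_mul_of_nonneg_right ?_ (by positivity)
      have hbar : ((D t).nL : ℝ) ≤ (D t).nbar := by
        rw [Design.nbar, le_div_iff₀ hm']
        calc ((D t).nL : ℝ) * (D t).m = ∑ _k ∈ Finset.range (D t).m, ((D t).nL : ℝ) := by
              simp [mul_comm]
          _ ≤ _ := Finset.sum_le_sum fun k hk => by
              exact_mod_cast (D t).nL_le (Finset.mem_range.1 hk)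
      -- Balance gives n_k ≤ C n_L, and n_L is at most the average size, so the weights in the
      -- averaged condition are bounded below and can be removed.
      have hratio : ∀ k < (D t).m, 1 ≤ |Cb| * ((D t).nbar / (D t).n k) := fun k hk => by
        have : (0 : ℝ) < (D t).n k := by exact_mod_cast hn k hk
        rw [← mul_div_assoc, one_le_div this]
        calc ((D t).n k : ℝ) ≤ Cb * (D t).nL := hCb k hk
          _ ≤ |Cb| * (D t).nL := by gcongr; exact le_abs_self _
          _ ≤ _ := by gcongr
      have htr : ∑ l, A t ω l l = ((D t).m : ℝ)⁻¹ * ∑ k ∈ Finset.range (D t).m,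
          ((D t).nbar / (D t).n k) * (M.H (D t) k ((S t).b k ω)).trace := by
        have : ∑ l, A t ω l l = (A t ω).trace := rfl
        rw [this, hA]
        simp only [Matrix.trace_smul, Matrix.trace_sum, smul_eq_mul]
      calc ∑ k ∈ Finset.range (D t).m, (M.H (D t) k ((S t).b k ω)).trace
          ≤ ∑ k ∈ Finset.range (D t).m, |Cb| *
              (((D t).nbar / (D t).n k) * (M.H (D t) k ((S t).b k ω)).trace) :=
            Finset.sum_le_sum fun k hk => by
              rw [← mul_assoc]
              exact le_mul_of_one_le_left (hH k (Finset.mem_range.1 hk))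
                (hratio k (Finset.mem_range.1 hk))
        _ = |Cb| * (∑ l, A t ω l l) * (D t).m := by
            rw [← Finset.mul_sum, htr]
            field_simp
        _ ≤ |Cb| * (∑ l, (Kbar l l + 1)) * (D t).m := by
            gcongr with l
            linarith [(abs_lt.1 (hω l)).2]
  obtain ⟨κ, hκ⟩ := Filter.skolem.1 hmain
  exact ⟨κ, _, hκ⟩

end Curvature

section Limits

lemma C2.aemeasurable_K (h2 : C2 P M D S K Kbar) (hc : CumulantBounds M c) (i : ℕ)
    (k l : Fin p) : AEMeasurable (fun b => K i b k l) (multivariateGaussian 0 M.G) := by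
  refine aemeasurable_of_tendsto_metrizable_ae atTop
    (fun t => (Model.measurable_H (D := D t) (i := i) hc k l).aemeasurable) ?_
  filter_upwards [h2.tendsto_H i] with b hb
  exact ((continuous_id.matrix_elem k l).tendsto (K i b)).comp hb

lemma C2.posSemidef_K (h2 : C2 P M D S K Kbar) (i : ℕ) :
    ∀ᵐ b ∂(multivariateGaussian 0 M.G), (K i b).PosSemidef := by
  obtain ⟨_, _, _, h⟩ := h2.eigen
  filter_upwards [h i] with b hb using hb.1.posSemidef

lemma C2.exists_norm_x_le (h2 : C2 P M D S K Kbar) : ∃ Cx : ℝ, 0 ≤ Cx ∧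
    ∀ t, ∀ k < (D t).m, ∀ j < (D t).n k, ‖(D t).x k j‖ ≤ Cx := by
  obtain ⟨C, hC⟩ := h2.bounded_x
  exact ⟨√(p * C ^ 2), Real.sqrt_nonneg _, fun t k hk j hj =>
    norm_le_of_coord_le fun l => (hC t k hk j hj l).le⟩

/-- Given the random effect, the linearised deviation is asymptotically normal. -/
lemma C2.tendsto_charFun_linDev (h2 : C2 P M D S K Kbar) (hM : M.IsValid)
    (hc : CumulantBounds M c) (hD : Growth D) {b : Vec p}
    (hb : Tendsto (fun t => M.H (D t) i b) atTop (𝓝 (K i b))) (u : Vec p) :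
    Tendsto (fun t => ∫ y, Complex.exp
        ((√((D t).n i : ℝ) * inner ℝ u (M.linDev (D t) i b y) : ℝ) * Complex.I)
          ∂(M.condLaw (D t) i b)) atTop (𝓝 (Real.exp (-matForm (K i b) u u / 2) : ℂ)) := by
  obtain ⟨Cx, hCx, hx⟩ := h2.exists_norm_x_le
  have hform : Continuous fun A : Matrix (Fin p) (Fin p) ℝ =>
      ((Real.exp (-matForm A u u / 2) : ℝ) : ℂ) := by
    simp only [matForm_eq_sum]
    fun_prop
  have hvec : Continuous fun A : Matrix (Fin p) (Fin p) ℝ =>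
      48 * Real.exp (c⁻¹ * M.φ) *
        (M.φ⁻¹ * Cx * ‖(WithLp.toLp 2 (A *ᵥ WithLp.ofLp u) : Vec p)‖) ^ 3
      + ((M.φ⁻¹ * Cx * ‖(WithLp.toLp 2 (A *ᵥ WithLp.ofLp u) : Vec p)‖) ^ 2
        * (M.φ * c⁻¹) / 2) ^ 2 := by
    have h1 : Continuous fun A : Matrix (Fin p) (Fin p) ℝ =>
        (WithLp.toLp 2 (A *ᵥ WithLp.ofLp u) : Vec p) :=
      (PiLp.continuous_toLp 2 _).comp (continuous_id.matrix_mulVec continuous_const)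
    fun_prop
  have hr : Tendsto (fun t => (√((D t).n i : ℝ))⁻¹) atTop (𝓝 0) :=
    tendsto_inv_atTop_zero.comp (Real.tendsto_sqrt_atTop.comp (hD.tendsto_n i))
  -- The error is the inverse root of the cluster size times a continuous function of `H`, and `H`
  -- converges at this `b`.
  have hbound := hr.mul ((hvec.tendsto (K i b)).comp hb)
  rw [zero_mul] at hbound
  have hdiff : Tendsto (fun t => ∫ y, Complex.exp
        ((√((D t).n i : ℝ) * inner ℝ u (M.linDev (D t) i b y) : ℝ) * Complex.I)
          ∂(M.condLaw (D t) i b) - (Real.exp (-matForm (M.H (D t) i b) u u / 2) : ℂ))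
        atTop (𝓝 0) := by
    refine squeeze_zero_norm' ?_ hbound
    filter_upwards [h2.info_invertible, hD.eventually_lt_m i,
      hD.nL_tendsto.eventually_gt_atTop 0] with t hu hi hL
    exact Model.norm_charFun_linDev_sub_le hM hc (hu i hi b) (hL.trans_le ((D t).nL_le hi))
      (hx t i hi) u
  simpa using hdiff.add ((hform.tendsto (K i b)).comp hb)

variable [∀ t, IsProbabilityMeasure (P t)]

/-- The linearised deviation converges to a normal mixture. -/
lemma C2.tendsto_charFun_dev (h2 : C2 P M D S K Kbar) (hM : M.IsValid)
    (hS : ∀ t, IsGLMM (P t) M (D t) (S t))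
    (hc : CumulantBounds M c) (hD : Growth D) (i : ℕ) (u : Vec p) :
    Tendsto (fun t => ∫ ω, Complex.exp
        ((√((D t).n i : ℝ) * inner ℝ u ((S t).dev M (D t) i ω) : ℝ) * Complex.I) ∂(P t)) atTop
      (𝓝 (∫ b, (Real.exp (-matForm (K i b) u u / 2) : ℂ) ∂(multivariateGaussian 0 M.G))) := by
  have h : Tendsto (fun t => ∫ b, ∫ y, Complex.exp
        ((√((D t).n i : ℝ) * inner ℝ u (M.linDev (D t) i b y) : ℝ) * Complex.I)
          ∂(M.condLaw (D t) i b) ∂(multivariateGaussian 0 M.G)) atTop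
      (𝓝 (∫ b, (Real.exp (-matForm (K i b) u u / 2) : ℂ) ∂(multivariateGaussian 0 M.G))) := by
    refine tendsto_integral_of_dominated_convergence (fun _ => 1) (fun t => ?_)
      (integrable_const _) (fun t => ae_of_all _ fun b => ?_) ?_
    · have hm := Model.measurable_linDev (D := D t) (i := i) hc
      exact (Model.stronglyMeasurable_integral_condLaw hM hc (f := fun q => Complex.exp
        ((√((D t).n i : ℝ) * inner ℝ u (M.linDev (D t) i q.1 q.2) : ℝ) * Complex.I))
          (by fun_prop)).aestronglyMeasurable
    · have := Model.isProbabilityMeasure_condLaw (D := D t) (i := i) hM b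
      refine (norm_integral_le_integral_norm _).trans ?_
      simp only [Complex.norm_exp_ofReal_mul_I]
      simp
    · filter_upwards [h2.tendsto_H i] with b hb
      exact h2.tendsto_charFun_linDev hM hc hD hb u
  refine h.congr' ?_
  filter_upwards [hD.eventually_lt_m i] with t hi
  exact ((hS t).integral_exp_inner_dev hM hc hi _ u).symm

/-- The variance factor is `(m - 1) * (s / m) ^ 2`, asymptotically `s ^ 2 / m`. The scales `r` and
`s` are separate so that the deviation can be suppressed by `r = 0`. -/
lemma tendsto_charFun_dev_sub_sum (hM : M.IsValid) (hS : ∀ t, IsGLMM (P t) M (D t) (S t))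
    (hc : CumulantBounds M c) (hD : Growth D) (i : ℕ) (u : Vec p) {r s : ℕ → ℝ} {σ : ℝ} {ℓ : ℂ}
    (hs : Tendsto (fun t => s t ^ 2 / (D t).m) atTop (𝓝 σ))
    (hr : Tendsto (fun t => ∫ ω, Complex.exp
        ((r t * inner ℝ u ((S t).dev M (D t) i ω) : ℝ) * Complex.I) ∂(P t)) atTop (𝓝 ℓ)) :
    Tendsto (fun t => ∫ ω, Complex.exp ((inner ℝ u (r t • (S t).dev M (D t) i ω
        - (s t / (D t).m) • ∑ k ∈ (Finset.range (D t).m).erase i, (S t).b k ω) : ℝ) * Complex.I)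
          ∂(P t)) atTop (𝓝 (ℓ * (Real.exp (-(σ * matForm M.G u u) / 2) : ℝ))) := by
  have h1 : Tendsto (fun t => ((D t).m - 1 : ℝ) * (s t / (D t).m) ^ 2) atTop (𝓝 σ) := by
    have hinv : Tendsto (fun t => ((D t).m : ℝ)⁻¹) atTop (𝓝 0) :=
      tendsto_inv_atTop_zero.comp hD.tendsto_m
    have := (tendsto_const_nhds (x := (1 : ℝ))).sub hinv |>.mul hs
    rw [sub_zero, one_mul] at this
    refine this.congr' ?_
    filter_upwards [hD.eventually_lt_m 0] with t hm
    have : (0 : ℝ) < (D t).m := by exact_mod_cast hm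
    field_simp
  have hcont : Continuous fun τ : ℝ => ((Real.exp (-(τ * matForm M.G u u) / 2) : ℝ) : ℂ) := by
    fun_prop
  refine (hr.mul ((hcont.tendsto σ).comp h1)).congr' ?_
  filter_upwards [hD.eventually_lt_m i] with t hi
  rw [(hS t).integral_exp_inner_dev_sub_sum hM hc hi]
  simp only [Function.comp_apply]
  congr 3
  ring

end Limits

end PQL
end

/-! ### Stochastic bounds for averages and the linearisation in probability. -/

noncomputable section
namespace PQL

variable {p : ℕ}

/-- Because the weights `κ` are deterministic, a uniform bound on the means of `X k` and a bound on
the average weight are enough. -/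
lemma lintegral_abs_average_le {Ω : Type*} [MeasurableSpace Ω] {P : Measure Ω} {m : ℕ}
    {κ : ℕ → ℝ} {X : ℕ → Ω → ℝ} {C : ℝ} {A : ENNReal} (hm : 0 < m) (hκ : ∀ k < m, 0 ≤ κ k)
    (hX : ∀ k ω, 0 ≤ X k ω) (hXm : ∀ k, Measurable (X k))
    (hA : ∀ k < m, ∫⁻ ω, ENNReal.ofReal (X k ω) ∂P ≤ A)
    (hC : ∑ k ∈ Finset.range m, κ k ≤ C * m) :
    ∫⁻ ω, ENNReal.ofReal |(m : ℝ)⁻¹ * ∑ k ∈ Finset.range m, κ k * X k ω| ∂P ≤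
      ENNReal.ofReal C * A := by
  have hm' : (0 : ℝ) < m := by exact_mod_cast hm
  have h0 : ∀ ω, ∀ k ∈ Finset.range m, 0 ≤ κ k * X k ω := fun ω k hk =>
    mul_nonneg (hκ k (Finset.mem_range.1 hk)) (hX k ω)
  have e : ∀ ω, ENNReal.ofReal |(m : ℝ)⁻¹ * ∑ k ∈ Finset.range m, κ k * X k ω| =
      ENNReal.ofReal (m : ℝ)⁻¹ *
        ∑ k ∈ Finset.range m, ENNReal.ofReal (κ k) * ENNReal.ofReal (X k ω) := fun ω => by
    rw [abs_of_nonneg (mul_nonneg (by positivity) (Finset.sum_nonneg (h0 ω))),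
      ENNReal.ofReal_mul (by positivity), ENNReal.ofReal_sum_of_nonneg (h0 ω)]
    congr 1
    exact Finset.sum_congr rfl fun k hk => ENNReal.ofReal_mul (hκ k (Finset.mem_range.1 hk))
  simp_rw [e]
  have hmeas : ∀ k, Measurable fun ω => ENNReal.ofReal (X k ω) := fun k => (hXm k).ennreal_ofReal
  rw [lintegral_const_mul _ (Finset.measurable_fun_sum _ fun k _ => (hmeas k).const_mul _),
    lintegral_finsetSum _ fun k _ => (hmeas k).const_mul _]
  calc ENNReal.ofReal (m : ℝ)⁻¹ * ∑ k ∈ Finset.range m,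
        ∫⁻ ω, ENNReal.ofReal (κ k) * ENNReal.ofReal (X k ω) ∂P
      ≤ ENNReal.ofReal (m : ℝ)⁻¹ * ∑ k ∈ Finset.range m, ENNReal.ofReal (κ k) * A := by
        gcongr with k hk
        rw [lintegral_const_mul _ (hmeas k)]
        gcongr
        exact hA k (Finset.mem_range.1 hk)
    _ = ENNReal.ofReal ((m : ℝ)⁻¹ * ∑ k ∈ Finset.range m, κ k) * A := by
        rw [← Finset.sum_mul, ← ENNReal.ofReal_sum_of_nonneg
          fun k hk => hκ k (Finset.mem_range.1 hk), ← mul_assoc,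
          ← ENNReal.ofReal_mul (by positivity)]
    _ ≤ ENNReal.ofReal C * A := by
        gcongr
        rw [← div_eq_inv_mul, div_le_iff₀ hm']
        exact hC

lemma lintegral_norm_sq_gaussian_lt_top (A : Matrix (Fin p) (Fin p) ℝ) :
    ∫⁻ b : Vec p, ENNReal.ofReal (‖b‖ ^ 2) ∂(multivariateGaussian 0 A) < ⊤ := by
  have h : MemLp (id : Vec p → Vec p) 2 (multivariateGaussian 0 A) := IsGaussian.memLp_two_id
  have := (h.integrable_norm_pow two_ne_zero).2
  rwa [hasFiniteIntegral_iff_ofReal (ae_of_all _ fun b => by positivity)] at this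

variable {Ω : ℕ → Type*} [∀ t, MeasurableSpace (Ω t)] {P : ∀ t, Measure (Ω t)}
  {M : Model p} {D : ℕ → Design p} {S : ∀ t, Sample p (Ω t)} {F : ∀ t, Fit p (Ω t)}
  {K : ℕ → Vec p → Matrix (Fin p) (Fin p) ℝ} {Kbar : Matrix (Fin p) (Fin p) ℝ} {c : ℝ} {i : ℕ}

lemma C4.stochBounded_penaltySize (h4 : C4 P F) :
    StochBounded P fun t ω => penaltySize (F t) ω := by
  refine (StochBounded.sum Finset.univ fun k => StochBounded.sum Finset.univ fun l =>
    h4.bounded_φhat.mul (h4.bounded_Ghat_inv k l)).mono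
      (Eventually.of_forall fun t ω => le_of_eq ?_)
  rw [penaltySize]
  congr 1
  refine Finset.sum_congr rfl fun k _ => ?_
  rw [abs_of_nonneg (Finset.sum_nonneg fun _ _ => abs_nonneg _)]
  simp [penalty]

section Averages

variable {κ : ℕ → ℕ → ℝ} {C : ℝ}

lemma stochBounded_average_norm_b_sq (hM : M.IsValid) (hS : ∀ t, IsGLMM (P t) M (D t) (S t))
    (hc : CumulantBounds M c) (hD : Growth D)
    (hκ : ∀ᶠ t in atTop, (∀ k < (D t).m, 0 ≤ κ t k) ∧
      ∑ k ∈ Finset.range (D t).m, κ t k ≤ C * (D t).m) :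
    StochBounded P fun t ω => ((D t).m : ℝ)⁻¹ *
      ∑ k ∈ Finset.range (D t).m, κ t k * ‖(S t).b k ω‖ ^ 2 := by
  have hb := fun t k => (hS t).measurable_b k
  refine stochBounded_of_lintegral_le (ENNReal.mul_ne_top (ENNReal.ofReal_ne_top (r := C))
    (lintegral_norm_sq_gaussian_lt_top M.G).ne) (fun t => by fun_prop) ?_
  filter_upwards [hκ, hD.eventually_lt_m 0] with t hκ hm
  exact lintegral_abs_average_le hm hκ.1 (fun _ _ => by positivity) (fun k => by fun_prop)
    (fun k hk => ((hS t).lintegral_norm_b_sq hM hc hk).le) hκ.2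

lemma stochBounded_average_devEnergy (hM : M.IsValid) (hS : ∀ t, IsGLMM (P t) M (D t) (S t))
    (hc : CumulantBounds M c) (hD : Growth D)
    (hu : ∀ᶠ t in atTop, ∀ k < (D t).m, ∀ b, IsUnit (M.info (D t) k b))
    (hκ : ∀ᶠ t in atTop, (∀ k < (D t).m, 0 ≤ κ t k) ∧
      ∑ k ∈ Finset.range (D t).m, κ t k ≤ C * (D t).m) :
    StochBounded P fun t ω => ((D t).m : ℝ)⁻¹ *
      ∑ k ∈ Finset.range (D t).m, κ t k * (S t).devEnergy M (D t) k ω := by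
  have hq := fun t k => (hS t).measurable_devEnergy hc k
  refine stochBounded_of_lintegral_le (ENNReal.mul_ne_top (ENNReal.ofReal_ne_top (r := C))
    (ENNReal.ofReal_ne_top (r := c⁻¹ * (M.φ * p)))) (fun t => by fun_prop) ?_
  filter_upwards [hκ, hu, hD.eventually_lt_m 0, hD.nL_tendsto.eventually_gt_atTop 0]
    with t hκ hu hm hL
  exact lintegral_abs_average_le hm hκ.1 (fun _ _ => energy_nonneg _ _) (hq t)
    (fun k hk => (hS t).lintegral_devEnergy_le hM hc hk (hL.trans_le ((D t).nL_le hk)) (hu k hk))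
    hκ.2

lemma stochBounded_norm_b_sq (hM : M.IsValid) (hS : ∀ t, IsGLMM (P t) M (D t) (S t))
    (hc : CumulantBounds M c) (hD : Growth D) (i : ℕ) :
    StochBounded P fun t ω => ‖(S t).b i ω‖ ^ 2 := by
  have hb := fun t k => (hS t).measurable_b k
  refine stochBounded_of_lintegral_le (lintegral_norm_sq_gaussian_lt_top M.G).ne
    (fun t => by fun_prop) ?_
  filter_upwards [hD.eventually_lt_m i] with t hi
  simp_rw [abs_sq]
  exact ((hS t).lintegral_norm_b_sq hM hc hi).le

lemma stochBounded_devEnergy (hM : M.IsValid) (hS : ∀ t, IsGLMM (P t) M (D t) (S t))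
    (hc : CumulantBounds M c) (hD : Growth D)
    (hu : ∀ᶠ t in atTop, ∀ k < (D t).m, ∀ b, IsUnit (M.info (D t) k b)) (i : ℕ) :
    StochBounded P fun t ω => (S t).devEnergy M (D t) i ω := by
  refine stochBounded_of_lintegral_le (C := ENNReal.ofReal (c⁻¹ * (M.φ * p)))
    ENNReal.ofReal_ne_top (fun t => (hS t).measurable_devEnergy hc i) ?_
  filter_upwards [hu, hD.eventually_lt_m i, hD.nL_tendsto.eventually_gt_atTop 0] with t hu hi hL
  have h0 : ∀ ω, 0 ≤ (S t).devEnergy M (D t) i ω := fun ω => energy_nonneg _ _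
  simp_rw [fun ω => abs_of_nonneg (h0 ω)]
  exact (hS t).lintegral_devEnergy_le hM hc hi (hL.trans_le ((D t).nL_le hi)) (hu i hi)

/-- The normalisation n_L/m reflects independence: the second moment of the sum is at most a
multiple of the sum of the `κ t k` divided by n_L. -/
lemma stochBounded_norm_sum_dev_sq [∀ t, IsProbabilityMeasure (P t)] (hM : M.IsValid)
    (hS : ∀ t, IsGLMM (P t) M (D t) (S t)) (hc : CumulantBounds M c) (hD : Growth D)
    (hu : ∀ᶠ t in atTop, ∀ k < (D t).m, ∀ b, IsUnit (M.info (D t) k b))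
    (hκ : ∀ᶠ t in atTop, (∀ k < (D t).m, 0 ≤ κ t k ∧ ∀ v, ((D t).n k : ℝ) * ‖v‖ ^ 2 ≤
        κ t k * energy (fun j : Fin ((D t).n k) => (D t).x k j) v) ∧
      ∑ k ∈ Finset.range (D t).m, κ t k ≤ C * (D t).m) :
    StochBounded P fun t ω => (D t).nL / (D t).m *
      ‖∑ k ∈ Finset.range (D t).m, (S t).dev M (D t) k ω‖ ^ 2 := by
  have hφ := hM.φ_pos
  have hc₀ := hc.pos
  have hd := fun t k => (hS t).measurable_dev hc k
  refine stochBounded_of_lintegral_le (C := ENNReal.ofReal (C * (c⁻¹ * (M.φ * p))))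
    ENNReal.ofReal_ne_top (fun t => by fun_prop) ?_
  filter_upwards [hκ, hu, hD.eventually_lt_m 0, hD.nL_tendsto.eventually_gt_atTop 0]
    with t hκ hu hm hL
  have hm' : (0 : ℝ) < (D t).m := by exact_mod_cast hm
  have hL' : (0 : ℝ) < (D t).nL := by exact_mod_cast hL
  have hn : ∀ k < (D t).m, 0 < (D t).n k := fun k hk => hL.trans_le ((D t).nL_le hk)
  have h0 : ∀ ω, 0 ≤ (D t).nL / (D t).m *
      ‖∑ k ∈ Finset.range (D t).m, (S t).dev M (D t) k ω‖ ^ 2 := fun ω => by positivity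
  simp_rw [fun ω => abs_of_nonneg (h0 ω)]
  rw [← ofReal_integral_eq_lintegral_ofReal
    (((hS t).integrable_norm_sum_dev_sq hM hc hn hu).const_mul _) (ae_of_all _ h0)]
  refine ENNReal.ofReal_le_ofReal ?_
  rw [integral_const_mul]
  calc (D t).nL / (D t).m * ∫ ω, ‖∑ k ∈ Finset.range (D t).m, (S t).dev M (D t) k ω‖ ^ 2 ∂(P t)
      ≤ (D t).nL / (D t).m * ∑ k ∈ Finset.range (D t).m,
          ((D t).n k : ℝ)⁻¹ * κ t k * (c⁻¹ * (M.φ * p)) := by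
        gcongr
        exact (hS t).integral_norm_sum_dev_sq_le hM hc hn hu (fun k hk => (hκ.1 k hk).1)
          fun k hk => (hκ.1 k hk).2
    _ ≤ (D t).nL / (D t).m * ∑ k ∈ Finset.range (D t).m,
          ((D t).nL : ℝ)⁻¹ * κ t k * (c⁻¹ * (M.φ * p)) := by
        gcongr with k hk
        · exact (hκ.1 k (Finset.mem_range.1 hk)).1
        · exact (D t).nL_le (Finset.mem_range.1 hk)
    _ = (∑ k ∈ Finset.range (D t).m, κ t k) / (D t).m * (c⁻¹ * (M.φ * p)) := by
        rw [← Finset.sum_mul, ← Finset.mul_sum]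
        field_simp
    _ ≤ C * (c⁻¹ * (M.φ * p)) := by
        gcongr
        rw [div_le_iff₀ hm']
        exact hκ.2

end Averages

section Linearisation

variable [∀ t, IsProbabilityMeasure (P t)]

/-- The predicted random effect, at a scale `s`, is asymptotically the sum of the linearised
deviation of its cluster and of the average of the other random effects. -/
lemma tendstoInProb_linearisation (hM : M.IsValid) (hS : ∀ t, IsGLMM (P t) M (D t) (S t))
    (hF : ∀ t, IsPQL (P t) M (D t) (S t) (F t)) (hD : Growth D) (hc : CumulantBounds M c)
    (h2 : C2 P M D S K Kbar) (h4 : C4 P F) (i : ℕ) {s r : ℕ → ℝ} (hs₀ : ∀ t, 0 ≤ s t)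
    (hs1 : Tendsto (fun t => s t / (D t).nL) atTop (𝓝 0))
    (hs2 : Tendsto (fun t => s t ^ 2 / ((D t).m * (D t).nL)) atTop (𝓝 0))
    (hs3 : Tendsto (fun t => (s t - r t) ^ 2 / (D t).n i) atTop (𝓝 0))
    (hs4 : Tendsto (fun t => s t / (D t).m) atTop (𝓝 0)) :
    TendstoInProb P (fun t ω => ‖s t • ((F t).bhat i ω - (S t).b i ω)
      - (r t • (S t).dev M (D t) i ω
        - (s t / (D t).m) • ∑ k ∈ (Finset.range (D t).m).erase i, (S t).b k ω)‖) 0 := by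
  obtain ⟨κ, C, hκ⟩ := h2.exists_curvature hM hc hD
  obtain ⟨κi, Ci, hκi⟩ := h2.exists_curvature_single hM hc hD i
  obtain ⟨Cx, hCx, hx⟩ := h2.exists_norm_x_le
  have hc₀ := hc.pos
  have hκ' : ∀ᶠ t in atTop, (∀ k < (D t).m, 0 ≤ κ t k) ∧
      ∑ k ∈ Finset.range (D t).m, κ t k ≤ C * (D t).m :=
    hκ.mono fun t h => ⟨fun k hk => (h.1 k hk).1, h.2⟩
  have h1 : ∀ᶠ t in atTop, (∀ k < (D t).m, 0 ≤ (1 : ℝ)) ∧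
      ∑ k ∈ Finset.range (D t).m, (1 : ℝ) ≤ 1 * (D t).m :=
    Eventually.of_forall fun t => ⟨fun _ _ => zero_le_one, by simp⟩
  have hu := h2.info_invertible
  have hU : ∀ k, StochBounded P ((![fun t ω => penaltySize (F t) ω,
      fun t ω => ((D t).m : ℝ)⁻¹ *
        ∑ k ∈ Finset.range (D t).m, κ t k * (S t).devEnergy M (D t) k ω,
      fun t ω => ((D t).m : ℝ)⁻¹ *
        ∑ k ∈ Finset.range (D t).m, κ t k * ‖(S t).b k ω‖ ^ 2,
      fun t ω => ((D t).m : ℝ)⁻¹ * ∑ k ∈ Finset.range (D t).m, 1 * ‖(S t).b k ω‖ ^ 2,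
      fun t ω => (S t).devEnergy M (D t) i ω,
      fun t ω => ‖(S t).b i ω‖ ^ 2,
      fun t ω => (D t).nL / (D t).m *
        ‖∑ k ∈ Finset.range (D t).m, (S t).dev M (D t) k ω‖ ^ 2] :
      Fin 7 → ∀ t, Ω t → ℝ) k) := by
    intro k
    fin_cases k
    · exact h4.stochBounded_penaltySize
    · exact stochBounded_average_devEnergy hM hS hc hD hu hκ'
    · exact stochBounded_average_norm_b_sq hM hS hc hD hκ'
    · exact stochBounded_average_norm_b_sq hM hS hc hD h1
    · exact stochBounded_devEnergy hM hS hc hD hu i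
    · exact stochBounded_norm_b_sq hM hS hc hD i
    · exact stochBounded_norm_sum_dev_sq hM hS hc hD hu hκ
  refine tendstoInProb_zero_of_stochBounded hU fun L ε hε => ?_
  -- One constant dominating `L`, `C`, `Ci` and `Ci * L`, so that it can serve for every bound
  -- required below.
  set L' := |C| + |Ci| + (1 + |Ci|) * |L| with hL'
  set B := linBound c (Cx * (c ^ 2)⁻¹ + 1) L' with hB
  -- The four terms bound, in order, the linearisation errors, the average of all linearised
  -- deviations, the change of scale from `s` to `r`, and the share of `b i` in the average of the
  -- random effects.
  have hlim : Tendsto (fun t => 2 * B * (s t / (D t).nL)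
      + √(s t ^ 2 / ((D t).m * (D t).nL) * L) + √((s t - r t) ^ 2 / (D t).n i * L')
      + s t / (D t).m * √L) atTop (𝓝 0) := by
    have hsq : ∀ {f : ℕ → ℝ} (A : ℝ), Tendsto f atTop (𝓝 0) →
        Tendsto (fun t => √(f t * A)) atTop (𝓝 0) := fun A hf => by
      have := (hf.mul_const A).sqrt
      rwa [zero_mul, Real.sqrt_zero] at this
    simpa using ((hs1.const_mul (2 * B)).add (hsq L hs2)).add (hsq L' hs3) |>.add
      (hs4.mul_const √L)
  filter_upwards [hκ, hκi, hu, hD.eventually_lt_m i, hD.nL_tendsto.eventually_gt_atTop 0,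
    hD.tendsto_nL.eventually_ge_atTop (1 / c), hD.tendsto_nL.eventually_ge_atTop (8 * L' ^ 2 / c),
    hlim.eventually (gt_mem_nhds hε)] with t hκ hκi hu hi hN0 hN1 hN2 hlt
  filter_upwards [(hF t).isMax, h4.posDef_Ghat t, h4.φhat_pos t] with ω hmax hG hφ hbd
  have b0 : |penaltySize (F t) ω| ≤ L := hbd 0
  have b1 : |((D t).m : ℝ)⁻¹ * ∑ k ∈ Finset.range (D t).m,
    κ t k * (S t).devEnergy M (D t) k ω| ≤ L := hbd 1
  have b2 : |((D t).m : ℝ)⁻¹ * ∑ k ∈ Finset.range (D t).m, κ t k * ‖(S t).b k ω‖ ^ 2| ≤ L := hbd 2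
  have b3 : |((D t).m : ℝ)⁻¹ * ∑ k ∈ Finset.range (D t).m, 1 * ‖(S t).b k ω‖ ^ 2| ≤ L := hbd 3
  have b4 : |(S t).devEnergy M (D t) i ω| ≤ L := hbd 4
  have b5 : |‖(S t).b i ω‖ ^ 2| ≤ L := hbd 5
  have b6 : |(D t).nL / (D t).m *
    ‖∑ k ∈ Finset.range (D t).m, (S t).dev M (D t) k ω‖ ^ 2| ≤ L := hbd 6
  have hm : (0 : ℝ) < (D t).m := by exact_mod_cast Nat.zero_lt_of_lt hi
  have hN : (0 : ℝ) < (D t).nL := by exact_mod_cast hN0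
  have hn : 0 < (D t).n i := hN0.trans_le ((D t).nL_le hi)
  have hn' : (0 : ℝ) < (D t).n i := by exact_mod_cast hn
  have hL0 : 0 ≤ L := (abs_nonneg _).trans b0
  rw [abs_of_nonneg hL0] at hL'
  have hLL' : L ≤ L' := by
    have := mul_nonneg (abs_nonneg Ci) hL0
    rw [hL']; linarith [abs_nonneg C, abs_nonneg Ci]
  have hCL : C ≤ L' := by
    have := mul_nonneg (abs_nonneg Ci) hL0
    rw [hL']; linarith [le_abs_self C, abs_nonneg Ci]
  have hCiL : Ci ≤ L' := by
    have := mul_nonneg (abs_nonneg Ci) hL0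
    rw [hL']; linarith [le_abs_self Ci, abs_nonneg C]
  have havg : ∀ {x : ℝ}, |((D t).m : ℝ)⁻¹ * x| ≤ L → x ≤ L' * (D t).m := fun {x} hx => by
    rw [← div_le_iff₀ hm, div_eq_inv_mul]
    exact ((le_abs_self _).trans hx).trans hLL'
  have hone : ∀ {x : ℝ}, |x| ≤ L → κi t * x ≤ L' := fun {x} hx => by
    calc κi t * x ≤ κi t * L := mul_le_mul_of_nonneg_left ((le_abs_self _).trans hx) hκi.1
      _ ≤ |Ci| * L := mul_le_mul_of_nonneg_right (hκi.2.1.trans (le_abs_self _)) hL0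
      _ ≤ L' := by rw [hL']; linarith [abs_nonneg C, abs_nonneg Ci]
  have hrem := IsMaxAt.norm_bhat_sub_le (M := M) (D := D t) (S := S t) (F := F t) (ω := ω)
    ⟨hG, hφ, hmax⟩ hM hc (N := (D t).nL) (L := L') (κi := κi t) (κ := κ t) hi (hx t) hCx
    (fun k hk => by exact_mod_cast (D t).nL_le hk) (by rwa [div_le_iff₀' hc₀] at hN1)
    (by rwa [div_le_iff₀' hc₀] at hN2) hu (fun k hk => (hκ.1 k hk).1) (fun k hk => (hκ.1 k hk).2)
    hκi.1 hκi.2.2 (((le_abs_self _).trans b0).trans hLL')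
    (hκ.2.trans (mul_le_mul_of_nonneg_right hCL hm.le)) (havg b1) (havg b2)
    (by simpa using havg b3) (hκi.2.1.trans hCiL) (hone b4) (hone b5)
  rw [abs_norm]
  refine lt_of_le_of_lt ?_ hlt
  have hsplit : s t • ((F t).bhat i ω - (S t).b i ω) - (r t • (S t).dev M (D t) i ω
        - (s t / (D t).m) • ∑ k ∈ (Finset.range (D t).m).erase i, (S t).b k ω) =
      s t • ((F t).bhat i ω - (S t).b i ω - ((S t).dev M (D t) i ω
        - ((D t).m : ℝ)⁻¹ • ∑ k ∈ Finset.range (D t).m, (S t).b k ω))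
      + (s t - r t) • (S t).dev M (D t) i ω - (s t / (D t).m) • (S t).b i ω := by
    rw [← Finset.add_sum_erase _ _ (Finset.mem_range.2 hi), div_eq_mul_inv]
    module
  rw [hsplit]
  refine (norm_sub_le _ _).trans (add_le_add ((norm_add_le _ _).trans (add_le_add ?_ ?_)) ?_)
  · rw [norm_smul, Real.norm_of_nonneg (hs₀ t)]
    refine (mul_le_mul_of_nonneg_left hrem (hs₀ t)).trans ?_
    rw [mul_add]
    refine add_le_add (le_of_eq (by rw [hB]; ring)) (Real.le_sqrt_of_sq_le ?_)
    rw [abs_of_nonneg (by positivity)] at b6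
    calc (s t * (((D t).m : ℝ)⁻¹ * ‖∑ k ∈ Finset.range (D t).m, (S t).dev M (D t) k ω‖)) ^ 2
        = s t ^ 2 / ((D t).m * (D t).nL) * ((D t).nL / (D t).m *
          ‖∑ k ∈ Finset.range (D t).m, (S t).dev M (D t) k ω‖ ^ 2) := by field_simp
      _ ≤ _ := by gcongr
  · refine Real.le_sqrt_of_sq_le ?_
    rw [norm_smul, mul_pow, Real.norm_eq_abs, sq_abs]
    calc (s t - r t) ^ 2 * ‖(S t).dev M (D t) i ω‖ ^ 2
        ≤ (s t - r t) ^ 2 * (((D t).n i : ℝ)⁻¹ * κi t * (S t).devEnergy M (D t) i ω) := by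
          gcongr
          exact IsGLMM.norm_dev_sq_le hn hκi.2.2 ω
      _ = (s t - r t) ^ 2 / (D t).n i * (κi t * (S t).devEnergy M (D t) i ω) := by ring
      _ ≤ _ := mul_le_mul_of_nonneg_left (hone b4) (by positivity)
  · rw [norm_smul, Real.norm_of_nonneg (div_nonneg (hs₀ t) hm.le)]
    refine mul_le_mul_of_nonneg_left (Real.le_sqrt_of_sq_le ?_) (div_nonneg (hs₀ t) hm.le)
    exact (le_abs_self _).trans b5

end Linearisation

end PQL
end

/-! ### Limit laws in the three regimes. -/

noncomputable section
namespace PQL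

variable {p : ℕ} {Ω : ℕ → Type*} [∀ t, MeasurableSpace (Ω t)] {P : ∀ t, Measure (Ω t)}
  [∀ t, IsProbabilityMeasure (P t)]
  {M : Model p} {D : ℕ → Design p} {S : ∀ t, Sample p (Ω t)} {F : ∀ t, Fit p (Ω t)}
  {K : ℕ → Vec p → Matrix (Fin p) (Fin p) ℝ} {Kbar : Matrix (Fin p) (Fin p) ℝ}

lemma tendsto_sqrt_div_zero {f g : ℕ → ℝ} (hg : ∀ t, 0 ≤ g t)
    (h : Tendsto (fun t => f t / g t ^ 2) atTop (𝓝 0)) :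
    Tendsto (fun t => √(f t) / g t) atTop (𝓝 0) := by
  have := h.sqrt
  rw [Real.sqrt_zero] at this
  refine this.congr fun t => ?_
  rw [Real.sqrt_div' _ (sq_nonneg _), Real.sqrt_sq (hg t)]

/-- The limit law of the predicted random effect at the scale of the square root of the cluster
size, when the ratio of the cluster size and the number of clusters converges. -/
lemma tendstoInLaw_sqrt_n (hM : M.IsValid) (hS : ∀ t, IsGLMM (P t) M (D t) (S t))
    (hF : ∀ t, IsPQL (P t) M (D t) (S t) (F t)) (hD : Growth D) (h1 : C1 M)
    (h2 : C2 P M D S K Kbar) (h4 : C4 P F) (i : ℕ) {σ : ℝ}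
    (hσ : Tendsto (fun t => ((D t).n i : ℝ) / (D t).m) atTop (𝓝 σ)) {μ : Measure (Vec p)}
    (hμ : IsProbabilityMeasure μ)
    (hchar : ∀ u, charFun μ u = charFun (mixN (fun _ => 0) (K i) (multivariateGaussian 0 M.G)) u *
      (Real.exp (-(σ * matForm M.G u u) / 2) : ℝ)) :
    TendstoInLaw P (fun t ω => √((D t).n i : ℝ) • ((F t).bhat i ω - (S t).b i ω)) μ := by
  obtain ⟨c, hc⟩ := h1.cumulantBounds
  obtain ⟨C, hC⟩ := hD.balanced
  have hinvL : Tendsto (fun t => ((D t).nL : ℝ)⁻¹) atTop (𝓝 0) :=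
    tendsto_inv_atTop_zero.comp hD.tendsto_nL
  have hinvm : Tendsto (fun t => ((D t).m : ℝ)⁻¹) atTop (𝓝 0) :=
    tendsto_inv_atTop_zero.comp hD.tendsto_m
  have hsq : ∀ t, √((D t).n i : ℝ) ^ 2 = (D t).n i := fun t => Real.sq_sqrt (Nat.cast_nonneg _)
  refine tendstoInLaw_of_tendsto_charFun hμ (V := fun t ω => √((D t).n i : ℝ) •
      (S t).dev M (D t) i ω - (√((D t).n i : ℝ) / (D t).m) •
        ∑ k ∈ (Finset.range (D t).m).erase i, (S t).b k ω) (fun t => ?_) (fun t => ?_) ?_ ?_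
  · have := (hF t).measurable_bhat i
    have := (hS t).measurable_b i
    fun_prop
  · have := (hS t).measurable_dev hc i
    have := (hS t).measurable_b
    fun_prop
  · refine tendstoInProb_linearisation hM hS hF hD hc h2 h4 i (fun t => Real.sqrt_nonneg _)
      ?_ ?_ ?_ ?_
    · refine tendsto_sqrt_div_zero (fun t => Nat.cast_nonneg _) ?_
      -- By balance n_i/n_L² is at most C/n_L.
      have h0 : Tendsto (fun t => C * ((D t).nL : ℝ)⁻¹) atTop (𝓝 0) := by
        simpa using hinvL.const_mul C
      refine squeeze_zero' (Eventually.of_forall fun t => by positivity) ?_ h0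
      filter_upwards [hC, hD.eventually_lt_m i, hD.nL_tendsto.eventually_gt_atTop 0]
        with t hC hi hL
      have hL' : (0 : ℝ) < (D t).nL := by exact_mod_cast hL
      rw [div_le_iff₀ (by positivity)]
      refine (hC i hi).trans (le_of_eq ?_)
      field_simp
    · simp_rw [hsq]
      have := hσ.mul hinvL
      rw [mul_zero] at this
      refine this.congr fun t => ?_
      rw [← div_eq_mul_inv, div_div]
    · simp
    · refine tendsto_sqrt_div_zero (fun t => Nat.cast_nonneg _) ?_
      have := hσ.mul hinvm
      rw [mul_zero] at this
      refine this.congr fun t => ?_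
      rw [← div_eq_mul_inv, div_div, sq]
  · intro u
    rw [hchar, charFun_mixN (h2.aemeasurable_K hc i) (h2.posSemidef_K i)]
    refine tendsto_charFun_dev_sub_sum hM hS hc hD i u ?_ (h2.tendsto_charFun_dev hM hS hc hD i u)
    simpa only [hsq] using hσ

/-- The limit law of the predicted random effect at the scale of the square root of the number of
clusters, when the latter is of smaller order than the cluster size. -/
lemma tendstoInLaw_sqrt_m (hM : M.IsValid) (hS : ∀ t, IsGLMM (P t) M (D t) (S t))
    (hF : ∀ t, IsPQL (P t) M (D t) (S t) (F t)) (hD : Growth D) (h1 : C1 M)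
    (h2 : C2 P M D S K Kbar) (h4 : C4 P F)
    (hmn : Tendsto (fun t => ((D t).m : ℝ) / ((D t).nL : ℝ) ^ 2) atTop (𝓝 0)) (i : ℕ)
    (hσ : Tendsto (fun t => ((D t).m : ℝ) / (D t).n i) atTop (𝓝 0)) :
    TendstoInLaw P (fun t ω => √((D t).m : ℝ) • ((F t).bhat i ω - (S t).b i ω))
      (multivariateGaussian 0 M.G) := by
  obtain ⟨c, hc⟩ := h1.cumulantBounds
  have hinvL : Tendsto (fun t => ((D t).nL : ℝ)⁻¹) atTop (𝓝 0) :=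
    tendsto_inv_atTop_zero.comp hD.tendsto_nL
  have hinvm : Tendsto (fun t => ((D t).m : ℝ)⁻¹) atTop (𝓝 0) :=
    tendsto_inv_atTop_zero.comp hD.tendsto_m
  have hsq : ∀ t, √((D t).m : ℝ) ^ 2 = (D t).m := fun t => Real.sq_sqrt (Nat.cast_nonneg _)
  have hm : ∀ᶠ t in atTop, ((D t).m : ℝ) ≠ 0 := by
    filter_upwards [hD.eventually_lt_m 0] with t ht
    exact_mod_cast ht.ne'
  -- The deviation gets scale 0: its size at scale √m is governed by m/n_i → 0.
  refine tendstoInLaw_of_tendsto_charFun inferInstance (V := fun t ω => (0 : ℝ) •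
      (S t).dev M (D t) i ω - (√((D t).m : ℝ) / (D t).m) •
        ∑ k ∈ (Finset.range (D t).m).erase i, (S t).b k ω) (fun t => ?_) (fun t => ?_) ?_ ?_
  · have := (hF t).measurable_bhat i
    have := (hS t).measurable_b i
    fun_prop
  · have := (hS t).measurable_dev hc i
    have := (hS t).measurable_b
    fun_prop
  · refine tendstoInProb_linearisation hM hS hF hD hc h2 h4 i (r := fun _ => 0)
      (fun t => Real.sqrt_nonneg _) (tendsto_sqrt_div_zero (fun t => Nat.cast_nonneg _) hmn)
      ?_ ?_ ?_
    · refine hinvL.congr' ?_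
      filter_upwards [hm] with t ht
      rw [hsq, div_mul_cancel_left₀ ht]
    · simpa only [sub_zero, hsq] using hσ
    · refine tendsto_sqrt_div_zero (fun t => Nat.cast_nonneg _) (hinvm.congr' ?_)
      filter_upwards [hm] with t ht
      rw [sq, div_mul_cancel_left₀ ht]
  · intro u
    -- With `r = 0` the deviation contributes the constant 1, and `s ^ 2 / m` is eventually equal to
    -- 1.
    have := tendsto_charFun_dev_sub_sum (σ := 1) (ℓ := 1) (r := fun _ => 0)
      (s := fun t => √((D t).m : ℝ)) hM hS hc hD i u ?_ ?_
    · rw [charFun_gaussian_zero hM.posSemidef_G]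
      simpa only [one_mul] using this
    · refine tendsto_const_nhds.congr' ?_
      filter_upwards [hm] with t ht
      rw [hsq, div_self ht]
    · simp

end PQL
end

theorem theorem4 {p : ℕ} {Ω : ℕ → Type*} [∀ t, MeasurableSpace (Ω t)]
    (P : ∀ t, Measure (Ω t)) [∀ t, IsProbabilityMeasure (P t)]
    (M : PQL.Model p) (D : ℕ → PQL.Design p)
    (S : ∀ t, PQL.Sample p (Ω t)) (F : ∀ t, PQL.Fit p (Ω t))
    (K : ℕ → PQL.Vec p → Matrix (Fin p) (Fin p) ℝ) (Kbar : Matrix (Fin p) (Fin p) ℝ)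
    (hM : M.IsValid)
    (hS : ∀ t, PQL.IsGLMM (P t) M (D t) (S t))
    (hF : ∀ t, PQL.IsPQL (P t) M (D t) (S t) (F t))
    (hD : PQL.Growth D)
    (h1 : PQL.C1 M) (h2 : PQL.C2 P M D S K Kbar) (h3 : PQL.C3 M D S)
    (h4 : PQL.C4 P F) (h5 : PQL.C5 P M D S F)
    (hmn : Tendsto (fun t => ((D t).m : ℝ) / ((D t).nL : ℝ) ^ 2) atTop (𝓝 0)) (i : ℕ) :
    (Tendsto (fun t => ((D t).m : ℝ) / (D t).n i) atTop atTop →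
      PQL.TendstoInLaw P
        (fun t ω => √((D t).n i : ℝ) • ((F t).bhat i ω - (S t).b i ω))
        (PQL.mixN (fun _ => 0) (K i) (multivariateGaussian 0 M.G))) ∧
    (∀ γ : ℝ, 0 < γ → Tendsto (fun t => ((D t).m : ℝ) / (D t).n i) atTop (𝓝 γ) →
      PQL.TendstoInLaw P
        (fun t ω => √((D t).n i : ℝ) • ((F t).bhat i ω - (S t).b i ω))
        ((PQL.mixN (fun _ => 0) (K i) (multivariateGaussian 0 M.G)).conv
          (multivariateGaussian 0 (γ⁻¹ • M.G)))) ∧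
    (Tendsto (fun t => ((D t).m : ℝ) / (D t).n i) atTop (𝓝 0) →
      PQL.TendstoInLaw P
        (fun t ω => √((D t).m : ℝ) • ((F t).bhat i ω - (S t).b i ω))
        (multivariateGaussian 0 M.G)) := by
  obtain ⟨c, hc⟩ := h1.cumulantBounds
  have hmix := PQL.isProbabilityMeasure_mixN (h2.aemeasurable_K hc i)
  refine ⟨fun hm => ?_, fun γ hγ hm => ?_, fun hm =>
    PQL.tendstoInLaw_sqrt_m hM hS hF hD h1 h2 h4 hmn i hm⟩
  -- Here n_i/m → 0, so the Gaussian factor is trivial.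
  · refine PQL.tendstoInLaw_sqrt_n hM hS hF hD h1 h2 h4 i (σ := 0) ?_ hmix fun u => by simp
    simpa [Function.comp_def] using tendsto_inv_atTop_zero.comp hm
  -- The factor with variance ratio `γ⁻¹` is the characteristic function of the second member of the
  -- convolution.
  · refine PQL.tendstoInLaw_sqrt_n hM hS hF hD h1 h2 h4 i (σ := γ⁻¹) ?_ inferInstance fun u => ?_
    · simpa using hm.inv₀ hγ.ne'
    · rw [charFun_conv, PQL.charFun_gaussian_zero
        (hM.posSemidef_G.smul (inv_nonneg.2 hγ.le)) u]
      congr 4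
      simp [PQL.matForm_apply, Matrix.smul_mulVec, dotProduct_smul]
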